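/- Let $\Bbbk$ be a field, $V$ a finite-dimensional $\Bbbk$-vector space and $G\le GL(V)$ a finite group. **Reflections.** Let $\mathcal S=\{s\in G:\dim(1-s)V=1\}$. For $s\in\mathcal S$ choose $\alpha_s\in V^*$, $\check\alpha_s\in V$ with $s(v)=v-\langle\alpha_s,v\rangle\check\alpha_s$ for all $v\in V$, and let $\lambda(g,s)\in\Bbbk$ be defined by $g(\check\alpha_s)=\lambda(g,s)\check\alpha_{gsg^{-1}}$. Let $t\in\Bbbk$, and let $c\colon\mathcal S\to\Bbbk$, $s\mapsto c_s$, satisfy $c_{gsg^{-1}}=c_s$ for all $g\in G$, $s\in\mathcal S$. **Braided doubles.** A finite-dimensional quasi-Yetter–Drinfeld module over $G$ is a finite-dimensional $G$-module $W$ with a linear map $\delta\colon W\to\Bbbk G\otimes W$, $\delta(w)=w^{[-1]}\otimes w^{[0]}$, such that $(gw)^{[-1]}g\otimes(gw)^{[0]}=g\,w^{[-1]}\otimes g(w^{[0]})$ for $g\in G$; it is a Yetter–Drinfeld module if $\delta$ is a coaction. Let $\widetilde A(W,\delta)$ be the algebra generated by $W$, $\Bbbk G$ and $W^*$ subject to the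 relations of $\Bbbk G$ and $g\cdot w=g(w)\cdot g$, $f\cdot g=g\cdot(f\circ g)$, $f\cdot w-w\cdot f=w^{[-1]}\langle f,w^{[0]}\rangle$ for $g\in G$, $w\in W$, $f\in W^*$; multiplication gives a linear isomorphism $T(W)\otimes\Bbbk G\otimes T(W^*)\cong\widetilde A(W,\delta)$. A triangular ideal is a two-sided ideal of the form $I^-\otimes\Bbbk G\otimes T(W^*)+T(W)\otimes\Bbbk G\otimes I^+$ with subspaces $I^-\subset T^{>0}(W)$, $I^+\subset T^{>0}(W^*)$; the quotient by it is called a braided double and written $T(W)/I^-\rtimes\Bbbk G\ltimes T(W^*)/I^+$. The quotient by the sum of all triangular ideals is the minimal double; for a Yetter–Drinfeld module it is called the braided Heisenberg double $\mathcal H_W$. A morphism from $T(V)/I^-\rtimes\Bbbk G\ltimes T(V^*)/I^+$ to $T(W)/K^-\rtimes\Bbbk G\ltimes T(W^*)/K^+$ is an algebra homomorphism of the form $\overline{T(\mu)}\otimes\mathrm{id}_{\Bbbk G}\otimes\overline{T(\nu^*)}$ induced by $G$-module maps $\mu\colon V\to W$, $\nu\colon W\to V$. **Nichols–Woronowicz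 algebras.** For a braided space $(W,\Psi)$ put $\mathcal B(W,\Psi)=\bigoplus_n W^{\otimes n}/\ker[n]!_\Psi$, where $[n]_\Psi=\mathrm{id}+\Psi_{n-1,n}+\Psi_{n-1,n}\Psi_{n-2,n-1}+\dots+\Psi_{n-1,n}\cdots\Psi_{1,2}$, $[0]!_\Psi=1$ and $[n]!_\Psi=([n-1]!_\Psi\otimes\mathrm{id})\circ[n]_\Psi$. A Yetter–Drinfeld module has the braiding $\Psi(x\otimes y)=x^{[-1]}(y)\otimes x^{[0]}$, and $\mathcal B(W)=\mathcal B(W,\Psi)$, $\mathcal B(W^*)=\mathcal B(W^*,\Psi^*)$, where $\Psi^*$ is the adjoint of $\Psi$ for $\langle f\otimes f',x\otimes y\rangle=\langle f,x\rangle\langle f',y\rangle$. **The two doubles.** The rational Cherednik algebra $H_{t,c}(G)$ is the quotient of $\widetilde A(V,\delta_{t,c})$, $\delta_{t,c}(v)=1\otimes tv+\sum_{s\in\mathcal S}c_s\,s\otimes(v-s(v))$, by the relations $vv'=v'v$ ($v,v'\in V$) and $ff'=f'f$ ($f,f'\in V^*$). Let $Y_{\mathcal S}(G)=V\oplus\bigoplus_{s\in\mathcal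 S}\Bbbk[s]$, with the given $G$-action and the coaction $v\mapsto1\otimes v$ on $V$, and with $g([s])=\lambda(g,s)[gsg^{-1}]$, $[s]\mapsto s\otimes[s]$. Let $[s]^*$ denote the functional on $Y_{\mathcal S}(G)$ that vanishes on $V$ and on $[r]$, $r\neq s$, and is $1$ on $[s]$. **Theorem.** $Y_{\mathcal S}(G)$ is a Yetter–Drinfeld module over $G$; $H_{t,c}(G)$ is a braided double of the form $S(V)\rtimes\Bbbk G\ltimes S(V^*)$; the braided Heisenberg double of $Y_{\mathcal S}(G)$ is of the form $\mathcal B(Y_{\mathcal S}(G))\rtimes\Bbbk G\ltimes\mathcal B(Y_{\mathcal S}(G)^*)$. The maps $$\mu\colon V\to Y_{\mathcal S}(G),\quad \mu(v)=tv\oplus\bigoplus_{s\in\mathcal S}c_s\langle\alpha_s,v\rangle[s],\qquad \nu^*\colon V^*\to Y_{\mathcal S}(G)^*,\quad \nu^*(f)=f\oplus\bigoplus_{s\in\mathcal S}\langle f,\check\alpha_s\rangle[s]^*$$ induce a morphism of braided doubles $$H_{t,c}(G)\longrightarrow\mathcal B(Y_{\mathcal S}(G))\rtimes\Bbbk G\ltimes\mathcal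 B(Y_{\mathcal S}(G)^*).$$ If $t\ne0$ and $\operatorname{char}\Bbbk=0$, this morphism is injective. -/

import Mathlib

open scoped TensorProduct

noncomputable section

namespace BraidedDouble

universe u v w

/-! ### Quasi-Yetter-Drinfeld modules over a group algebra -/

section General

variable {k : Type u} [Field k] {G : Type v} [Group G] {W : Type w} [AddCommGroup W] [Module k W]

/-- A quasicoaction of the group algebra on `W`: an arbitrary linear map `W → kG ⊗ W`. -/
abbrev Quasicoaction (k : Type u) [Field k] (G : Type v) [Group G]
    (W : Type w) [AddCommGroup W] [Module k W] :=
  W →ₗ[k] MonoidAlgebra k G ⊗[k] W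

/-- The Yetter-Drinfeld compatibility condition
`(h₁ ▷ v)^[-1] h₂ ⊗ (h₁ ▷ v)^[0] = h₁ v^[-1] ⊗ h₂ ▷ v^[0]`, on the basis `h = g ∈ G` of `kG`. -/
def IsQuasiYetterDrinfeld (ρ : Representation k G W) (δ : Quasicoaction k G W) : Prop :=
  ∀ (g : G) (v : W),
    TensorProduct.map (LinearMap.mulRight k (MonoidAlgebra.of k G g)) LinearMap.id (δ (ρ g v)) =
      TensorProduct.map (LinearMap.mulLeft k (MonoidAlgebra.of k G g)) (ρ g) (δ v)

/-- A Yetter-Drinfeld module: the quasicoaction is moreover a (coassociative, counital) coaction. -/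
structure IsYetterDrinfeld (ρ : Representation k G W) (δ : Quasicoaction k G W) : Prop where
  compat : IsQuasiYetterDrinfeld ρ δ
  coassoc : ∀ v : W, TensorProduct.assoc k _ _ _
      ((Coalgebra.comul (R := k) (A := MonoidAlgebra k G)).rTensor W (δ v)) = δ.lTensor _ (δ v)
  counit : ∀ v : W,
    (Coalgebra.counit (R := k) (A := MonoidAlgebra k G)).rTensor W (δ v) = 1 ⊗ₜ[k] v

/-- The `kG`-valued pairing `β(f, v) = v^[-1] ⟨f, v^[0]⟩` attached to a quasicoaction. -/
def pairing (δ : Quasicoaction k G W) (f : Module.Dual k W) (v : W) : MonoidAlgebra k G :=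
  TensorProduct.rid k _ (f.lTensor (MonoidAlgebra k G) (δ v))

/-! ### The algebra generated by `W`, `kG`, `W*` and its quotients -/

/-- The space of generators of the free double. -/
abbrev Gen (k : Type u) [Field k] (G : Type v) [Group G]
    (W : Type w) [AddCommGroup W] [Module k W] :=
  W × MonoidAlgebra k G × Module.Dual k W

/-- The generator `v ∈ W`. -/
def genV (v : W) : TensorAlgebra k (Gen k G W) := TensorAlgebra.ι k (v, 0, 0)

/-- The generator `h ∈ kG`. -/
def genH (h : MonoidAlgebra k G) : TensorAlgebra k (Gen k G W) := TensorAlgebra.ι k (0, h, 0)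

/-- The generator `f ∈ W*`. -/
def genF (f : Module.Dual k W) : TensorAlgebra k (Gen k G W) := TensorAlgebra.ι k (0, 0, f)

/-- The defining relations of the free double: all relations of `kG`, the two semidirect product
relations `g v = g(v) g` and `f g = g (f ◁ g)` with `⟨f ◁ g, v⟩ = ⟨f, g(v)⟩`, and the commutator
relation `f v - v f = β(f, v)`. -/
inductive Rel (ρ : Representation k G W) (δ : Quasicoaction k G W) :
    TensorAlgebra k (Gen k G W) → TensorAlgebra k (Gen k G W) → Prop
  | one : Rel ρ δ (genH 1) 1
  | mul (a b : MonoidAlgebra k G) : Rel ρ δ (genH (a * b)) (genH a * genH b)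
  | left (g : G) (v : W) :
      Rel ρ δ (genH (MonoidAlgebra.of k G g) * genV v) (genV (ρ g v) * genH (MonoidAlgebra.of k G g))
  | right (f : Module.Dual k W) (g : G) :
      Rel ρ δ (genF f * genH (MonoidAlgebra.of k G g))
        (genH (MonoidAlgebra.of k G g) * genF (f ∘ₗ ρ g))
  | comm (f : Module.Dual k W) (v : W) :
      Rel ρ δ (genF f * genV v) (genV v * genF f + genH (pairing δ f v))

/-- The algebra `Ã(W, δ)` generated by `W`, `kG` and `W*` subject to `Rel`. -/
abbrev FreeDouble (ρ : Representation k G W) (δ : Quasicoaction k G W) := RingQuot (Rel ρ δ)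

variable (ρ : Representation k G W) (δ : Quasicoaction k G W)

/-- The quotient map onto `Ã(W, δ)` from the free algebra on the space of generators. -/
def FreeDouble.proj : TensorAlgebra k (Gen k G W) →ₐ[k] FreeDouble ρ δ :=
  RingQuot.mkAlgHom k (Rel ρ δ)

/-- The homomorphism `T(W) → Ã(W, δ)`. -/
def lower : TensorAlgebra k W →ₐ[k] FreeDouble ρ δ :=
  TensorAlgebra.lift k
    ((FreeDouble.proj ρ δ).toLinearMap ∘ₗ TensorAlgebra.ι k ∘ₗ LinearMap.inl k _ _)

/-- The map `kG → Ã(W, δ)`. -/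
def mid : MonoidAlgebra k G →ₗ[k] FreeDouble ρ δ :=
  (FreeDouble.proj ρ δ).toLinearMap ∘ₗ TensorAlgebra.ι k ∘ₗ LinearMap.inr k _ _ ∘ₗ
    LinearMap.inl k _ _

/-- The homomorphism `T(W*) → Ã(W, δ)`. -/
def upper : TensorAlgebra k (Module.Dual k W) →ₐ[k] FreeDouble ρ δ :=
  TensorAlgebra.lift k
    ((FreeDouble.proj ρ δ).toLinearMap ∘ₗ TensorAlgebra.ι k ∘ₗ LinearMap.inr k _ _ ∘ₗ
      LinearMap.inr k _ _)

/-- The product `a · h · b` in `Ã(W, δ)` of `a ∈ T(W)`, `h ∈ kG`, `b ∈ T(W*)`. -/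
def tri (a : TensorAlgebra k W) (h : MonoidAlgebra k G) (b : TensorAlgebra k (Module.Dual k W)) :
    FreeDouble ρ δ :=
  lower ρ δ a * mid ρ δ h * upper ρ δ b

/-- The quotient algebra `Ã(W, δ) / J`. -/
abbrev QuotAlg (J : TwoSidedIdeal (FreeDouble ρ δ)) := J.ringCon.Quotient

/-- The quotient map `Ã(W, δ) → Ã(W, δ) / J`. -/
def toQuot (J : TwoSidedIdeal (FreeDouble ρ δ)) : FreeDouble ρ δ →ₐ[k] QuotAlg ρ δ J :=
  J.ringCon.mkₐ k

/-- Multiplication induces a linear isomorphism `T(W)/I⁻ ⊗ kG ⊗ T(W*)/I⁺ → Ã(W, δ)/J`. -/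
def HasTriangularDecomposition (Im : Submodule k (TensorAlgebra k W))
    (Ip : Submodule k (TensorAlgebra k (Module.Dual k W)))
    (J : TwoSidedIdeal (FreeDouble ρ δ)) : Prop :=
  ∃ e : (TensorAlgebra k W ⧸ Im) ⊗[k] MonoidAlgebra k G ⊗[k]
      (TensorAlgebra k (Module.Dual k W) ⧸ Ip) ≃ₗ[k] QuotAlg ρ δ J,
    ∀ a h b, e (Im.mkQ a ⊗ₜ h ⊗ₜ Ip.mkQ b) = toQuot ρ δ J (tri ρ δ a h b)

/-- The ideal `T^{>0}(M)` of the tensor algebra. -/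
def positivePart (k : Type u) [Field k] (M : Type w) [AddCommGroup M] [Module k M] :
    Submodule k (TensorAlgebra k M) :=
  LinearMap.ker (TensorAlgebra.algebraMapInv (R := k) (M := M)).toLinearMap

/-- `J` is the triangular ideal `I⁻ ⊗ kG ⊗ T(W*) + T(W) ⊗ kG ⊗ I⁺` of `Ã(W, δ)`, where `I⁻` and
`I⁺` are subspaces of `T^{>0}(W)` and `T^{>0}(W*)`. -/
structure IsTriangularIdeal (Im : Submodule k (TensorAlgebra k W))
    (Ip : Submodule k (TensorAlgebra k (Module.Dual k W)))
    (J : TwoSidedIdeal (FreeDouble ρ δ)) : Prop where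
  lower_pos : Im ≤ positivePart k W
  upper_pos : Ip ≤ positivePart k (Module.Dual k W)
  carrier_eq : (J : Set (FreeDouble ρ δ)) =
    Submodule.span k {x | ∃ a h b, (a ∈ Im ∨ b ∈ Ip) ∧ x = tri ρ δ a h b}

/-- `Ã(W, δ)/J` is a `(W, δ)`-braided double `T(W)/I⁻ ⋊ kG ⋉ T(W*)/I⁺`: the quotient of a free
braided double by a triangular ideal. -/
structure IsBraidedDouble (Im : Submodule k (TensorAlgebra k W))
    (Ip : Submodule k (TensorAlgebra k (Module.Dual k W)))
    (J : TwoSidedIdeal (FreeDouble ρ δ)) : Prop where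
  compat : IsQuasiYetterDrinfeld ρ δ
  free : HasTriangularDecomposition ρ δ ⊥ ⊥ ⊥
  triangular : IsTriangularIdeal ρ δ Im Ip J
  decomposition : HasTriangularDecomposition ρ δ Im Ip J

/-- The sum of all triangular ideals of `Ã(W, δ)`. -/
def maximalTriangularIdeal : TwoSidedIdeal (FreeDouble ρ δ) :=
  sSup {J | ∃ Im Ip, IsTriangularIdeal ρ δ Im Ip J}

/-- The minimal double `Ā(W, δ)`; for a finite-dimensional Yetter-Drinfeld module `(W, δ)` this is
the braided Heisenberg double of `(W, δ)`. -/
abbrev MinimalDouble := QuotAlg ρ δ (maximalTriangularIdeal ρ δ)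

end General

/-! ### Morphisms of braided doubles -/

/-- The algebra homomorphism `T(μ) : T(V) → T(W)`. -/
def tensorMap {k V W : Type*} [Field k] [AddCommGroup V] [Module k V] [AddCommGroup W] [Module k W]
    (μ : V →ₗ[k] W) : TensorAlgebra k V →ₐ[k] TensorAlgebra k W :=
  TensorAlgebra.lift k (TensorAlgebra.ι k ∘ₗ μ)

/-- `Φ` is the morphism `T(μ) ⊗ id ⊗ T(η)` from the braided double
`Ã(V, δV)/J = T(V)/I⁻ ⋊ kG ⋉ T(V*)/I⁺` to the braided double
`Ã(W, δW)/L = T(W)/K⁻ ⋊ kG ⋉ T(W*)/K⁺`, induced by `μ : V → W` and by `η = ν*` for some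
`ν : W → V`, where `μ` and `ν` are `G`-module maps. -/
structure IsMorphism {k G V W : Type*} [Field k] [Group G]
    [AddCommGroup V] [Module k V] [AddCommGroup W] [Module k W]
    (ρV : Representation k G V) (δV : Quasicoaction k G V)
    (Im : Submodule k (TensorAlgebra k V)) (Ip : Submodule k (TensorAlgebra k (Module.Dual k V)))
    (J : TwoSidedIdeal (FreeDouble ρV δV))
    (ρW : Representation k G W) (δW : Quasicoaction k G W)
    (Km : Submodule k (TensorAlgebra k W)) (Kp : Submodule k (TensorAlgebra k (Module.Dual k W)))
    (L : TwoSidedIdeal (FreeDouble ρW δW))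
    (μ : V →ₗ[k] W) (η : Module.Dual k V →ₗ[k] Module.Dual k W)
    (Φ : QuotAlg ρV δV J →ₐ[k] QuotAlg ρW δW L) : Prop where
  source : IsBraidedDouble ρV δV Im Ip J
  target : IsBraidedDouble ρW δW Km Kp L
  equivariant : ∀ g, μ ∘ₗ ρV g = ρW g ∘ₗ μ
  adjoint : ∃ ν : W →ₗ[k] V, (∀ g, ν ∘ₗ ρW g = ρV g ∘ₗ ν) ∧ ν.dualMap = η
  map_lower : ∀ a ∈ Im, tensorMap μ a ∈ Km
  map_upper : ∀ b ∈ Ip, tensorMap η b ∈ Kp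
  map_tri : ∀ a h b, Φ (toQuot ρV δV J (tri ρV δV a h b)) =
    toQuot ρW δW L (tri ρW δW (tensorMap μ a) h (tensorMap η b))

/-! ### Nichols-Woronowicz algebras -/

section Nichols

variable {k : Type u} [Field k] {M : Type v} [AddCommGroup M] [Module k M]

/-- `(b ⊗ x) ⊗ y ↦ b · Ψ(x ⊗ y)`, that is, `Ψ` on the last two legs; here and below the tensor
power `M^{⊗ n}` is the degree `n` part of `T(M)`. -/
def lastLegs (Ψ : M ⊗[k] M →ₗ[k] M ⊗[k] M) :
    (TensorAlgebra k M ⊗[k] M) ⊗[k] M →ₗ[k] TensorAlgebra k M ⊗[k] M :=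
  (LinearMap.mul' k (TensorAlgebra k M) ∘ₗ (TensorAlgebra.ι k).lTensor _).rTensor M ∘ₗ
    (TensorProduct.assoc k (TensorAlgebra k M) M M).symm.toLinearMap ∘ₗ
    Ψ.lTensor (TensorAlgebra k M) ∘ₗ (TensorProduct.assoc k (TensorAlgebra k M) M M).toLinearMap

/-- One step of the recursion for braided integers: `y` sends `(b, x)` to
`(b y, b ⊗ y + Ψ_{n-1,n}(x ⊗ y))`. -/
def braidedStep (Ψ : M ⊗[k] M →ₗ[k] M ⊗[k] M) :
    M →ₗ[k] Module.End k (TensorAlgebra k M × TensorAlgebra k M ⊗[k] M) :=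
  LinearMap.mk₂ k
    (fun y p => (p.1 * TensorAlgebra.ι k y, p.1 ⊗ₜ[k] y + lastLegs Ψ (p.2 ⊗ₜ[k] y)))
    (fun y y' p => by
      ext1
      · simp [mul_add]
      · simp only [TensorProduct.tmul_add, map_add, Prod.snd_add]; abel)
    (fun c y p => by ext1 <;> simp)
    (fun y p p' => by
      ext1
      · simp [add_mul]
      · simp only [TensorProduct.add_tmul, map_add, Prod.snd_add, Prod.fst_add]; abel)
    (fun c y p => by ext1 <;> simp [← TensorProduct.smul_tmul'])

/-- The braided integers `[n]_Ψ = id + Ψ_{n-1,n} + Ψ_{n-1,n} Ψ_{n-2,n-1} + ⋯`, for all `n` at once,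
as a map `T(M) → T(M) ⊗ M` with degree `n` component `M^{⊗ n} → M^{⊗ (n-1)} ⊗ M`. It is given by
`[0] = 0` and `[n] = id + Ψ_{n-1,n} ([n-1] ⊗ id)`. -/
def braidedInteger (Ψ : M ⊗[k] M →ₗ[k] M ⊗[k] M) :
    TensorAlgebra k M →ₗ[k] TensorAlgebra k M ⊗[k] M :=
  LinearMap.snd k _ _ ∘ₗ
    LinearMap.applyₗ ((1, 0) : TensorAlgebra k M × TensorAlgebra k M ⊗[k] M) ∘ₗ
    (MulOpposite.opLinearEquiv k).symm.toLinearMap ∘ₗ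
    (TensorAlgebra.lift k
      ((MulOpposite.opLinearEquiv k).toLinearMap ∘ₗ braidedStep Ψ)).toLinearMap

/-- The braided factorial `[n]!_Ψ = ([n-1]!_Ψ ⊗ id) ∘ [n]_Ψ` on `M^{⊗ n}`, extended by zero to the
other homogeneous components of `T(M)`. -/
def braidedFactorial (Ψ : M ⊗[k] M →ₗ[k] M ⊗[k] M) :
    ℕ → TensorAlgebra k M →ₗ[k] TensorAlgebra k M
  | 0 => Algebra.linearMap k _ ∘ₗ TensorAlgebra.algebraMapInv.toLinearMap
  | n + 1 => LinearMap.mul' k _ ∘ₗ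
      TensorProduct.map (braidedFactorial Ψ n) (TensorAlgebra.ι k) ∘ₗ braidedInteger Ψ

/-- The kernel of the Woronowicz symmetriser `Wor(Ψ)`, whose restriction to `M^{⊗ n}` is `[n]!_Ψ`.
The Nichols-Woronowicz algebra is `B(M, Ψ) = T(M) / ker Wor(Ψ)`. -/
def worKer (Ψ : M ⊗[k] M →ₗ[k] M ⊗[k] M) : Submodule k (TensorAlgebra k M) :=
  ⨅ n, LinearMap.ker (braidedFactorial Ψ n)

/-- The adjoint `Ψ*`, with `⟨f ⊗ g, v ⊗ w⟩ = ⟨f, v⟩ ⟨g, w⟩`. -/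
def dualBraiding [FiniteDimensional k M] (Ψ : M ⊗[k] M →ₗ[k] M ⊗[k] M) :
    Module.Dual k M ⊗[k] Module.Dual k M →ₗ[k] Module.Dual k M ⊗[k] Module.Dual k M :=
  (TensorProduct.dualDistribEquiv k M M).symm.toLinearMap ∘ₗ Ψ.dualMap ∘ₗ
    (TensorProduct.dualDistribEquiv k M M).toLinearMap

/-- The braiding `Ψ(x ⊗ y) = x^(-1) ▷ y ⊗ x^(0)` of a Yetter-Drinfeld module. -/
def braiding {G : Type w} [Group G] (ρ : Representation k G M) (δ : Quasicoaction k G M) :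
    M ⊗[k] M →ₗ[k] M ⊗[k] M :=
  (TensorProduct.lift ρ.asAlgebraHom.toLinearMap).rTensor M ∘ₗ
    (TensorProduct.assoc k (MonoidAlgebra k G) M M).symm.toLinearMap ∘ₗ
    (TensorProduct.comm k M M).toLinearMap.lTensor (MonoidAlgebra k G) ∘ₗ
    (TensorProduct.assoc k (MonoidAlgebra k G) M M).toLinearMap ∘ₗ δ.rTensor M

/-- The kernel of `T(M) → S(M)`. -/
def symKer (k : Type u) [Field k] (M : Type v) [AddCommGroup M] [Module k M] :
    Submodule k (TensorAlgebra k M) :=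
  LinearMap.ker (SymmetricAlgebra.algHom k M).toLinearMap

end Nichols

/-! ### Linear groups, complex reflections, rational Cherednik algebras -/

section Cherednik

variable {k : Type u} [Field k] {V : Type v} [AddCommGroup V] [Module k V]
variable (G : Subgroup (LinearMap.GeneralLinearGroup k V))

/-- The tautological representation of `G ≤ GL(V)` on `V`. -/
def tautRep : Representation k G V :=
  (Units.coeHom (V →ₗ[k] V)).comp G.subtype

/-- The set of complex reflections (pseudoreflections): the `s ∈ G` with `dim (1 - s) V = 1`. -/
abbrev Refl : Type v :=
  {s : G // Module.finrank k (LinearMap.range (1 - tautRep G s)) = 1}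

variable {G}

/-- Conjugation `s ↦ g s g⁻¹` on complex reflections. -/
def Refl.conj (g : G) (s : Refl G) : Refl G :=
  ⟨g * s.1 * g⁻¹, by
    have hg : tautRep G g ∘ₗ tautRep G g⁻¹ = LinearMap.id := by
      change tautRep G g * tautRep G g⁻¹ = 1
      rw [← map_mul, mul_inv_cancel, map_one]
    have hg' : tautRep G g⁻¹ ∘ₗ tautRep G g = LinearMap.id := by
      change tautRep G g⁻¹ * tautRep G g = 1
      rw [← map_mul, inv_mul_cancel, map_one]
    let e : V ≃ₗ[k] V := LinearEquiv.ofLinearMap _ _ hg hg'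
    have h1 : (1 - tautRep G (g * s.1 * g⁻¹) : V →ₗ[k] V) =
        e.toLinearMap ∘ₗ (1 - tautRep G s.1) ∘ₗ e.symm.toLinearMap := by
      change _ = tautRep G g * ((1 - tautRep G s.1) * tautRep G g⁻¹)
      rw [sub_mul, mul_sub, one_mul, ← map_mul, ← map_mul, ← map_mul, mul_inv_cancel, map_one,
        mul_assoc]
    rw [h1, LinearMap.range_comp, LinearMap.range_comp_of_range_eq_top _ e.symm.range,
      LinearEquiv.finrank_map_eq]
    exact s.2⟩

variable (G)

/-- A choice of a root `α_s ∈ V*` and a coroot `α̌_s ∈ V` for every complex reflection `s`: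
`s(v) = v - ⟨α_s, v⟩ α̌_s`. -/
structure RootData where
  root : Refl G → Module.Dual k V
  coroot : Refl G → V
  refl_apply : ∀ (s : Refl G) (v : V), tautRep G s.1 v = v - root s v • coroot s

variable {G}

theorem RootData.exists_root_ne (R : RootData G) (s : Refl G) : ∃ v, R.root s v ≠ 0 := by
  by_contra! h
  have h0 : (1 - tautRep G s.1 : V →ₗ[k] V) = 0 := by
    ext v
    simp [R.refl_apply, h]
  have h1 := s.2
  rw [h0, LinearMap.range_zero, finrank_bot] at h1
  exact zero_ne_one h1

theorem RootData.coroot_ne (R : RootData G) (s : Refl G) : R.coroot s ≠ 0 := by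
  intro h
  have h0 : (1 - tautRep G s.1 : V →ₗ[k] V) = 0 := by
    ext v
    simp [R.refl_apply, h]
  have h1 := s.2
  rw [h0, LinearMap.range_zero, finrank_bot] at h1
  exact zero_ne_one h1

theorem RootData.nonempty : Nonempty (RootData G) := by
  have key : ∀ s : Refl G, ∃ p : Module.Dual k V × V,
      ∀ v, tautRep G s.1 v = v - p.1 v • p.2 := by
    intro s
    let b := Module.basisUnique Unit s.2
    refine ⟨(b.coord () ∘ₗ (1 - tautRep G s.1 : V →ₗ[k] V).rangeRestrict, (b ()).1), fun v => ?_⟩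
    have h := b.sum_repr ((1 - tautRep G s.1 : V →ₗ[k] V).rangeRestrict v)
    have h2 := congrArg Subtype.val h
    simp only [Finset.univ_unique, Finset.sum_singleton] at h2
    change b.repr _ () • (b ()).1 = v - tautRep G s.1 v at h2
    change _ = v - b.repr _ () • (b ()).1
    rw [h2]; abel
  choose p hp using key
  exact ⟨⟨fun s => (p s).1, fun s => (p s).2, hp⟩⟩

theorem tautRep_mul_apply (g h : G) (v : V) :
    tautRep G (g * h) v = tautRep G g (tautRep G h v) := by
  rw [map_mul]; rfl

theorem tautRep_inv_apply (g : G) (v : V) : tautRep G g⁻¹ (tautRep G g v) = v := by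
  rw [← tautRep_mul_apply, inv_mul_cancel, map_one]; rfl

theorem RootData.exists_cocycle (R : RootData G) (g : G) (s : Refl G) :
    ∃ l : k, tautRep G g (R.coroot s) = l • R.coroot (s.conj g) := by
  obtain ⟨v, hv⟩ := R.exists_root_ne s
  have h := R.refl_apply (s.conj g) (tautRep G g v)
  change tautRep G (g * s.1 * g⁻¹) (tautRep G g v) = _ at h
  rw [tautRep_mul_apply, tautRep_inv_apply, tautRep_mul_apply, R.refl_apply s v, map_sub, map_smul,
    sub_right_inj] at h
  refine ⟨(R.root s v)⁻¹ * R.root (s.conj g) (tautRep G g v), ?_⟩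
  rw [mul_smul, ← h, smul_smul, inv_mul_cancel₀ hv, one_smul]

/-- The scalar `λ(g, s)` with `g(α̌_s) = λ(g, s) α̌_{gsg⁻¹}` (unique, as `α̌_{gsg⁻¹} ≠ 0`). -/
def RootData.cocycle (R : RootData G) (g : G) (s : Refl G) : k := (R.exists_cocycle g s).choose

theorem RootData.cocycle_spec (R : RootData G) (g : G) (s : Refl G) :
    tautRep G g (R.coroot s) = R.cocycle g s • R.coroot (s.conj g) :=
  (R.exists_cocycle g s).choose_spec

theorem RootData.cocycle_unique (R : RootData G) {g : G} {s r : Refl G} (hr : s.conj g = r) {l : k}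
    (h : tautRep G g (R.coroot s) = l • R.coroot r) : R.cocycle g s = l := by
  subst hr
  rw [R.cocycle_spec] at h
  exact smul_left_injective k (R.coroot_ne _) h

theorem Refl.conj_one (s : Refl G) : s.conj 1 = s := Subtype.ext (by simp [Refl.conj])

theorem Refl.conj_mul (g h : G) (s : Refl G) : s.conj (g * h) = (s.conj h).conj g :=
  Subtype.ext (by simp [Refl.conj, mul_assoc])

theorem RootData.cocycle_one (R : RootData G) (s : Refl G) : R.cocycle 1 s = 1 :=
  R.cocycle_unique s.conj_one (by rw [map_one, one_smul]; rfl)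

theorem RootData.cocycle_mul (R : RootData G) (g h : G) (s : Refl G) :
    R.cocycle (g * h) s = R.cocycle h s * R.cocycle g (s.conj h) :=
  R.cocycle_unique (s.conj_mul g h) (by
    rw [tautRep_mul_apply, R.cocycle_spec h, map_smul, R.cocycle_spec g, smul_smul])

/-! ### The Yetter-Drinfeld module `Y_S(G) = V₁ ⊕ ⊕_s k [s]` -/

variable (G) in
/-- The underlying space of `Y_S(G)`; the symbol `[s]` is `(0, Finsupp.single s 1)`. -/
abbrev YSpace := V × (Refl G →₀ k)

/-- The `G`-action on `Y_S(G)`: the given one on `V₁ = V`, and `g([s]) = λ(g, s) [gsg⁻¹]`. -/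
def RootData.yRep (R : RootData G) : Representation k G (YSpace G) where
  toFun g := (tautRep G g).prodMap
    (Finsupp.lsum k fun s => R.cocycle g s • Finsupp.lsingle (s.conj g))
  map_one' := by
    ext <;> simp [Refl.conj_one, R.cocycle_one]
  map_mul' g h := by
    ext <;> simp [Refl.conj_mul, R.cocycle_mul, mul_comm]

variable (G) in
/-- The `kG`-coaction on `Y_S(G)`: `v ↦ 1 ⊗ v` on `V₁` and `[s] ↦ s ⊗ [s]`. -/
def yCoaction : Quasicoaction k G (YSpace G) :=
  LinearMap.coprod
    (TensorProduct.mk k (MonoidAlgebra k G) (YSpace G) 1 ∘ₗ LinearMap.inl k V (Refl G →₀ k))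
    (Finsupp.lsum k fun s =>
      TensorProduct.mk k (MonoidAlgebra k G) (YSpace G) (MonoidAlgebra.of k G s.1) ∘ₗ
        LinearMap.inr k V (Refl G →₀ k) ∘ₗ Finsupp.lsingle s)

/-- The braiding on `Y_S(G)`. -/
def RootData.yBraiding (R : RootData G) :
    YSpace G ⊗[k] YSpace G →ₗ[k] YSpace G ⊗[k] YSpace G :=
  braiding R.yRep (yCoaction G)

/-- The braided Heisenberg double of `Y_S(G)`. -/
abbrev RootData.HeisenbergDouble (R : RootData G) := MinimalDouble R.yRep (yCoaction G)

variable (G) in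
/-- The quasicoaction `δ_{t,c}(v) = 1 ⊗ t v + ∑_s c_s s ⊗ (v - s(v))` on `V`
(for finite `G`, the sum is finite). -/
def cherednikCoaction (t : k) (c : Refl G → k) : Quasicoaction k G V :=
  t • TensorProduct.mk k (MonoidAlgebra k G) V 1 +
    ∑ᶠ s : Refl G, c s • TensorProduct.mk k (MonoidAlgebra k G) V (MonoidAlgebra.of k G s.1) ∘ₗ
      (1 - tautRep G s.1 : V →ₗ[k] V)

variable (G) in
/-- The ideal of `Ã(V, δ_{t,c})` generated by the commutators `[v, v']` and `[f, f']`. -/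
def cherednikIdeal (t : k) (c : Refl G → k) :
    TwoSidedIdeal (FreeDouble (tautRep G) (cherednikCoaction G t c)) :=
  TwoSidedIdeal.span
    ({x | ∃ v v' : V, x = lower _ _ (TensorAlgebra.ι k v * TensorAlgebra.ι k v' -
        TensorAlgebra.ι k v' * TensorAlgebra.ι k v)} ∪
      {x | ∃ f f' : Module.Dual k V, x = upper _ _ (TensorAlgebra.ι k f * TensorAlgebra.ι k f' -
        TensorAlgebra.ι k f' * TensorAlgebra.ι k f)})

variable (G) in
/-- The rational Cherednik algebra `H_{t,c}(G)`. -/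
abbrev CherednikAlgebra (t : k) (c : Refl G → k) :=
  QuotAlg (tautRep G) (cherednikCoaction G t c) (cherednikIdeal G t c)

/-- `μ(v) = t v ⊕ ⊕_s c_s ⟨α_s, v⟩ [s]`. -/
def RootData.mu [Finite G] (R : RootData G) (t : k) (c : Refl G → k) : V →ₗ[k] YSpace G :=
  (t • LinearMap.id).prod
    ((Finsupp.linearEquivFunOnFinite k k (Refl G)).symm.toLinearMap ∘ₗ
      LinearMap.pi fun s => c s • R.root s)

/-- `ν*(f) = f ⊕ ⊕_s ⟨f, α̌_s⟩ [s]*`: the functional on `Y_S(G)` that equals `f` on `V₁` and takes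
the value `⟨f, α̌_s⟩` at `[s]`. -/
def RootData.nuStar (R : RootData G) : Module.Dual k V →ₗ[k] Module.Dual k (YSpace G) where
  toFun f := LinearMap.coprod f (Finsupp.linearCombination k fun s => f (R.coroot s))
  map_add' f f' := by ext <;> simp
  map_smul' a f := by ext <;> simp

end Cherednik

end BraidedDouble

end

/-! Everything is read off from one scalar pairing of T(W*) with T(W): ⟨b, a⟩ is the value of ε ⊗ ε
⊗ ε on the product b a in Ã(W, δ) = T(W) ⊗ kG ⊗ T(W*). The triangular decomposition behind this
functional is `triMap_bijective`: Ã(W, δ) acts on the module induced from kG ⊗ T(W*), and there a h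
b sends 1 ⊗ 1 ⊗ 1 to a ⊗ h ⊗ b.

Minimal double. The functional vanishes on every triangular ideal, so I⁻ and I⁺ lie in the two
radicals of the pairing (`IsTriangularIdeal.le_radical`). If W and W* are spanned by homogeneous
elements, then f ∈ W* of degree g satisfies f a = a f + a' g with a single group element g, so
nothing is lost by applying the augmentation of kG. The radicals are then G-stable two-sided ideals
that define a triangular ideal, necessarily the largest (`isTriangularIdeal_maximal`). Moreover a'
is the braided derivation (id ⊗ f)[n]_Ψ of a, so multiplication by f is adjoint to it (`form_mul_ι`,
and `form_ι_mul` on the other side). Each radical is therefore the largest subspace of T^{>0} stable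
under braided derivations, which is the kernel of the braided factorials (`lowerRadical_eq_worKer`,
`upperRadical_eq_worKer`).

Cherednik algebra. In Ã(V, δ_{t,c}) the element f v v' - v v' f is symmetric in v and v', so [v, v']
commutes with V*; dually [f, f'] commutes with V. Hence the commutators generate a triangular ideal
whose halves are the kernels of T → S (`isTriangularIdeal_cherednik`).

Morphism. The maps μ and ν* are equivariant and carry the kG-valued pairing of δ_{t,c} to that of
Y_S(G) (`RootData.isCompatible`), so they induce a homomorphism of free doubles. It descends to the
quotients because Ψ sends μ(v) ⊗ μ(v') to μ(v') ⊗ μ(v) minus a term symmetric in v and v', whence id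
+ Ψ kills the commutator; the same holds for ν* and Ψ*.

Injectivity. The triangular decompositions reduce it to the two halves, and for each half the
partner map may be replaced. Against f ↦ f ∘ pr_V the map μ has pairing t⟨f, v⟩ · 1, and against the
inclusion of V the map ν* has pairing ⟨f, v⟩ · 1. Compatible maps preserve the scalar pairing, so a
tensor that becomes zero in the target lies in the radical of a Weyl algebra pairing. There letters
act as multiples of partial derivatives, and in characteristic zero a polynomial is determined by
the constant terms of its iterated derivatives. -/

open scoped TensorProduct

noncomputable section

namespace BraidedDouble

universe u v w

/-! ### Letter-by-letter induction on the tensor algebra -/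

section TensorAlgebraInduction

variable {k : Type u} [Field k] {M : Type w} [AddCommGroup M] [Module k M]

/-- A subspace of `T(M)` that contains `1` and is stable under left multiplication by `M` is all of
`T(M)`. -/
theorem eq_top_of_ι_mul_mem {S : Submodule k (TensorAlgebra k M)} (h1 : 1 ∈ S)
    (h : ∀ m, ∀ a ∈ S, TensorAlgebra.ι k m * a ∈ S) (a : TensorAlgebra k M) : a ∈ S := by
  suffices H : ∀ x ∈ S, a * x ∈ S by simpa using H 1 h1
  induction a using TensorAlgebra.induction with
  | algebraMap r => intro x hx; rw [← Algebra.smul_def]; exact S.smul_mem _ hx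
  | ι m => exact h m
  | mul a b ha hb => intro x hx; rw [mul_assoc]; exact ha _ (hb _ hx)
  | add a b ha hb => intro x hx; rw [add_mul]; exact S.add_mem (ha _ hx) (hb _ hx)

/-- A subspace of `T(M)` that contains `1` and is stable under right multiplication by `M` is all of
`T(M)`. -/
theorem eq_top_of_mul_ι_mem {S : Submodule k (TensorAlgebra k M)} (h1 : 1 ∈ S)
    (h : ∀ m, ∀ a ∈ S, a * TensorAlgebra.ι k m ∈ S) (a : TensorAlgebra k M) : a ∈ S := by
  suffices H : ∀ x ∈ S, x * a ∈ S by simpa using H 1 h1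
  induction a using TensorAlgebra.induction with
  | algebraMap r =>
    intro x hx; rw [← Algebra.commutes, ← Algebra.smul_def]; exact S.smul_mem _ hx
  | ι m => exact h m
  | mul a b ha hb => intro x hx; rw [← mul_assoc]; exact hb _ (ha _ hx)
  | add a b ha hb => intro x hx; rw [mul_add]; exact S.add_mem (ha _ hx) (hb _ hx)

/-- Left induction on the tensor algebra, for linear predicates. -/
theorem leftInduction {P : TensorAlgebra k M → Prop} (hadd : ∀ a b, P a → P b → P (a + b))
    (hsmul : ∀ (r : k) a, P a → P (r • a)) (h1 : P 1)
    (h : ∀ m a, P a → P (TensorAlgebra.ι k m * a)) (a : TensorAlgebra k M) : P a :=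
  eq_top_of_ι_mul_mem (S :=
    { carrier := {a | P a}, add_mem' := fun ha hb => hadd _ _ ha hb
      zero_mem' := by simpa using hsmul 0 1 h1, smul_mem' := fun r _ ha => hsmul r _ ha })
    h1 h a

/-- Right induction on the tensor algebra, for linear predicates. -/
theorem rightInduction {P : TensorAlgebra k M → Prop} (hadd : ∀ a b, P a → P b → P (a + b))
    (hsmul : ∀ (r : k) a, P a → P (r • a)) (h1 : P 1)
    (h : ∀ m a, P a → P (a * TensorAlgebra.ι k m)) (a : TensorAlgebra k M) : P a :=
  eq_top_of_mul_ι_mem (S :=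
    { carrier := {a | P a}, add_mem' := fun ha hb => hadd _ _ ha hb
      zero_mem' := by simpa using hsmul 0 1 h1, smul_mem' := fun r _ ha => hsmul r _ ha })
    h1 h a

@[simp]
theorem tensorMap_ι {N : Type*} [AddCommGroup N] [Module k N] (φ : M →ₗ[k] N) (m : M) :
    tensorMap φ (TensorAlgebra.ι k m) = TensorAlgebra.ι k (φ m) := by
  simp [tensorMap]

@[simp]
theorem algebraMapInv_ι (m : M) :
    TensorAlgebra.algebraMapInv (R := k) (TensorAlgebra.ι k m) = 0 := by
  simp [TensorAlgebra.algebraMapInv]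

@[simp]
theorem algebraMapInv_tensorMap {N : Type*} [AddCommGroup N] [Module k N] (φ : M →ₗ[k] N)
    (a : TensorAlgebra k M) : TensorAlgebra.algebraMapInv (tensorMap φ a) =
      TensorAlgebra.algebraMapInv (R := k) a := by
  have : (TensorAlgebra.algebraMapInv (R := k) (M := N)).comp (tensorMap φ) =
      TensorAlgebra.algebraMapInv := by
    ext m; simp
  exact DFunLike.congr_fun this a

theorem tensorMap_tensorMap {N P : Type*} [AddCommGroup N] [Module k N] [AddCommGroup P]
    [Module k P] (φ : M →ₗ[k] N) (ψ : N →ₗ[k] P) (a : TensorAlgebra k M) :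
    tensorMap ψ (tensorMap φ a) = tensorMap (ψ ∘ₗ φ) a := by
  have : (tensorMap ψ).comp (tensorMap φ) = tensorMap (ψ ∘ₗ φ) := by ext m; simp
  exact DFunLike.congr_fun this a

theorem tensorMap_id (a : TensorAlgebra k M) : tensorMap (LinearMap.id (R := k) (M := M)) a = a := by
  have : tensorMap (LinearMap.id (R := k) (M := M)) = AlgHom.id k _ := by ext m; simp
  exact DFunLike.congr_fun this a

end TensorAlgebraInduction

/-! ### Relations and generators of the free double -/

section Relations

variable {k : Type u} [Field k] {G : Type v} [Group G] {W : Type w} [AddCommGroup W] [Module k W]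

/-- Linear maps on `kG` that agree on `G` are equal. -/
theorem monoidAlgebra_induction {P : MonoidAlgebra k G → Prop}
    (hadd : ∀ a b, P a → P b → P (a + b)) (hsmul : ∀ (r : k) a, P a → P (r • a))
    (h : ∀ g, P (MonoidAlgebra.of k G g)) (a : MonoidAlgebra k G) : P a :=
  MonoidAlgebra.induction_on a h hadd hsmul

/-- The pairing `β` as a bilinear map. -/
def pairingₗ (δ : Quasicoaction k G W) : Module.Dual k W →ₗ[k] W →ₗ[k] MonoidAlgebra k G :=
  LinearMap.mk₂ k (pairing δ)
    (fun f f' v => by simp [pairing, LinearMap.lTensor_add])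
    (fun r f v => by simp [pairing, LinearMap.lTensor_smul])
    (fun f v v' => by simp [pairing])
    (fun r f v => by simp [pairing])

@[simp]
theorem pairingₗ_apply (δ : Quasicoaction k G W) (f : Module.Dual k W) (v : W) :
    pairingₗ δ f v = pairing δ f v := rfl

/-- The quasi-Yetter-Drinfeld condition in terms of the pairing. -/
theorem IsQuasiYetterDrinfeld.pairing_mul {ρ : Representation k G W} {δ : Quasicoaction k G W}
    (h : IsQuasiYetterDrinfeld ρ δ) (f : Module.Dual k W) (g : G) (v : W) :
    pairing δ f (ρ g v) * MonoidAlgebra.of k G g =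
      MonoidAlgebra.of k G g * pairing δ (f ∘ₗ ρ g) v := by
  -- Contract the second leg of the compatibility identity with `f`; `h2` and `h3` evaluate the two
  -- sides.
  have h1 := congrArg (fun z => TensorProduct.rid k _ (f.lTensor (MonoidAlgebra k G) z)) (h g v)
  have h2 : ∀ z : MonoidAlgebra k G ⊗[k] W, TensorProduct.rid k _ (f.lTensor (MonoidAlgebra k G)
      (TensorProduct.map (LinearMap.mulRight k (MonoidAlgebra.of k G g)) LinearMap.id z)) =
      TensorProduct.rid k _ (f.lTensor (MonoidAlgebra k G) z) * MonoidAlgebra.of k G g := by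
    intro z
    induction z using TensorProduct.induction_on with
    | zero => simp
    | tmul x y => simp
    | add x y hx hy => simp only [map_add, hx, hy, add_mul]
  have h3 : ∀ z : MonoidAlgebra k G ⊗[k] W, TensorProduct.rid k _ (f.lTensor (MonoidAlgebra k G)
      (TensorProduct.map (LinearMap.mulLeft k (MonoidAlgebra.of k G g)) (ρ g) z)) =
      MonoidAlgebra.of k G g *
        TensorProduct.rid k _ ((f ∘ₗ ρ g).lTensor (MonoidAlgebra k G) z) := by
    intro z
    induction z using TensorProduct.induction_on with
    | zero => simp
    | tmul x y => simp
    | add x y hx hy => simp only [map_add, hx, hy, mul_add]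
  simp only [h2, h3] at h1
  exact h1

variable (ρ : Representation k G W) (δ : Quasicoaction k G W)

theorem lower_ι (v : W) : lower ρ δ (TensorAlgebra.ι k v) = FreeDouble.proj ρ δ (genV v) := by
  simp [lower, genV]
  rfl

theorem upper_ι (f : Module.Dual k W) :
    upper ρ δ (TensorAlgebra.ι k f) = FreeDouble.proj ρ δ (genF f) := by
  simp [upper, genF]

theorem mid_eq (h : MonoidAlgebra k G) : mid ρ δ h = FreeDouble.proj ρ δ (genH h) := by
  simp [mid, genH]

@[simp]
theorem mid_one : mid ρ δ 1 = 1 := by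
  rw [mid_eq, ← map_one (FreeDouble.proj ρ δ)]
  exact RingQuot.mkAlgHom_rel k Rel.one

theorem mid_mul (a b : MonoidAlgebra k G) : mid ρ δ (a * b) = mid ρ δ a * mid ρ δ b := by
  rw [mid_eq, mid_eq, mid_eq, ← map_mul]
  exact RingQuot.mkAlgHom_rel k (Rel.mul a b)

theorem mid_mul_ι (g : G) (v : W) :
    mid ρ δ (MonoidAlgebra.of k G g) * lower ρ δ (TensorAlgebra.ι k v) =
      lower ρ δ (TensorAlgebra.ι k (ρ g v)) * mid ρ δ (MonoidAlgebra.of k G g) := by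
  rw [mid_eq, lower_ι, lower_ι, ← map_mul, ← map_mul]
  exact RingQuot.mkAlgHom_rel k (Rel.left g v)

theorem ι_mul_mid (f : Module.Dual k W) (g : G) :
    upper ρ δ (TensorAlgebra.ι k f) * mid ρ δ (MonoidAlgebra.of k G g) =
      mid ρ δ (MonoidAlgebra.of k G g) * upper ρ δ (TensorAlgebra.ι k (f ∘ₗ ρ g)) := by
  rw [mid_eq, upper_ι, upper_ι, ← map_mul, ← map_mul]
  exact RingQuot.mkAlgHom_rel k (Rel.right f g)

theorem ι_mul_ι (f : Module.Dual k W) (v : W) :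
    upper ρ δ (TensorAlgebra.ι k f) * lower ρ δ (TensorAlgebra.ι k v) =
      lower ρ δ (TensorAlgebra.ι k v) * upper ρ δ (TensorAlgebra.ι k f) +
        mid ρ δ (pairing δ f v) := by
  rw [mid_eq, upper_ι, lower_ι, ← map_mul, ← map_mul, ← map_add]
  exact RingQuot.mkAlgHom_rel k (Rel.comm f v)

theorem mid_mul_lower (g : G) (a : TensorAlgebra k W) :
    mid ρ δ (MonoidAlgebra.of k G g) * lower ρ δ a =
      lower ρ δ (tensorMap (ρ g) a) * mid ρ δ (MonoidAlgebra.of k G g) := by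
  induction a using TensorAlgebra.induction with
  | algebraMap r => simp [Algebra.commutes]
  | ι m => rw [mid_mul_ι, tensorMap_ι]
  | mul a b ha hb => rw [map_mul, map_mul, map_mul, ← mul_assoc, ha, mul_assoc, hb, mul_assoc]
  | add a b ha hb => simp only [map_add, mul_add, add_mul, ha, hb]

/-- The right action of `g ∈ G` on `T(W*)`, which extends `f ↦ f ∘ g`. -/
abbrev dualAct (ρ : Representation k G W) (g : G) :
    TensorAlgebra k (Module.Dual k W) →ₐ[k] TensorAlgebra k (Module.Dual k W) :=
  tensorMap (ρ g).dualMap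

theorem upper_mul_mid (b : TensorAlgebra k (Module.Dual k W)) (g : G) :
    upper ρ δ b * mid ρ δ (MonoidAlgebra.of k G g) =
      mid ρ δ (MonoidAlgebra.of k G g) * upper ρ δ (dualAct ρ g b) := by
  induction b using TensorAlgebra.induction with
  | algebraMap r => simp [Algebra.commutes]
  | ι m => rw [ι_mul_mid]; simp [LinearMap.dualMap_eq_lcomp]; rfl
  | mul a b ha hb => rw [map_mul, map_mul, map_mul, mul_assoc, hb, ← mul_assoc, ha, mul_assoc]
  | add a b ha hb => simp only [map_add, mul_add, add_mul, ha, hb]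

/-- Induction on `Ã(W, δ)`, from the generators. -/
theorem FreeDouble.induction {P : FreeDouble ρ δ → Prop} (hadd : ∀ x y, P x → P y → P (x + y))
    (hmul : ∀ x y, P x → P y → P (x * y)) (hk : ∀ r : k, P (algebraMap k _ r))
    (hV : ∀ v, P (lower ρ δ (TensorAlgebra.ι k v)))
    (hG : ∀ g, P (mid ρ δ (MonoidAlgebra.of k G g)))
    (hF : ∀ f, P (upper ρ δ (TensorAlgebra.ι k f))) (x : FreeDouble ρ δ) : P x := by
  have hH : ∀ h, P (mid ρ δ h) := by
    intro h
    induction h using monoidAlgebra_induction with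
    | h g => exact hG g
    | hadd a b ha hb => rw [map_add]; exact hadd _ _ ha hb
    | hsmul r a ha => rw [map_smul, Algebra.smul_def]; exact hmul _ _ (hk r) ha
  obtain ⟨y, rfl⟩ : ∃ y, FreeDouble.proj ρ δ y = x := RingQuot.mkAlgHom_surjective k _ x
  induction y using TensorAlgebra.induction with
  | algebraMap r => rw [AlgHom.commutes]; exact hk r
  | ι m =>
    obtain ⟨v, h, f⟩ := m
    have : (TensorAlgebra.ι k ((v, h, f) : Gen k G W)) = genV v + genH h + genF f := by
      simp [genV, genH, genF, ← map_add]
    rw [this, map_add, map_add, ← lower_ι, ← mid_eq, ← upper_ι]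
    exact hadd _ _ (hadd _ _ (hV _) (hH _)) (hF _)
  | mul a b ha hb => rw [map_mul]; exact hmul _ _ ha hb
  | add a b ha hb => rw [map_add]; exact hadd _ _ ha hb

/-- A subspace of `Ã(W, δ)` that is stable under left multiplication by the generators is a left
ideal. -/
theorem FreeDouble.mul_mem_left {S : Submodule k (FreeDouble ρ δ)}
    (hV : ∀ v, ∀ x ∈ S, lower ρ δ (TensorAlgebra.ι k v) * x ∈ S)
    (hG : ∀ g, ∀ x ∈ S, mid ρ δ (MonoidAlgebra.of k G g) * x ∈ S)
    (hF : ∀ f, ∀ x ∈ S, upper ρ δ (TensorAlgebra.ι k f) * x ∈ S) (y : FreeDouble ρ δ) :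
    ∀ x ∈ S, y * x ∈ S := by
  refine FreeDouble.induction ρ δ (P := fun y => ∀ x ∈ S, y * x ∈ S) ?_ ?_ ?_ hV hG hF y
  · intro a b ha hb x hx; rw [add_mul]; exact S.add_mem (ha x hx) (hb x hx)
  · intro a b ha hb x hx; rw [mul_assoc]; exact ha _ (hb _ hx)
  · intro r x hx; rw [← Algebra.smul_def]; exact S.smul_mem _ hx

/-- A subspace of `Ã(W, δ)` that is stable under right multiplication by the generators is a right
ideal. -/
theorem FreeDouble.mul_mem_right {S : Submodule k (FreeDouble ρ δ)}
    (hV : ∀ v, ∀ x ∈ S, x * lower ρ δ (TensorAlgebra.ι k v) ∈ S)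
    (hG : ∀ g, ∀ x ∈ S, x * mid ρ δ (MonoidAlgebra.of k G g) ∈ S)
    (hF : ∀ f, ∀ x ∈ S, x * upper ρ δ (TensorAlgebra.ι k f) ∈ S) (y : FreeDouble ρ δ) :
    ∀ x ∈ S, x * y ∈ S := by
  refine FreeDouble.induction ρ δ (P := fun y => ∀ x ∈ S, x * y ∈ S) ?_ ?_ ?_ hV hG hF y
  · intro a b ha hb x hx; rw [mul_add]; exact S.add_mem (ha x hx) (hb x hx)
  · intro a b ha hb x hx; rw [← mul_assoc]; exact hb _ (ha _ hx)
  · intro r x hx; rw [← Algebra.commutes, ← Algebra.smul_def]; exact S.smul_mem _ hx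

end Relations

/-! ### Universal property of the free double -/

section Lift

variable {k : Type u} [Field k] {G : Type v} [Group G] {W : Type w} [AddCommGroup W] [Module k W]
  (ρ : Representation k G W) (δ : Quasicoaction k G W)

/-- The universal property of `Ã(W, δ)`. -/
def FreeDouble.lift {A : Type*} [Semiring A] [Algebra k A] (φ : W →ₗ[k] A)
    (χ : MonoidAlgebra k G →ₐ[k] A) (ψ : Module.Dual k W →ₗ[k] A)
    (hl : ∀ g v, χ (MonoidAlgebra.of k G g) * φ v = φ (ρ g v) * χ (MonoidAlgebra.of k G g))
    (hr : ∀ f g, ψ f * χ (MonoidAlgebra.of k G g) = χ (MonoidAlgebra.of k G g) * ψ (f ∘ₗ ρ g))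
    (hc : ∀ f v, ψ f * φ v = φ v * ψ f + χ (pairing δ f v)) : FreeDouble ρ δ →ₐ[k] A :=
  RingQuot.liftAlgHom k ⟨TensorAlgebra.lift k (φ.coprod (χ.toLinearMap.coprod ψ)), by
    intro x y h
    cases h with
    | one => simp [genH]
    | mul a b => simp [genH]
    | left g v => simpa [genH, genV] using hl g v
    | right f g => simpa [genH, genF] using hr f g
    | comm f v => simpa [genH, genF, genV] using hc f v⟩

section
variable {A : Type*} [Semiring A] [Algebra k A] (φ : W →ₗ[k] A)
    (χ : MonoidAlgebra k G →ₐ[k] A) (ψ : Module.Dual k W →ₗ[k] A)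
    (hl : ∀ g v, χ (MonoidAlgebra.of k G g) * φ v = φ (ρ g v) * χ (MonoidAlgebra.of k G g))
    (hr : ∀ f g, ψ f * χ (MonoidAlgebra.of k G g) = χ (MonoidAlgebra.of k G g) * ψ (f ∘ₗ ρ g))
    (hc : ∀ f v, ψ f * φ v = φ v * ψ f + χ (pairing δ f v))

@[simp]
theorem FreeDouble.lift_lower_ι (v : W) :
    FreeDouble.lift ρ δ φ χ ψ hl hr hc (lower ρ δ (TensorAlgebra.ι k v)) = φ v := by
  rw [lower_ι, FreeDouble.lift, FreeDouble.proj, RingQuot.liftAlgHom_mkAlgHom_apply]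
  simp [genV]

@[simp]
theorem FreeDouble.lift_upper_ι (f : Module.Dual k W) :
    FreeDouble.lift ρ δ φ χ ψ hl hr hc (upper ρ δ (TensorAlgebra.ι k f)) = ψ f := by
  rw [upper_ι, FreeDouble.lift, FreeDouble.proj, RingQuot.liftAlgHom_mkAlgHom_apply]
  simp [genF]

@[simp]
theorem FreeDouble.lift_mid (h : MonoidAlgebra k G) :
    FreeDouble.lift ρ δ φ χ ψ hl hr hc (mid ρ δ h) = χ h := by
  rw [mid_eq, FreeDouble.lift, FreeDouble.proj, RingQuot.liftAlgHom_mkAlgHom_apply]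
  simp [genH]

end

end Lift

/-! ### Induced modules and the triangular decomposition of the free double -/

section Induced

variable {k : Type u} [Field k] {G : Type v} [Group G] {W : Type w} [AddCommGroup W] [Module k W]
  (ρ : Representation k G W) (δ : Quasicoaction k G W)
  {X : Type*} [AddCommGroup X] [Module k X]
  (σ : Representation k G X) (F : Module.Dual k W →ₗ[k] Module.End k X)

/-- Left multiplication by `W` on `T(W) ⊗ X`. -/
def inducedMul : W →ₗ[k] Module.End k (TensorAlgebra k W ⊗[k] X) :=
  LinearMap.rTensorHom X ∘ₗ LinearMap.mul k (TensorAlgebra k W) ∘ₗ TensorAlgebra.ι k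

@[simp]
theorem inducedMul_tmul (v : W) (a : TensorAlgebra k W) (x : X) :
    inducedMul (X := X) v (a ⊗ₜ[k] x) = (TensorAlgebra.ι k v * a) ⊗ₜ[k] x := by
  simp [inducedMul]

/-- The diagonal action of `G` on `T(W) ⊗ X`. -/
def inducedRep : Representation k G (TensorAlgebra k W ⊗[k] X) where
  toFun g := TensorProduct.map (tensorMap (ρ g)).toLinearMap (σ g)
  map_one' := by
    ext a x
    change tensorMap (ρ 1) a ⊗ₜ[k] σ 1 x = a ⊗ₜ[k] x
    rw [map_one, map_one]
    exact congrArg (· ⊗ₜ[k] x) (tensorMap_id a)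
  map_mul' g h := by
    ext a x
    change tensorMap (ρ (g * h)) a ⊗ₜ[k] σ (g * h) x =
      tensorMap (ρ g) (tensorMap (ρ h) a) ⊗ₜ[k] σ g (σ h x)
    rw [tensorMap_tensorMap, map_mul, map_mul]
    rfl

@[simp]
theorem inducedRep_tmul (g : G) (a : TensorAlgebra k W) (x : X) :
    inducedRep ρ σ g (a ⊗ₜ[k] x) = tensorMap (ρ g) a ⊗ₜ[k] σ g x := rfl

/-- The recursion step for the action of `W*` on `T(W) ⊗ X`: with `n = a ⊗ x` and
`φ f = f · (a ⊗ x)`, it computes `v n` and `f ↦ f · (v a ⊗ x)`. -/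
def inducedStep : W →ₗ[k] Module.End k
    ((TensorAlgebra k W ⊗[k] X) × (Module.Dual k W →ₗ[k] TensorAlgebra k W ⊗[k] X)) :=
  LinearMap.mk₂ k (fun v p => (inducedMul v p.1, inducedMul v ∘ₗ p.2 +
      ((inducedRep ρ σ).asAlgebraHom.toLinearMap.flip p.1) ∘ₗ (pairingₗ δ).flip v))
    (fun v v' p => by ext1 <;> simp [LinearMap.add_comp, LinearMap.comp_add]; abel)
    (fun r v p => by ext1 <;> simp [LinearMap.smul_comp, LinearMap.comp_smul])
    (fun v p p' => by ext1 <;> simp [LinearMap.add_comp, LinearMap.comp_add]; abel)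
    (fun r v p => by ext1 <;> simp [LinearMap.smul_comp, LinearMap.comp_smul])

theorem inducedStep_apply (v : W)
    (p : (TensorAlgebra k W ⊗[k] X) × (Module.Dual k W →ₗ[k] TensorAlgebra k W ⊗[k] X)) :
    inducedStep ρ δ σ v p = (inducedMul v p.1, inducedMul v ∘ₗ p.2 +
      ((inducedRep ρ σ).asAlgebraHom.toLinearMap.flip p.1) ∘ₗ (pairingₗ δ).flip v) := rfl

/-- The start of the recursion: `1 ⊗ x` and `f ↦ 1 ⊗ f x`. -/
def inducedStart : X →ₗ[k]
    (TensorAlgebra k W ⊗[k] X) × (Module.Dual k W →ₗ[k] TensorAlgebra k W ⊗[k] X) :=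
  (TensorProduct.mk k _ X 1).prod ((LinearMap.llcomp k _ _ _ (TensorProduct.mk k _ X 1)) ∘ₗ F.flip)

/-- The action of `W*` on `T(W) ⊗ X`. -/
def inducedDual : Module.Dual k W →ₗ[k] Module.End k (TensorAlgebra k W ⊗[k] X) :=
  LinearMap.flip (LinearMap.snd k _ _ ∘ₗ TensorProduct.lift
    (LinearMap.lcomp k _ (inducedStart F) ∘ₗ
      (TensorAlgebra.lift k (inducedStep ρ δ σ)).toLinearMap))

theorem inducedDual_one_tmul (f : Module.Dual k W) (x : X) :
    inducedDual ρ δ σ F f (1 ⊗ₜ[k] x) = 1 ⊗ₜ[k] F f x := by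
  simp [inducedDual, inducedStart]

/-- The first component of the recursion merely records the vector built so far; the second
component needs it, because the term β(f, v) acts on that vector. -/
theorem lift_inducedStep_fst (a : TensorAlgebra k W) (x : X) :
    (TensorAlgebra.lift k (inducedStep ρ δ σ) a (inducedStart F x)).1 = a ⊗ₜ[k] x := by
  induction a using leftInduction with
  | hadd a b ha hb => simp [ha, hb, TensorProduct.add_tmul]
  | hsmul r a ha => simp [ha, TensorProduct.smul_tmul']
  | h1 => simp [inducedStart]
  | h v a ha => simp [inducedStep_apply, ha]

/-- The recursion was designed so that f v = v f + β(f, v) holds on the induced module. -/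
theorem inducedDual_mul_tmul (f : Module.Dual k W) (v : W) (a : TensorAlgebra k W) (x : X) :
    inducedDual ρ δ σ F f ((TensorAlgebra.ι k v * a) ⊗ₜ[k] x) =
      inducedMul v (inducedDual ρ δ σ F f (a ⊗ₜ[k] x)) +
        (inducedRep ρ σ).asAlgebraHom (pairing δ f v) (a ⊗ₜ[k] x) := by
  have := lift_inducedStep_fst ρ δ σ F a x
  simp [inducedDual, inducedStep_apply, this]

theorem inducedRep_mul_inducedMul (g : G) (v : W) :
    inducedRep ρ σ g * inducedMul v = inducedMul (ρ g v) * inducedRep ρ σ g := by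
  ext a x
  simp

variable {ρ δ σ F}

/-- This is where the quasi-Yetter–Drinfeld condition enters: moving f past v before or after
applying g leaves β(f, g v) g and g β(f ∘ g, v) respectively, and these must agree. -/
theorem inducedDual_mul_inducedRep (h : IsQuasiYetterDrinfeld ρ δ)
    (hF : ∀ f g, F f * σ g = σ g * F (f ∘ₗ ρ g)) (f : Module.Dual k W) (g : G) :
    inducedDual ρ δ σ F f * inducedRep ρ σ g =
      inducedRep ρ σ g * inducedDual ρ δ σ F (f ∘ₗ ρ g) := by
  suffices H : ∀ a x, inducedDual ρ δ σ F f (inducedRep ρ σ g (a ⊗ₜ[k] x)) =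
      inducedRep ρ σ g (inducedDual ρ δ σ F (f ∘ₗ ρ g) (a ⊗ₜ[k] x)) by
    ext a x; exact H a x
  intro a x
  induction a using leftInduction with
  | hadd a b ha hb => simp only [TensorProduct.add_tmul, map_add, ha, hb]
  | hsmul r a ha => simp only [← TensorProduct.smul_tmul', map_smul, ha]
  | h1 =>
    have := LinearMap.congr_fun (hF f g) x
    simp only [inducedRep_tmul, map_one, inducedDual_one_tmul]
    exact congrArg _ this
  | h v a ha =>
    have e1 : inducedRep ρ σ g ((TensorAlgebra.ι k v * a) ⊗ₜ[k] x) =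
        (TensorAlgebra.ι k (ρ g v) * tensorMap (ρ g) a) ⊗ₜ[k] σ g x := by simp
    have e2 := congrArg (fun y => (inducedRep ρ σ).asAlgebraHom y (a ⊗ₜ[k] x))
      (h.pairing_mul f g v)
    simp only [map_mul, Module.End.mul_apply, Representation.asAlgebraHom_of] at e2
    rw [e1, inducedDual_mul_tmul, inducedDual_mul_tmul, ← inducedRep_tmul, ha, e2, map_add]
    congr 1
    exact (LinearMap.congr_fun (inducedRep_mul_inducedMul ρ σ g v) _).symm

/-- The `Ã(W, δ)`-module induced from a `kG ⋉ T(W*)`-module `X`. -/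
def inducedModule (h : IsQuasiYetterDrinfeld ρ δ)
    (hF : ∀ f g, F f * σ g = σ g * F (f ∘ₗ ρ g)) :
    FreeDouble ρ δ →ₐ[k] Module.End k (TensorAlgebra k W ⊗[k] X) :=
  FreeDouble.lift ρ δ inducedMul (inducedRep ρ σ).asAlgebraHom (inducedDual ρ δ σ F)
    (fun g v => by
      rw [Representation.asAlgebraHom_of, inducedRep_mul_inducedMul])
    (fun f g => by
      rw [Representation.asAlgebraHom_of, inducedDual_mul_inducedRep h hF])
    (fun f v => by
      ext a x
      exact inducedDual_mul_tmul ρ δ σ F f v a x)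

section
variable (h : IsQuasiYetterDrinfeld ρ δ) (hF : ∀ f g, F f * σ g = σ g * F (f ∘ₗ ρ g))

theorem inducedModule_lower_tmul (a a' : TensorAlgebra k W) (x : X) :
    inducedModule h hF (lower ρ δ a) (a' ⊗ₜ[k] x) = (a * a') ⊗ₜ[k] x := by
  induction a using leftInduction with
  | hadd a b ha hb => simp only [map_add, LinearMap.add_apply, ha, hb, add_mul, TensorProduct.add_tmul]
  | hsmul r a ha =>
    simp only [map_smul, LinearMap.smul_apply, ha, smul_mul_assoc, TensorProduct.smul_tmul']
  | h1 => simp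
  | h v a ha =>
    rw [map_mul, map_mul, Module.End.mul_apply, ha, inducedModule, FreeDouble.lift_lower_ι,
      inducedMul_tmul, mul_assoc]

theorem inducedModule_mid (y : MonoidAlgebra k G) :
    inducedModule h hF (mid ρ δ y) = (inducedRep ρ σ).asAlgebraHom y := by
  rw [inducedModule, FreeDouble.lift_mid]

theorem inducedModule_upper_one_tmul (f : Module.Dual k W) (x : X) :
    inducedModule h hF (upper ρ δ (TensorAlgebra.ι k f)) (1 ⊗ₜ[k] x) = 1 ⊗ₜ[k] F f x := by
  rw [inducedModule, FreeDouble.lift_upper_ι, inducedDual_one_tmul]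

end

end Induced

section FreeDecomposition

variable {k : Type u} [Field k] {G : Type v} [Group G] {W : Type w} [AddCommGroup W] [Module k W]
  (ρ : Representation k G W) (δ : Quasicoaction k G W)

/-- The left regular action of `G` on `kG ⊗ T(W*)`. -/
def regularRep : Representation k G (MonoidAlgebra k G ⊗[k] TensorAlgebra k (Module.Dual k W)) where
  toFun g := (LinearMap.mulLeft k (MonoidAlgebra.of k G g)).rTensor _
  map_one' := by
    ext; simp
  map_mul' g h := by
    ext; simp [mul_assoc]

/-- The action of `W*` on `kG ⊗ T(W*)`, given by `f · (g ⊗ b) = g ⊗ (f ∘ g) b`. -/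
def regularDual : Module.Dual k W →ₗ[k]
    Module.End k (MonoidAlgebra k G ⊗[k] TensorAlgebra k (Module.Dual k W)) :=
  LinearMap.flip (TensorProduct.lift
    ((Finsupp.lsum k fun g : G => LinearMap.toSpanSingleton k _
      (LinearMap.flip (LinearMap.mk₂ k
        (fun (f : Module.Dual k W) (b : TensorAlgebra k (Module.Dual k W)) =>
          MonoidAlgebra.of k G g ⊗ₜ[k] (TensorAlgebra.ι k (f ∘ₗ ρ g) * b))
        (fun f f' b => by simp [LinearMap.add_comp, add_mul, TensorProduct.tmul_add])
        (fun r f b => by simp [LinearMap.smul_comp])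
        (fun f b b' => by simp [mul_add, TensorProduct.tmul_add])
        (fun r f b => by simp)))) ∘ₗ (MonoidAlgebra.coeffLinearEquiv k).toLinearMap))

theorem regularDual_tmul (f : Module.Dual k W) (g : G) (b : TensorAlgebra k (Module.Dual k W)) :
    regularDual ρ f (MonoidAlgebra.of k G g ⊗ₜ[k] b) =
      MonoidAlgebra.of k G g ⊗ₜ[k] (TensorAlgebra.ι k (f ∘ₗ ρ g) * b) := by
  simp [regularDual]

/-- Both sides send g' ⊗ b to g g' ⊗ (f ∘ g g') b. This makes kG ⊗ T(W*) an admissible input for the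
induced module. -/
theorem regularDual_mul_regularRep (f : Module.Dual k W) (g : G) :
    regularDual ρ f * regularRep g = regularRep g * regularDual ρ (f ∘ₗ ρ g) := by
  refine TensorProduct.ext' fun x b => ?_
  induction x using monoidAlgebra_induction with
  | hadd x y hx hy => simp only [TensorProduct.add_tmul, map_add, hx, hy]
  | hsmul r x hx => simp only [← TensorProduct.smul_tmul', map_smul, hx]
  | h g' =>
    have e : ∀ c : TensorAlgebra k (Module.Dual k W),
        regularRep g (MonoidAlgebra.of k G g' ⊗ₜ[k] c) = MonoidAlgebra.of k G (g * g') ⊗ₜ[k] c := by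
      intro c; rw [map_mul]; rfl
    simp only [Module.End.mul_apply]
    rw [e, regularDual_tmul, regularDual_tmul, e, map_mul ρ]
    rfl

/-- The multiplication map `T(W) ⊗ kG ⊗ T(W*) → Ã(W, δ)`. -/
def triMap : (TensorAlgebra k W ⊗[k] MonoidAlgebra k G) ⊗[k] TensorAlgebra k (Module.Dual k W) →ₗ[k]
    FreeDouble ρ δ :=
  LinearMap.mul' k _ ∘ₗ TensorProduct.map
    (LinearMap.mul' k _ ∘ₗ TensorProduct.map (lower ρ δ).toLinearMap (mid ρ δ))
    (upper ρ δ).toLinearMap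

@[simp]
theorem triMap_tmul (a : TensorAlgebra k W) (h : MonoidAlgebra k G)
    (b : TensorAlgebra k (Module.Dual k W)) : triMap ρ δ (a ⊗ₜ h ⊗ₜ b) = tri ρ δ a h b := rfl

variable {ρ δ}

/-- Acting on 1 ⊗ 1 ⊗ 1 in the induced module recovers a ⊗ h ⊗ b from a h b: T(W*) multiplies the
last leg, then kG the middle one, then T(W) the first. -/
theorem triMap_injective (hq : IsQuasiYetterDrinfeld ρ δ) : Function.Injective (triMap ρ δ) := by
  let Θ := inducedModule hq (regularDual_mul_regularRep ρ)
  let ev : FreeDouble ρ δ →ₗ[k] _ := LinearMap.applyₗ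
    ((1 : TensorAlgebra k W) ⊗ₜ[k] ((1 : MonoidAlgebra k G) ⊗ₜ[k]
      (1 : TensorAlgebra k (Module.Dual k W)))) ∘ₗ Θ.toLinearMap
  have hup : ∀ b b', Θ (upper ρ δ b) (1 ⊗ₜ[k] (1 ⊗ₜ[k] b')) = 1 ⊗ₜ[k] (1 ⊗ₜ[k] (b * b')) := by
    intro b
    induction b using leftInduction with
    | hadd a b ha hb =>
      intro b'; simp only [map_add, LinearMap.add_apply, ha, hb, add_mul, TensorProduct.tmul_add]
    | hsmul r a ha =>
      intro b'; simp only [map_smul, LinearMap.smul_apply, ha, smul_mul_assoc,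
        TensorProduct.tmul_smul]
    | h1 => simp
    | h f b hb =>
      intro b'
      rw [map_mul, map_mul, Module.End.mul_apply, hb, inducedModule_upper_one_tmul,
        ← map_one (MonoidAlgebra.of k G), regularDual_tmul, map_one ρ, mul_assoc]
      rfl
  have key : ev ∘ₗ triMap ρ δ = (TensorProduct.assoc k _ _ _).toLinearMap := by
    refine TensorProduct.ext_threefold fun a x b => ?_
    change Θ (lower ρ δ a * mid ρ δ x * upper ρ δ b) (1 ⊗ₜ (1 ⊗ₜ 1)) = a ⊗ₜ (x ⊗ₜ b)
    rw [map_mul, Module.End.mul_apply, hup, mul_one, map_mul, Module.End.mul_apply,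
      inducedModule_mid]
    have : (inducedRep ρ regularRep).asAlgebraHom x
        ((1 : TensorAlgebra k W) ⊗ₜ[k] ((1 : MonoidAlgebra k G) ⊗ₜ[k] b)) = 1 ⊗ₜ[k] (x ⊗ₜ[k] b) := by
      induction x using monoidAlgebra_induction with
      | hadd x y hx hy => simp only [map_add, LinearMap.add_apply, hx, hy, TensorProduct.add_tmul,
          TensorProduct.tmul_add]
      | hsmul r x hx =>
        simp only [map_smul, LinearMap.smul_apply, hx, ← TensorProduct.smul_tmul',
          TensorProduct.tmul_smul]
      | h g =>
        rw [Representation.asAlgebraHom_of, inducedRep_tmul, map_one]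
        simp [regularRep]
    rw [this, inducedModule_lower_tmul, mul_one]
  intro x y hxy
  apply (TensorProduct.assoc k _ _ _).injective
  have := congrArg ev hxy
  rwa [← LinearMap.comp_apply, ← LinearMap.comp_apply, key] at this

theorem lower_mul_tri (a a' : TensorAlgebra k W) (h : MonoidAlgebra k G)
    (b : TensorAlgebra k (Module.Dual k W)) :
    lower ρ δ a * tri ρ δ a' h b = tri ρ δ (a * a') h b := by
  simp only [tri, map_mul, mul_assoc]

theorem tri_mul_upper (a : TensorAlgebra k W) (h : MonoidAlgebra k G)
    (b b' : TensorAlgebra k (Module.Dual k W)) :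
    tri ρ δ a h b * upper ρ δ b' = tri ρ δ a h (b * b') := by
  simp only [tri, map_mul, mul_assoc]

theorem mid_mul_tri (g : G) (a : TensorAlgebra k W) (h : MonoidAlgebra k G)
    (b : TensorAlgebra k (Module.Dual k W)) :
    mid ρ δ (MonoidAlgebra.of k G g) * tri ρ δ a h b =
      tri ρ δ (tensorMap (ρ g) a) (MonoidAlgebra.of k G g * h) b := by
  simp only [tri, mid_mul, ← mul_assoc, mid_mul_lower]

theorem tri_mul_mid (g : G) (a : TensorAlgebra k W) (h : MonoidAlgebra k G)
    (b : TensorAlgebra k (Module.Dual k W)) :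
    tri ρ δ a h b * mid ρ δ (MonoidAlgebra.of k G g) =
      tri ρ δ a (h * MonoidAlgebra.of k G g) (dualAct ρ g b) := by
  simp only [tri, mid_mul, mul_assoc, upper_mul_mid]

/-- The range contains 1 and is stable under left multiplication by the generators. The only
generators that are not immediate are the f ∈ W*. -/
theorem mem_range_triMap (x : FreeDouble ρ δ) : x ∈ LinearMap.range (triMap ρ δ) := by
  set S := LinearMap.range (triMap ρ δ) with hS
  have htri : ∀ a h b, tri ρ δ a h b ∈ S := fun a h b => ⟨a ⊗ₜ h ⊗ₜ b, rfl⟩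
  have hind : ∀ {p : FreeDouble ρ δ →ₗ[k] FreeDouble ρ δ}, (∀ a h b, p (tri ρ δ a h b) ∈ S) →
      ∀ x ∈ S, p x ∈ S := by
    rintro p hp x ⟨z, rfl⟩
    induction z using TensorProduct.induction_on with
    | zero => simp
    | add z z' hz hz' => rw [map_add, map_add]; exact S.add_mem hz hz'
    | tmul z b =>
      induction z using TensorProduct.induction_on with
      | zero => simp
      | add z z' hz hz' => rw [TensorProduct.add_tmul, map_add, map_add]; exact S.add_mem hz hz'
      | tmul a h => exact hp a h b
  have hV : ∀ v, ∀ x ∈ S, lower ρ δ (TensorAlgebra.ι k v) * x ∈ S := fun v =>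
    hind (p := LinearMap.mulLeft k _) fun a h b => by
      rw [LinearMap.mulLeft_apply, lower_mul_tri]; exact htri _ _ _
  have hG : ∀ g, ∀ x ∈ S, mid ρ δ (MonoidAlgebra.of k G g) * x ∈ S := fun g =>
    hind (p := LinearMap.mulLeft k _) fun a h b => by
      rw [LinearMap.mulLeft_apply, mid_mul_tri]; exact htri _ _ _
  have hH : ∀ h, ∀ x ∈ S, mid ρ δ h * x ∈ S := by
    intro h x hx
    induction h using monoidAlgebra_induction with
    | h g => exact hG g x hx
    | hadd a b ha hb => rw [map_add, add_mul]; exact S.add_mem ha hb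
    | hsmul r a ha => rw [map_smul, smul_mul_assoc]; exact S.smul_mem _ ha
  have hF : ∀ f, ∀ x ∈ S, upper ρ δ (TensorAlgebra.ι k f) * x ∈ S := by
    intro f
    refine hind (p := LinearMap.mulLeft k _) fun a h b => ?_
    rw [LinearMap.mulLeft_apply]
    -- Push `f` to the right one letter at a time: each exchange with v leaves β(f, v) ∈ kG in front
    -- of a shorter product, which `hH` keeps in the range.
    induction a using leftInduction with
    | hadd a a' ha ha' =>
      have : tri ρ δ (a + a') h b = tri ρ δ a h b + tri ρ δ a' h b := by simp [tri, add_mul]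
      rw [this, mul_add]; exact S.add_mem ha ha'
    | hsmul r a ha =>
      have : tri ρ δ (r • a) h b = r • tri ρ δ a h b := by simp [tri]
      rw [this, mul_smul_comm]; exact S.smul_mem _ ha
    | h1 =>
      induction h using monoidAlgebra_induction with
      | hadd x y hx hy =>
        have : tri ρ δ 1 (x + y) b = tri ρ δ 1 x b + tri ρ δ 1 y b := by simp [tri, add_mul]
        rw [this, mul_add]; exact S.add_mem hx hy
      | hsmul r x hx =>
        have : tri ρ δ 1 (r • x) b = r • tri ρ δ 1 x b := by simp [tri]
        rw [this, mul_smul_comm]; exact S.smul_mem _ hx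
      | h g =>
        have : upper ρ δ (TensorAlgebra.ι k f) * tri ρ δ 1 (MonoidAlgebra.of k G g) b =
            tri ρ δ 1 (MonoidAlgebra.of k G g) (TensorAlgebra.ι k (f ∘ₗ ρ g) * b) := by
          simp only [tri, map_one, one_mul, ← mul_assoc, ι_mul_mid, map_mul]
        rw [this]; exact htri _ _ _
    | h v a ha =>
      rw [← lower_mul_tri, ← mul_assoc, ι_mul_ι, add_mul, mul_assoc]
      exact S.add_mem (hV _ _ ha) (hH _ _ (htri _ _ _))
  have h1 : (1 : FreeDouble ρ δ) ∈ S := ⟨1 ⊗ₜ 1 ⊗ₜ 1, by simp [tri]⟩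
  simpa using FreeDouble.mul_mem_left ρ δ hV hG hF x 1 h1

theorem triMap_bijective (hq : IsQuasiYetterDrinfeld ρ δ) : Function.Bijective (triMap ρ δ) :=
  ⟨triMap_injective hq, mem_range_triMap⟩

/-- Induction on `Ã(W, δ)` along the triangular decomposition. -/
theorem FreeDouble.tri_induction {P : FreeDouble ρ δ → Prop} (h0 : P 0)
    (hadd : ∀ x y, P x → P y → P (x + y)) (htri : ∀ a h b, P (tri ρ δ a h b))
    (x : FreeDouble ρ δ) : P x := by
  obtain ⟨z, rfl⟩ := mem_range_triMap x
  induction z using TensorProduct.induction_on with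
  | zero => simpa using h0
  | add z z' hz hz' => rw [map_add]; exact hadd _ _ hz hz'
  | tmul z b =>
    induction z using TensorProduct.induction_on with
    | zero => simpa using h0
    | add z z' hz hz' => rw [TensorProduct.add_tmul, map_add]; exact hadd _ _ hz hz'
    | tmul a h => exact htri a h b

end FreeDecomposition

/-- Two surjections with the same kernel have isomorphic targets. -/
theorem exists_linearEquiv_of_ker_eq {k M N P : Type*} [Field k] [AddCommGroup M] [Module k M]
    [AddCommGroup N] [Module k N] [AddCommGroup P] [Module k P] {p : M →ₗ[k] N} {q : M →ₗ[k] P}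
    (hp : Function.Surjective p) (hq : Function.Surjective q)
    (h : LinearMap.ker p = LinearMap.ker q) : ∃ e : N ≃ₗ[k] P, ∀ m, e (p m) = q m := by
  refine ⟨(p.quotKerEquivOfSurjective hp).symm ≪≫ₗ Submodule.quotEquivOfEq _ _ h ≪≫ₗ
    q.quotKerEquivOfSurjective hq, fun m => ?_⟩
  have h1 : (p.quotKerEquivOfSurjective hp).symm (p m) = Submodule.Quotient.mk m := by
    rw [LinearEquiv.symm_apply_eq]; rfl
  rw [LinearEquiv.trans_apply, LinearEquiv.trans_apply, h1]
  rfl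

/-- The kernel of the tensor product of two quotient maps. -/
theorem ker_tensorProduct_map_mkQ {k M N : Type*} [Field k] [AddCommGroup M] [Module k M]
    [AddCommGroup N] [Module k N] {P : Type*} [AddCommGroup P] [Module k P] {p : M →ₗ[k] P}
    {A : Submodule k M} (hp : Function.Surjective p) (hA : LinearMap.ker p = A)
    (B : Submodule k N) : LinearMap.ker (TensorProduct.map p B.mkQ) =
      LinearMap.range (B.subtype.lTensor M) ⊔ LinearMap.range (A.subtype.rTensor N) := by
  refine TensorProduct.map_ker ?_ hp (LinearMap.exact_subtype_mkQ B) B.mkQ_surjective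
  rw [LinearMap.exact_iff, hA, Submodule.range_subtype]

/-! ### Triangular ideals and their quotients -/

section Triangular

variable {k : Type u} [Field k] {G : Type v} [Group G] {W : Type w} [AddCommGroup W] [Module k W]
  {ρ : Representation k G W} {δ : Quasicoaction k G W}

theorem toQuot_surjective (J : TwoSidedIdeal (FreeDouble ρ δ)) :
    Function.Surjective (toQuot ρ δ J) := Quotient.mk_surjective

theorem toQuot_eq_zero {J : TwoSidedIdeal (FreeDouble ρ δ)} {x : FreeDouble ρ δ} :
    toQuot ρ δ J x = 0 ↔ x ∈ J := by
  rw [TwoSidedIdeal.mem_iff]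
  exact Quotient.eq

/-- The subspace `I⁻ ⊗ kG ⊗ T(W*) + T(W) ⊗ kG ⊗ I⁺` of `Ã(W, δ)`. -/
def triSpan (ρ : Representation k G W) (δ : Quasicoaction k G W)
    (Im : Submodule k (TensorAlgebra k W)) (Ip : Submodule k (TensorAlgebra k (Module.Dual k W))) :
    Submodule k (FreeDouble ρ δ) :=
  Submodule.span k {x | ∃ a h b, (a ∈ Im ∨ b ∈ Ip) ∧ x = tri ρ δ a h b}

theorem tri_mem_triSpan {Im : Submodule k (TensorAlgebra k W)}
    {Ip : Submodule k (TensorAlgebra k (Module.Dual k W))} {a : TensorAlgebra k W}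
    {h : MonoidAlgebra k G} {b : TensorAlgebra k (Module.Dual k W)} (hab : a ∈ Im ∨ b ∈ Ip) :
    tri ρ δ a h b ∈ triSpan ρ δ Im Ip :=
  Submodule.subset_span ⟨a, h, b, hab, rfl⟩

/-- The kernel of `T(W) ⊗ kG ⊗ T(W*) → T(W)/I⁻ ⊗ kG ⊗ T(W*)/I⁺`. -/
theorem ker_map_mkQ {M H N : Type*} [AddCommGroup M] [Module k M] [AddCommGroup H] [Module k H]
    [AddCommGroup N] [Module k N] (Im : Submodule k M) (Ip : Submodule k N) :
    LinearMap.ker (TensorProduct.map (TensorProduct.map Im.mkQ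
      (LinearMap.id (R := k) (M := H))) Ip.mkQ) =
    Submodule.span k {z | ∃ a h b, (a ∈ Im ∨ b ∈ Ip) ∧ z = a ⊗ₜ[k] h ⊗ₜ[k] b} := by
  apply le_antisymm
  · have hsurj : Function.Surjective
        (TensorProduct.map Im.mkQ (LinearMap.id (R := k) (M := H))) :=
      LinearMap.rTensor_surjective _ Im.mkQ_surjective
    rw [ker_tensorProduct_map_mkQ hsurj (rTensor_mkQ _ _)]
    refine sup_le ?_ ?_
    · rintro _ ⟨z, rfl⟩
      induction z using TensorProduct.induction_on with
      | zero => simp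
      | add z z' hz hz' => rw [map_add]; exact Submodule.add_mem _ hz hz'
      | tmul z b =>
        induction z using TensorProduct.induction_on with
        | zero => simp
        | add z z' hz hz' => rw [TensorProduct.add_tmul, map_add]; exact Submodule.add_mem _ hz hz'
        | tmul a h => exact Submodule.subset_span ⟨a, h, b, Or.inr b.2, rfl⟩
    · rintro _ ⟨z, rfl⟩
      induction z using TensorProduct.induction_on with
      | zero => simp
      | add z z' hz hz' => rw [map_add]; exact Submodule.add_mem _ hz hz'
      | tmul z b =>
        obtain ⟨_, z, rfl⟩ := z
        induction z using TensorProduct.induction_on with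
        | zero =>
          rw [show (⟨_, 0, rfl⟩ : LinearMap.range (Im.subtype.rTensor H)) = 0 from
            Subtype.ext (map_zero _), TensorProduct.zero_tmul, map_zero]
          exact Submodule.zero_mem _
        | add z z' hz hz' =>
          have := Submodule.add_mem _ hz hz'
          rw [← map_add, ← TensorProduct.add_tmul] at this
          rwa [show (⟨_, z + z', rfl⟩ : LinearMap.range (Im.subtype.rTensor H)) =
            ⟨_, z, rfl⟩ + ⟨_, z', rfl⟩ from Subtype.ext (map_add _ _ _)]
        | tmul a h => exact Submodule.subset_span ⟨a, h, b, Or.inl a.2, rfl⟩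
  · rw [Submodule.span_le]
    rintro _ ⟨a, h, b, hab | hab, rfl⟩
    · simp [(Submodule.Quotient.mk_eq_zero Im).2 hab]
    · simp [(Submodule.Quotient.mk_eq_zero Ip).2 hab]

theorem map_triMap_span (Im : Submodule k (TensorAlgebra k W))
    (Ip : Submodule k (TensorAlgebra k (Module.Dual k W))) :
    (Submodule.span k {z | ∃ a h b, (a ∈ Im ∨ b ∈ Ip) ∧ z = a ⊗ₜ[k] h ⊗ₜ[k] b}).map (triMap ρ δ) =
      triSpan ρ δ Im Ip := by
  rw [Submodule.map_span, triSpan]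
  congr 1
  ext x
  constructor
  · rintro ⟨_, ⟨a, h, b, hab, rfl⟩, rfl⟩; exact ⟨a, h, b, hab, rfl⟩
  · rintro ⟨a, h, b, hab, rfl⟩; exact ⟨_, ⟨a, h, b, hab, rfl⟩, rfl⟩

/-- The quotient by a triangular ideal has a triangular decomposition. -/
theorem IsTriangularIdeal.hasTriangularDecomposition (hq : IsQuasiYetterDrinfeld ρ δ)
    {Im : Submodule k (TensorAlgebra k W)} {Ip : Submodule k (TensorAlgebra k (Module.Dual k W))}
    {J : TwoSidedIdeal (FreeDouble ρ δ)}
    (hJ : (J : Set (FreeDouble ρ δ)) = triSpan ρ δ Im Ip) :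
    HasTriangularDecomposition ρ δ Im Ip J := by
  let p := TensorProduct.map (TensorProduct.map Im.mkQ
      (LinearMap.id (R := k) (M := MonoidAlgebra k G))) Ip.mkQ
  have hp : Function.Surjective p :=
    TensorProduct.map_surjective (TensorProduct.map_surjective Im.mkQ_surjective
      Function.surjective_id) Ip.mkQ_surjective
  let q := (toQuot ρ δ J).toLinearMap ∘ₗ triMap ρ δ
  have hq' : Function.Surjective q := (toQuot_surjective J).comp mem_range_triMap
  have hker : LinearMap.ker p = LinearMap.ker q := by
    rw [ker_map_mkQ]
    -- As `triMap` is injective, the kernels can be compared through their images in the free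
    -- double; both images are `J`.
    apply Submodule.map_injective_of_injective (triMap_injective hq)
    rw [map_triMap_span]
    ext x
    have : x ∈ triSpan ρ δ Im Ip ↔ x ∈ J := by
      rw [← SetLike.mem_coe, ← hJ, SetLike.mem_coe]
    rw [this]
    constructor
    · intro hx
      obtain ⟨z, rfl⟩ := mem_range_triMap x
      exact ⟨z, toQuot_eq_zero.2 hx, rfl⟩
    · rintro ⟨z, hz, rfl⟩
      exact toQuot_eq_zero.1 hz
  obtain ⟨e, he⟩ := exists_linearEquiv_of_ker_eq (k := k)
    (M := (TensorAlgebra k W ⊗[k] MonoidAlgebra k G) ⊗[k] TensorAlgebra k (Module.Dual k W))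
    (N := ((TensorAlgebra k W ⧸ Im) ⊗[k] MonoidAlgebra k G) ⊗[k]
      (TensorAlgebra k (Module.Dual k W) ⧸ Ip)) (P := QuotAlg ρ δ J) hp hq' hker
  exact ⟨e, fun a h b => he (a ⊗ₜ h ⊗ₜ b)⟩

theorem triSpan_bot : triSpan ρ δ ⊥ ⊥ = ⊥ := by
  rw [triSpan, Submodule.span_eq_bot]
  rintro _ ⟨a, h, b, hab, rfl⟩
  rcases hab with hab | hab <;> rw [Submodule.mem_bot] at hab <;> simp [hab, tri]

/-- A quotient by a triangular ideal is a braided double. -/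
theorem IsTriangularIdeal.isBraidedDouble (hq : IsQuasiYetterDrinfeld ρ δ)
    {Im : Submodule k (TensorAlgebra k W)} {Ip : Submodule k (TensorAlgebra k (Module.Dual k W))}
    {J : TwoSidedIdeal (FreeDouble ρ δ)} (hJ : IsTriangularIdeal ρ δ Im Ip J) :
    IsBraidedDouble ρ δ Im Ip J where
  compat := hq
  free := IsTriangularIdeal.hasTriangularDecomposition hq (by
    rw [triSpan_bot, TwoSidedIdeal.coe_bot]; rfl)
  triangular := hJ
  decomposition := IsTriangularIdeal.hasTriangularDecomposition hq hJ.carrier_eq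

theorem mid_mul_mem {S : Submodule k (FreeDouble ρ δ)} {x : FreeDouble ρ δ}
    (h : ∀ g, mid ρ δ (MonoidAlgebra.of k G g) * x ∈ S) (y : MonoidAlgebra k G) :
    mid ρ δ y * x ∈ S := by
  induction y using monoidAlgebra_induction with
  | h g => exact h g
  | hadd a b ha hb => rw [map_add, add_mul]; exact S.add_mem ha hb
  | hsmul r a ha => rw [map_smul, smul_mul_assoc]; exact S.smul_mem _ ha

theorem mul_mid_mem {S : Submodule k (FreeDouble ρ δ)} {x : FreeDouble ρ δ}
    (h : ∀ g, x * mid ρ δ (MonoidAlgebra.of k G g) ∈ S) (y : MonoidAlgebra k G) :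
    x * mid ρ δ y ∈ S := by
  induction y using monoidAlgebra_induction with
  | h g => exact h g
  | hadd a b ha hb => rw [map_add, mul_add]; exact S.add_mem ha hb
  | hsmul r a ha => rw [map_smul, mul_smul_comm]; exact S.smul_mem _ ha

/-- `I⁻ ⊂ T(W)` is a `G`-stable two-sided ideal such that `I⁻ · Ã(W, δ)` is stable under left
multiplication by `W*`. -/
structure IsLowerIdeal (ρ : Representation k G W) (δ : Quasicoaction k G W)
    (Im : Submodule k (TensorAlgebra k W)) : Prop where
  ι_mul_mem : ∀ v, ∀ a ∈ Im, TensorAlgebra.ι k v * a ∈ Im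
  mul_mem : ∀ a ∈ Im, ∀ x, a * x ∈ Im
  act_mem : ∀ g, ∀ a ∈ Im, tensorMap (ρ g) a ∈ Im
  dual_mul_mem : ∀ f, ∀ a ∈ Im, upper ρ δ (TensorAlgebra.ι k f) * lower ρ δ a ∈ triSpan ρ δ Im ⊥

/-- `I⁺ ⊂ T(W*)` is a `G`-stable two-sided ideal such that `Ã(W, δ) · I⁺` is stable under right
multiplication by `W`. -/
structure IsUpperIdeal (ρ : Representation k G W) (δ : Quasicoaction k G W)
    (Ip : Submodule k (TensorAlgebra k (Module.Dual k W))) : Prop where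
  mul_ι_mem : ∀ f, ∀ b ∈ Ip, b * TensorAlgebra.ι k f ∈ Ip
  mul_mem : ∀ b ∈ Ip, ∀ x, x * b ∈ Ip
  act_mem : ∀ g, ∀ b ∈ Ip, dualAct ρ g b ∈ Ip
  mul_vec_mem : ∀ v, ∀ b ∈ Ip, upper ρ δ b * lower ρ δ (TensorAlgebra.ι k v) ∈ triSpan ρ δ ⊥ Ip

theorem lower_mem_triSpan {Im : Submodule k (TensorAlgebra k W)} {a : TensorAlgebra k W}
    (ha : a ∈ Im) : lower ρ δ a ∈ triSpan ρ δ Im ⊥ := by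
  have : lower ρ δ a = tri ρ δ a 1 1 := by simp [tri]
  rw [this]; exact tri_mem_triSpan (Or.inl ha)

theorem upper_mem_triSpan {Ip : Submodule k (TensorAlgebra k (Module.Dual k W))}
    {b : TensorAlgebra k (Module.Dual k W)} (hb : b ∈ Ip) : upper ρ δ b ∈ triSpan ρ δ ⊥ Ip := by
  have : upper ρ δ b = tri ρ δ 1 1 b := by simp [tri]
  rw [this]; exact tri_mem_triSpan (Or.inr hb)

theorem triSpan_lower_induction {Im : Submodule k (TensorAlgebra k W)}
    {S : Submodule k (FreeDouble ρ δ)} {p : FreeDouble ρ δ →ₗ[k] FreeDouble ρ δ}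
    (h : ∀ a ∈ Im, ∀ y b, p (tri ρ δ a y b) ∈ S) {x : FreeDouble ρ δ}
    (hx : x ∈ triSpan ρ δ Im ⊥) : p x ∈ S := by
  suffices H : triSpan ρ δ Im ⊥ ≤ S.comap p from H hx
  rw [triSpan, Submodule.span_le]
  rintro _ ⟨a, y, b, hab | hab, rfl⟩
  · exact h a hab y b
  · rw [Submodule.mem_bot] at hab; simp [hab, tri]

theorem triSpan_upper_induction {Ip : Submodule k (TensorAlgebra k (Module.Dual k W))}
    {S : Submodule k (FreeDouble ρ δ)} {p : FreeDouble ρ δ →ₗ[k] FreeDouble ρ δ}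
    (h : ∀ a y, ∀ b ∈ Ip, p (tri ρ δ a y b) ∈ S) {x : FreeDouble ρ δ}
    (hx : x ∈ triSpan ρ δ ⊥ Ip) : p x ∈ S := by
  suffices H : triSpan ρ δ ⊥ Ip ≤ S.comap p from H hx
  rw [triSpan, Submodule.span_le]
  rintro _ ⟨a, y, b, hab | hab, rfl⟩
  · rw [Submodule.mem_bot] at hab; simp [hab, tri]
  · exact h a y b hab

/-- Written as a sum of products a' y b, the element x only affects the left leg through a a', so a
right ideal `Im` suffices. -/
theorem IsLowerIdeal.lower_mul_mem {Im : Submodule k (TensorAlgebra k W)}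
    (h : ∀ a ∈ Im, ∀ x, a * x ∈ Im) {a : TensorAlgebra k W} (ha : a ∈ Im) (x : FreeDouble ρ δ) :
    lower ρ δ a * x ∈ triSpan ρ δ Im ⊥ := by
  induction x using FreeDouble.tri_induction with
  | h0 => simp
  | hadd x y hx hy => rw [mul_add]; exact Submodule.add_mem _ hx hy
  | htri a' y b => rw [lower_mul_tri]; exact tri_mem_triSpan (Or.inl (h a ha a'))

theorem IsUpperIdeal.mul_upper_mem {Ip : Submodule k (TensorAlgebra k (Module.Dual k W))}
    (h : ∀ b ∈ Ip, ∀ x, x * b ∈ Ip) {b : TensorAlgebra k (Module.Dual k W)} (hb : b ∈ Ip)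
    (x : FreeDouble ρ δ) : x * upper ρ δ b ∈ triSpan ρ δ ⊥ Ip := by
  induction x using FreeDouble.tri_induction with
  | h0 => simp
  | hadd x y hx hy => rw [add_mul]; exact Submodule.add_mem _ hx hy
  | htri a y b' => rw [tri_mul_upper]; exact tri_mem_triSpan (Or.inr (h b hb b'))

theorem IsLowerIdeal.mul_mem_right {Im : Submodule k (TensorAlgebra k W)}
    (h : ∀ a ∈ Im, ∀ x, a * x ∈ Im) {x : FreeDouble ρ δ}
    (hx : x ∈ triSpan ρ δ Im ⊥) (y : FreeDouble ρ δ) : x * y ∈ triSpan ρ δ Im ⊥ :=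
  triSpan_lower_induction (p := LinearMap.mulRight k y) (fun a ha z b => by
    rw [LinearMap.mulRight_apply, tri, mul_assoc, mul_assoc]
    exact IsLowerIdeal.lower_mul_mem h ha _) hx

theorem IsUpperIdeal.mul_mem_left {Ip : Submodule k (TensorAlgebra k (Module.Dual k W))}
    (h : ∀ b ∈ Ip, ∀ x, x * b ∈ Ip) {x : FreeDouble ρ δ}
    (hx : x ∈ triSpan ρ δ ⊥ Ip) (y : FreeDouble ρ δ) : y * x ∈ triSpan ρ δ ⊥ Ip :=
  triSpan_upper_induction (p := LinearMap.mulLeft k y) (fun a z b hb => by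
    rw [LinearMap.mulLeft_apply, tri, ← mul_assoc]
    exact IsUpperIdeal.mul_upper_mem h hb _) hx

/-- It is enough to multiply by generators. Vectors, group elements and functionals are handled by
`ι_mul_mem`, `act_mem` and `dual_mul_mem`, the last combined with the right ideal property. -/
theorem IsLowerIdeal.mul_mem_left {Im : Submodule k (TensorAlgebra k W)} (h : IsLowerIdeal ρ δ Im)
    {x : FreeDouble ρ δ} (hx : x ∈ triSpan ρ δ Im ⊥) (y : FreeDouble ρ δ) :
    y * x ∈ triSpan ρ δ Im ⊥ := by
  refine FreeDouble.mul_mem_left ρ δ ?_ ?_ ?_ y x hx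
  · intro v x
    refine triSpan_lower_induction (p := LinearMap.mulLeft k _) fun a ha z b => ?_
    rw [LinearMap.mulLeft_apply, lower_mul_tri]
    exact tri_mem_triSpan (Or.inl (h.ι_mul_mem _ _ ha))
  · intro g x
    refine triSpan_lower_induction (p := LinearMap.mulLeft k _) fun a ha z b => ?_
    rw [LinearMap.mulLeft_apply, mid_mul_tri]
    exact tri_mem_triSpan (Or.inl (h.act_mem _ _ ha))
  · intro f x
    refine triSpan_lower_induction (p := LinearMap.mulLeft k _) fun a ha z b => ?_
    rw [LinearMap.mulLeft_apply, tri, ← mul_assoc, ← mul_assoc, mul_assoc]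
    exact IsLowerIdeal.mul_mem_right h.mul_mem (h.dual_mul_mem f a ha) _

theorem IsUpperIdeal.mul_mem_right {Ip : Submodule k (TensorAlgebra k (Module.Dual k W))}
    (h : IsUpperIdeal ρ δ Ip) {x : FreeDouble ρ δ} (hx : x ∈ triSpan ρ δ ⊥ Ip)
    (y : FreeDouble ρ δ) : x * y ∈ triSpan ρ δ ⊥ Ip := by
  refine FreeDouble.mul_mem_right ρ δ ?_ ?_ ?_ y x hx
  · intro v x
    refine triSpan_upper_induction (p := LinearMap.mulRight k _) fun a z b hb => ?_
    rw [LinearMap.mulRight_apply, tri, mul_assoc]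
    exact IsUpperIdeal.mul_mem_left h.mul_mem (h.mul_vec_mem v b hb) _
  · intro g x
    refine triSpan_upper_induction (p := LinearMap.mulRight k _) fun a z b hb => ?_
    rw [LinearMap.mulRight_apply, tri_mul_mid]
    exact tri_mem_triSpan (Or.inr (h.act_mem _ _ hb))
  · intro f x
    refine triSpan_upper_induction (p := LinearMap.mulRight k _) fun a z b hb => ?_
    rw [LinearMap.mulRight_apply, tri_mul_upper]
    exact tri_mem_triSpan (Or.inr (h.mul_ι_mem _ _ hb))

theorem triSpan_eq_sup (Im : Submodule k (TensorAlgebra k W))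
    (Ip : Submodule k (TensorAlgebra k (Module.Dual k W))) :
    triSpan ρ δ Im Ip = triSpan ρ δ Im ⊥ ⊔ triSpan ρ δ ⊥ Ip := by
  apply le_antisymm
  · rw [triSpan, Submodule.span_le]
    rintro _ ⟨a, y, b, hab | hab, rfl⟩
    · exact Submodule.mem_sup_left (tri_mem_triSpan (Or.inl hab))
    · exact Submodule.mem_sup_right (tri_mem_triSpan (Or.inr hab))
  · refine sup_le (Submodule.span_mono ?_) (Submodule.span_mono ?_) <;>
    · rintro _ ⟨a, y, b, hab, rfl⟩
      refine ⟨a, y, b, ?_, rfl⟩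
      rcases hab with hab | hab
      · first | exact Or.inl hab | exact Or.inl ((Submodule.mem_bot k).1 hab ▸ Submodule.zero_mem _)
      · first | exact Or.inr hab | exact Or.inr ((Submodule.mem_bot k).1 hab ▸ Submodule.zero_mem _)

/-- The triangular ideal attached to a lower and an upper ideal. -/
def triangularIdeal {Im : Submodule k (TensorAlgebra k W)}
    {Ip : Submodule k (TensorAlgebra k (Module.Dual k W))} (hm : IsLowerIdeal ρ δ Im)
    (hp : IsUpperIdeal ρ δ Ip) : TwoSidedIdeal (FreeDouble ρ δ) :=
  TwoSidedIdeal.mk' (triSpan ρ δ Im Ip : Set (FreeDouble ρ δ)) (Submodule.zero_mem _)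
    (Submodule.add_mem _) (Submodule.neg_mem _)
    (fun {x y} hy => by
      rw [triSpan_eq_sup, SetLike.mem_coe, Submodule.mem_sup] at hy ⊢
      obtain ⟨a, ha, b, hb, rfl⟩ := hy
      exact ⟨_, hm.mul_mem_left ha x, _, IsUpperIdeal.mul_mem_left hp.mul_mem hb x,
        (mul_add _ _ _).symm⟩)
    (fun {x y} hx => by
      rw [triSpan_eq_sup, SetLike.mem_coe, Submodule.mem_sup] at hx ⊢
      obtain ⟨a, ha, b, hb, rfl⟩ := hx
      exact ⟨_, IsLowerIdeal.mul_mem_right hm.mul_mem ha y, _, hp.mul_mem_right hb y,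
        (add_mul _ _ _).symm⟩)

theorem isTriangularIdeal_triangularIdeal {Im : Submodule k (TensorAlgebra k W)}
    {Ip : Submodule k (TensorAlgebra k (Module.Dual k W))} (hm : IsLowerIdeal ρ δ Im)
    (hp : IsUpperIdeal ρ δ Ip) (hm' : Im ≤ positivePart k W)
    (hp' : Ip ≤ positivePart k (Module.Dual k W)) :
    IsTriangularIdeal ρ δ Im Ip (triangularIdeal hm hp) where
  lower_pos := hm'
  upper_pos := hp'
  carrier_eq := TwoSidedIdeal.coe_mk' _ _ _ _ _ _

end Triangular

/-! ### Tensor induction along spanning sets of letters -/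

section SpanInduction

variable {k : Type u} [Field k] {M : Type w} [AddCommGroup M] [Module k M]

/-- Left induction on the tensor algebra along a spanning set. -/
theorem leftInduction_of_span {s : Set M} (hs : Submodule.span k s = ⊤)
    {P : TensorAlgebra k M → Prop} (hadd : ∀ a b, P a → P b → P (a + b))
    (hsmul : ∀ (r : k) a, P a → P (r • a)) (h1 : P 1)
    (h : ∀ m ∈ s, ∀ a, P a → P (TensorAlgebra.ι k m * a)) (a : TensorAlgebra k M) : P a := by
  refine leftInduction hadd hsmul h1 (fun m a ha => ?_) a
  have hm : m ∈ Submodule.span k s := hs ▸ Submodule.mem_top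
  induction hm using Submodule.span_induction with
  | mem m hm => exact h m hm a ha
  | zero => simpa using hsmul 0 1 h1
  | add m m' _ _ hm hm' => rw [map_add, add_mul]; exact hadd _ _ hm hm'
  | smul r m _ hm => rw [map_smul, smul_mul_assoc]; exact hsmul _ _ hm

/-- Right induction on the tensor algebra along a spanning set. -/
theorem rightInduction_of_span {s : Set M} (hs : Submodule.span k s = ⊤)
    {P : TensorAlgebra k M → Prop} (hadd : ∀ a b, P a → P b → P (a + b))
    (hsmul : ∀ (r : k) a, P a → P (r • a)) (h1 : P 1)
    (h : ∀ m ∈ s, ∀ a, P a → P (a * TensorAlgebra.ι k m)) (a : TensorAlgebra k M) : P a := by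
  refine rightInduction hadd hsmul h1 (fun m a ha => ?_) a
  have hm : m ∈ Submodule.span k s := hs ▸ Submodule.mem_top
  induction hm using Submodule.span_induction with
  | mem m hm => exact h m hm a ha
  | zero => simpa using hsmul 0 1 h1
  | add m m' _ _ hm hm' => rw [map_add, mul_add]; exact hadd _ _ hm hm'
  | smul r m _ hm => rw [map_smul, mul_smul_comm]; exact hsmul _ _ hm

end SpanInduction

/-! ### The Harish-Chandra form and the minimal double -/

section Form

variable {k : Type u} [Field k] {G : Type v} [Group G] {W : Type w} [AddCommGroup W] [Module k W]
  {ρ : Representation k G W} {δ : Quasicoaction k G W}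

variable (k G) in
/-- The augmentation of the group algebra. -/
def augmentation : MonoidAlgebra k G →ₐ[k] k := MonoidAlgebra.lift k k G 1

@[simp]
theorem augmentation_of (g : G) : augmentation k G (MonoidAlgebra.of k G g) = 1 := by
  simp [augmentation]

/-- The functional `ε ⊗ ε ⊗ ε` on `Ã(W, δ) = T(W) ⊗ kG ⊗ T(W*)`. -/
def vacuum (hq : IsQuasiYetterDrinfeld ρ δ) : FreeDouble ρ δ →ₗ[k] k :=
  LinearMap.mul' k k ∘ₗ TensorProduct.map (LinearMap.mul' k k ∘ₗ
    TensorProduct.map TensorAlgebra.algebraMapInv.toLinearMap (augmentation k G).toLinearMap)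
    TensorAlgebra.algebraMapInv.toLinearMap ∘ₗ
    (LinearEquiv.ofBijective (triMap ρ δ) (triMap_bijective hq)).symm.toLinearMap

variable (hq : IsQuasiYetterDrinfeld ρ δ)

theorem vacuum_tri (a : TensorAlgebra k W) (h : MonoidAlgebra k G)
    (b : TensorAlgebra k (Module.Dual k W)) : vacuum hq (tri ρ δ a h b) =
      TensorAlgebra.algebraMapInv a * augmentation k G h * TensorAlgebra.algebraMapInv b := by
  have : (LinearEquiv.ofBijective (triMap ρ δ) (triMap_bijective hq)).symm (tri ρ δ a h b) =
      a ⊗ₜ h ⊗ₜ b := by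
    rw [LinearEquiv.symm_apply_eq]; rfl
  simp only [vacuum, LinearMap.comp_apply, LinearEquiv.coe_coe, this]
  rfl

/-- The functional kills W on the left and W* on the right, and ignores group elements on either
side, because each of these multiplications preserves the order a h b. Pairings can thus be computed
by moving letters outwards. -/
theorem vacuum_lower_mul (v : W) (x : FreeDouble ρ δ) :
    vacuum hq (lower ρ δ (TensorAlgebra.ι k v) * x) = 0 := by
  induction x using FreeDouble.tri_induction with
  | h0 => simp
  | hadd x y hx hy => simp only [mul_add, map_add, hx, hy, add_zero]
  | htri a h b => simp [lower_mul_tri, vacuum_tri]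

theorem vacuum_mul_upper (f : Module.Dual k W) (x : FreeDouble ρ δ) :
    vacuum hq (x * upper ρ δ (TensorAlgebra.ι k f)) = 0 := by
  induction x using FreeDouble.tri_induction with
  | h0 => simp
  | hadd x y hx hy => simp only [add_mul, map_add, hx, hy, add_zero]
  | htri a h b => simp [tri_mul_upper, vacuum_tri]

theorem vacuum_mid_mul (g : G) (x : FreeDouble ρ δ) :
    vacuum hq (mid ρ δ (MonoidAlgebra.of k G g) * x) = vacuum hq x := by
  induction x using FreeDouble.tri_induction with
  | h0 => simp
  | hadd x y hx hy => simp only [mul_add, map_add, hx, hy]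
  | htri a h b => rw [mid_mul_tri, vacuum_tri, vacuum_tri, map_mul, augmentation_of, one_mul,
      algebraMapInv_tensorMap]

theorem vacuum_mul_mid (g : G) (x : FreeDouble ρ δ) :
    vacuum hq (x * mid ρ δ (MonoidAlgebra.of k G g)) = vacuum hq x := by
  induction x using FreeDouble.tri_induction with
  | h0 => simp
  | hadd x y hx hy => simp only [add_mul, map_add, hx, hy]
  | htri a h b => rw [tri_mul_mid, vacuum_tri, vacuum_tri, map_mul, augmentation_of, mul_one,
      algebraMapInv_tensorMap]

theorem vacuum_lower (a : TensorAlgebra k W) :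
    vacuum hq (lower ρ δ a) = TensorAlgebra.algebraMapInv a := by
  have : lower ρ δ a = tri ρ δ a 1 1 := by simp [tri]
  rw [this, vacuum_tri]; simp

theorem vacuum_upper (b : TensorAlgebra k (Module.Dual k W)) :
    vacuum hq (upper ρ δ b) = TensorAlgebra.algebraMapInv b := by
  have : upper ρ δ b = tri ρ δ 1 1 b := by simp [tri]
  rw [this, vacuum_tri]; simp

/-- The bilinear form `⟨b, a⟩ = (ε ⊗ ε ⊗ ε)(b a)` on `T(W*) × T(W)`. -/
def form (b : TensorAlgebra k (Module.Dual k W)) (a : TensorAlgebra k W) : k :=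
  vacuum hq (upper ρ δ b * lower ρ δ a)

theorem form_add_left (b b' : TensorAlgebra k (Module.Dual k W)) (a : TensorAlgebra k W) :
    form hq (b + b') a = form hq b a + form hq b' a := by
  simp [form, add_mul]

theorem form_add_right (b : TensorAlgebra k (Module.Dual k W)) (a a' : TensorAlgebra k W) :
    form hq b (a + a') = form hq b a + form hq b a' := by
  simp [form, mul_add]

theorem form_smul_left (r : k) (b : TensorAlgebra k (Module.Dual k W)) (a : TensorAlgebra k W) :
    form hq (r • b) a = r * form hq b a := by
  simp [form]

theorem form_smul_right (r : k) (b : TensorAlgebra k (Module.Dual k W)) (a : TensorAlgebra k W) :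
    form hq b (r • a) = r * form hq b a := by
  simp [form]

/-- Insert g on the left at no cost, carry it through b and then through a, and drop it on the
right. -/
theorem form_dualAct (g : G) (b : TensorAlgebra k (Module.Dual k W)) (a : TensorAlgebra k W) :
    form hq (dualAct ρ g b) a = form hq b (tensorMap (ρ g) a) := by
  rw [form, form, ← vacuum_mid_mul hq g, ← mul_assoc, ← upper_mul_mid, mul_assoc, mid_mul_lower,
    ← mul_assoc, vacuum_mul_mid]

/-- The radical of the form in `T(W)`. -/
def lowerRadical : Submodule k (TensorAlgebra k W) where
  carrier := {a | ∀ b, form hq b a = 0}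
  add_mem' ha ha' b := by rw [form_add_right, ha b, ha' b, add_zero]
  zero_mem' b := by simp [form]
  smul_mem' r a ha b := by rw [form_smul_right, ha b, mul_zero]

/-- The radical of the form in `T(W*)`. -/
def upperRadical : Submodule k (TensorAlgebra k (Module.Dual k W)) where
  carrier := {b | ∀ a, form hq b a = 0}
  add_mem' hb hb' a := by rw [form_add_left, hb a, hb' a, add_zero]
  zero_mem' b := by simp [form]
  smul_mem' r b hb a := by rw [form_smul_left, hb a, mul_zero]

theorem mem_lowerRadical {a : TensorAlgebra k W} :
    a ∈ lowerRadical hq ↔ ∀ b, form hq b a = 0 := Iff.rfl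

theorem mem_upperRadical {b : TensorAlgebra k (Module.Dual k W)} :
    b ∈ upperRadical hq ↔ ∀ a, form hq b a = 0 := Iff.rfl

/-- Pairing with 1 is the augmentation. -/
theorem lowerRadical_le_positivePart : lowerRadical hq ≤ positivePart k W := by
  intro a ha
  have := ha 1
  rwa [form, map_one, one_mul, vacuum_lower] at this

theorem upperRadical_le_positivePart :
    upperRadical hq ≤ positivePart k (Module.Dual k W) := by
  intro b hb
  have := hb 1
  rwa [form, map_one, mul_one, vacuum_upper] at this

/-- A triangular ideal lies in the one given by the radicals of the form. -/
theorem IsTriangularIdeal.le_radical {Im : Submodule k (TensorAlgebra k W)}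
    {Ip : Submodule k (TensorAlgebra k (Module.Dual k W))} {J : TwoSidedIdeal (FreeDouble ρ δ)}
    (hJ : IsTriangularIdeal ρ δ Im Ip J) : Im ≤ lowerRadical hq ∧ Ip ≤ upperRadical hq := by
  have hmem : ∀ x, x ∈ J ↔ x ∈ triSpan ρ δ Im Ip := fun x => by
    rw [← SetLike.mem_coe, hJ.carrier_eq]; rfl
  -- The generators a h b of `J` have a or b of augmentation zero. Since `J` is two-sided, all
  -- products b a with a in `Im` or b in `Ip` stay in `J`.
  have hvac : ∀ x ∈ J, vacuum hq x = 0 := by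
    intro x hx
    rw [hmem] at hx
    suffices H : triSpan ρ δ Im Ip ≤ LinearMap.ker (vacuum hq) from H hx
    rw [triSpan, Submodule.span_le]
    rintro _ ⟨a, y, b, hab | hab, rfl⟩
    · have h0 : TensorAlgebra.algebraMapInv (R := k) a = 0 := hJ.lower_pos hab
      simp [vacuum_tri, h0]
    · have h0 : TensorAlgebra.algebraMapInv (R := k) b = 0 := hJ.upper_pos hab
      simp [vacuum_tri, h0]
  constructor
  · intro a ha b
    refine hvac _ (J.mul_mem_left _ _ ((hmem _).2 ?_))
    have : lower ρ δ a = tri ρ δ a 1 1 := by simp [tri]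
    rw [this]; exact tri_mem_triSpan (Or.inl ha)
  · intro b hb a
    refine hvac _ (J.mul_mem_right _ _ ((hmem _).2 ?_))
    have : upper ρ δ b = tri ρ δ 1 1 b := by simp [tri]
    rw [this]; exact tri_mem_triSpan (Or.inr hb)

end Form

/-! ### Gradings: the radicals define the largest triangular ideal -/

section Graded

variable {k : Type u} [Field k] {G : Type v} [Group G] {W : Type w} [AddCommGroup W] [Module k W]

/-- `x ∈ W` is homogeneous of degree `g`. -/
def IsHomogeneousVec (δ : Quasicoaction k G W) (g : G) (x : W) : Prop :=
  δ x = MonoidAlgebra.of k G g ⊗ₜ[k] x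

/-- `f ∈ W*` is homogeneous of degree `g`. -/
def IsHomogeneousDual (δ : Quasicoaction k G W) (g : G) (f : Module.Dual k W) : Prop :=
  ∀ x, pairing δ f x = f x • MonoidAlgebra.of k G g

/-- The quasicoaction `δ` is a `G`-grading of `W`: both `W` and `W*` are spanned by homogeneous
elements. -/
structure IsGrading (δ : Quasicoaction k G W) : Prop where
  span_vec : Submodule.span k {x | ∃ g, IsHomogeneousVec δ g x} = ⊤
  span_dual : Submodule.span k {f | ∃ g, IsHomogeneousDual δ g f} = ⊤

theorem IsHomogeneousVec.pairing_eq {δ : Quasicoaction k G W} {g : G} {x : W}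
    (hx : IsHomogeneousVec δ g x) (f : Module.Dual k W) :
    pairing δ f x = f x • MonoidAlgebra.of k G g := by
  rw [pairing, hx]; simp

variable {ρ : Representation k G W} {δ : Quasicoaction k G W}

/-- Every value β(f, v) is a multiple of the same g, and group elements move past T(W), so all
correction terms can be collected in front of one g. This is what allows a scalar-valued pairing
instead of a kG-valued one. -/
theorem IsHomogeneousDual.exists_commute {g : G} {f : Module.Dual k W}
    (hf : IsHomogeneousDual δ g f) (a : TensorAlgebra k W) :
    ∃ a', upper ρ δ (TensorAlgebra.ι k f) * lower ρ δ a =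
      lower ρ δ a * upper ρ δ (TensorAlgebra.ι k f) +
        lower ρ δ a' * mid ρ δ (MonoidAlgebra.of k G g) := by
  induction a using rightInduction with
  | hadd a b ha hb =>
    obtain ⟨a', ha⟩ := ha
    obtain ⟨b', hb⟩ := hb
    exact ⟨a' + b', by simp only [map_add, mul_add, add_mul, ha, hb]; abel⟩
  | hsmul r a ha =>
    obtain ⟨a', ha⟩ := ha
    exact ⟨r • a', by simp only [map_smul, mul_smul_comm, smul_mul_assoc, ha, smul_add]⟩
  | h1 => exact ⟨0, by simp⟩
  | h v a ha =>
    obtain ⟨a', ha⟩ := ha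
    -- From f a v = a f v + a' g v: the first term contributes f(v) a g, and the second becomes a'
    -- g(v) g.
    refine ⟨f v • a + a' * TensorAlgebra.ι k (ρ g v), ?_⟩
    rw [map_mul, ← mul_assoc, ha, add_mul, mul_assoc, ι_mul_ι, hf v, map_smul, mul_assoc,
      mid_mul_ι, map_add, map_smul, map_mul]
    simp only [mul_add, add_mul, mul_smul_comm, smul_mul_assoc, mul_assoc, add_assoc]

theorem IsHomogeneousVec.exists_commute {g : G} {x : W}
    (hx : IsHomogeneousVec δ g x) (b : TensorAlgebra k (Module.Dual k W)) :
    ∃ b', upper ρ δ b * lower ρ δ (TensorAlgebra.ι k x) =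
      lower ρ δ (TensorAlgebra.ι k x) * upper ρ δ b +
        mid ρ δ (MonoidAlgebra.of k G g) * upper ρ δ b' := by
  induction b using leftInduction with
  | hadd a b ha hb =>
    obtain ⟨a', ha⟩ := ha
    obtain ⟨b', hb⟩ := hb
    exact ⟨a' + b', by simp only [map_add, mul_add, add_mul, ha, hb]; abel⟩
  | hsmul r a ha =>
    obtain ⟨a', ha⟩ := ha
    exact ⟨r • a', by simp only [map_smul, mul_smul_comm, smul_mul_assoc, ha, smul_add]⟩
  | h1 => exact ⟨0, by simp⟩
  | h f b hb =>
    obtain ⟨b', hb⟩ := hb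
    -- Mirror image: f x b gives f(x) g b, and f g b' = g (f ∘ g) b'.
    refine ⟨f x • b + TensorAlgebra.ι k (f ∘ₗ ρ g) * b', ?_⟩
    rw [map_mul, mul_assoc, hb, mul_add, ← mul_assoc, ι_mul_ι, hx.pairing_eq, map_smul,
      ← mul_assoc, ι_mul_mid, map_add, map_smul, map_mul]
    simp only [mul_add, add_mul, mul_smul_comm, smul_mul_assoc, mul_assoc, add_assoc]

variable {hq : IsQuasiYetterDrinfeld ρ δ}

theorem tensorMap_mem_lowerRadical {a : TensorAlgebra k W} (ha : a ∈ lowerRadical hq) (g : G) :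
    tensorMap (ρ g) a ∈ lowerRadical hq := fun b => by
  rw [← form_dualAct, ha]

theorem dualAct_mem_upperRadical {b : TensorAlgebra k (Module.Dual k W)}
    (hb : b ∈ upperRadical hq) (g : G) : dualAct ρ g b ∈ upperRadical hq := fun a => by
  rw [form_dualAct, hb]

/-- Test a against b f: the summand ending in f is killed and the trailing g is dropped, which
leaves ⟨b, a'⟩. -/
theorem mem_lowerRadical_of_commute {g : G} {f : Module.Dual k W} {a a' : TensorAlgebra k W}
    (h : upper ρ δ (TensorAlgebra.ι k f) * lower ρ δ a =
      lower ρ δ a * upper ρ δ (TensorAlgebra.ι k f) +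
        lower ρ δ a' * mid ρ δ (MonoidAlgebra.of k G g)) (ha : a ∈ lowerRadical hq) :
    a' ∈ lowerRadical hq := by
  intro b
  have h1 := ha (b * TensorAlgebra.ι k f)
  rwa [form, map_mul (upper ρ δ), mul_assoc, h, mul_add, map_add, ← mul_assoc, ← mul_assoc, vacuum_mul_upper,
    vacuum_mul_mid, zero_add] at h1

theorem mem_upperRadical_of_commute {g : G} {x : W} {b b' : TensorAlgebra k (Module.Dual k W)}
    (h : upper ρ δ b * lower ρ δ (TensorAlgebra.ι k x) =
      lower ρ δ (TensorAlgebra.ι k x) * upper ρ δ b +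
        mid ρ δ (MonoidAlgebra.of k G g) * upper ρ δ b') (hb : b ∈ upperRadical hq) :
    b' ∈ upperRadical hq := by
  intro a
  have h1 := hb (TensorAlgebra.ι k x * a)
  rwa [form, map_mul (lower ρ δ), ← mul_assoc, h, add_mul, map_add, mul_assoc, mul_assoc,
    vacuum_lower_mul, vacuum_mid_mul, zero_add] at h1

/-- Remove the last letter f from b by moving it through a v. One summand ends in f and vanishes,
one is f(v)⟨b, a⟩ = 0, and the third is ⟨b, a' g(v)⟩, covered by induction because a' is again in
the radical. Hence both a and v must vary in the induction. -/
theorem mul_ι_mem_lowerRadical (hδ : IsGrading δ)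
    (v : W) {a : TensorAlgebra k W} (ha : a ∈ lowerRadical hq) :
    a * TensorAlgebra.ι k v ∈ lowerRadical hq := by
  intro b
  induction b using rightInduction_of_span hδ.span_dual generalizing v a with
  | hadd b b' hb hb' => rw [form_add_left, hb v ha, hb' v ha, add_zero]
  | hsmul r b hb => rw [form_smul_left, hb v ha, mul_zero]
  | h1 =>
    rw [form, map_one, one_mul, vacuum_lower]; simp
  | h f hf b ih =>
    obtain ⟨g, hf⟩ := hf
    obtain ⟨a', h⟩ := hf.exists_commute (ρ := ρ) a
    have e : upper ρ δ (b * TensorAlgebra.ι k f) * lower ρ δ (a * TensorAlgebra.ι k v) =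
        upper ρ δ b * lower ρ δ (a * TensorAlgebra.ι k v) * upper ρ δ (TensorAlgebra.ι k f) +
        f v • (upper ρ δ b * lower ρ δ a * mid ρ δ (MonoidAlgebra.of k G g)) +
        upper ρ δ b * lower ρ δ (a' * TensorAlgebra.ι k (ρ g v)) *
          mid ρ δ (MonoidAlgebra.of k G g) := by
      rw [map_mul, map_mul, mul_assoc, ← mul_assoc (upper ρ δ (TensorAlgebra.ι k f)), h, add_mul,
        mul_assoc (lower ρ δ a), ι_mul_ι, hf v, map_smul, mul_assoc (lower ρ δ a'), mid_mul_ι,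
        map_mul]
      simp only [mul_add, mul_smul_comm, mul_assoc]
    have e2 := ha b
    have e3 := ih (ρ g v) (mem_lowerRadical_of_commute h ha)
    rw [form] at e2 e3
    rw [form, e, map_add, map_add, map_smul, vacuum_mul_upper, vacuum_mul_mid, vacuum_mul_mid, e2,
      e3]
    simp

/-- As for right multiplication, but the term from β(f, v) is now f(v)⟨b, g a⟩, which vanishes
because the radical is G-stable. -/
theorem ι_mul_mem_lowerRadical (hδ : IsGrading δ)
    (v : W) {a : TensorAlgebra k W} (ha : a ∈ lowerRadical hq) :
    TensorAlgebra.ι k v * a ∈ lowerRadical hq := by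
  intro b
  induction b using rightInduction_of_span hδ.span_dual generalizing a with
  | hadd b b' hb hb' => rw [form_add_left, hb ha, hb' ha, add_zero]
  | hsmul r b hb => rw [form_smul_left, hb ha, mul_zero]
  | h1 =>
    rw [form, map_one, one_mul, vacuum_lower]; simp
  | h f hf b ih =>
    obtain ⟨g, hf⟩ := hf
    obtain ⟨a', h⟩ := hf.exists_commute (ρ := ρ) a
    have e : upper ρ δ (b * TensorAlgebra.ι k f) * lower ρ δ (TensorAlgebra.ι k v * a) =
        upper ρ δ b * lower ρ δ (TensorAlgebra.ι k v * a) * upper ρ δ (TensorAlgebra.ι k f) +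
        upper ρ δ b * lower ρ δ (TensorAlgebra.ι k v * a') * mid ρ δ (MonoidAlgebra.of k G g) +
        f v • (upper ρ δ b * lower ρ δ (tensorMap (ρ g) a) *
          mid ρ δ (MonoidAlgebra.of k G g)) := by
      rw [map_mul, map_mul, mul_assoc, ← mul_assoc (upper ρ δ (TensorAlgebra.ι k f)), ι_mul_ι,
        add_mul, mul_assoc (lower ρ δ (TensorAlgebra.ι k v)), h, hf v, map_smul, smul_mul_assoc,
        mid_mul_lower, map_mul]
      simp only [mul_add, mul_smul_comm, mul_assoc]
    have e2 := tensorMap_mem_lowerRadical ha g b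
    have e3 := ih (mem_lowerRadical_of_commute h ha)
    rw [form] at e2 e3
    rw [form, e, map_add, map_add, map_smul, vacuum_mul_upper, vacuum_mul_mid, vacuum_mul_mid, e2,
      e3]
    simp

/-- The mirror argument: the first letter of a is moved to the left, so the induction runs over a
and homogeneous vectors. -/
theorem ι_mul_mem_upperRadical (hδ : IsGrading δ)
    (f : Module.Dual k W) {b : TensorAlgebra k (Module.Dual k W)}
    (hb : b ∈ upperRadical hq) : TensorAlgebra.ι k f * b ∈ upperRadical hq := by
  intro a
  induction a using leftInduction_of_span hδ.span_vec generalizing f b with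
  | hadd a a' ha ha' => rw [form_add_right, ha f hb, ha' f hb, add_zero]
  | hsmul r a ha => rw [form_smul_right, ha f hb, mul_zero]
  | h1 =>
    rw [form, map_one, mul_one, vacuum_upper]; simp
  | h x hx a ih =>
    obtain ⟨g, hx⟩ := hx
    obtain ⟨b', h⟩ := hx.exists_commute (ρ := ρ) b
    have e : upper ρ δ (TensorAlgebra.ι k f * b) * lower ρ δ (TensorAlgebra.ι k x * a) =
        lower ρ δ (TensorAlgebra.ι k x) *
          (upper ρ δ (TensorAlgebra.ι k f) * upper ρ δ b * lower ρ δ a) +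
        f x • (mid ρ δ (MonoidAlgebra.of k G g) * (upper ρ δ b * lower ρ δ a)) +
        mid ρ δ (MonoidAlgebra.of k G g) *
          (upper ρ δ (TensorAlgebra.ι k (f ∘ₗ ρ g) * b') * lower ρ δ a) := by
      rw [map_mul, map_mul, mul_assoc, ← mul_assoc (upper ρ δ b), h, add_mul, mul_add,
        mul_assoc (lower ρ δ (TensorAlgebra.ι k x)), ← mul_assoc, ι_mul_ι, hx.pairing_eq, map_smul,
        mul_assoc (mid ρ δ _) (upper ρ δ b'), ← mul_assoc (upper ρ δ _) (mid ρ δ _), ι_mul_mid,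
        map_mul]
      simp only [add_mul, smul_mul_assoc, mul_assoc]
    have e2 := hb a
    have e3 := ih (f ∘ₗ ρ g) (mem_upperRadical_of_commute h hb)
    rw [form] at e2 e3
    rw [form, e, map_add, map_add, map_smul, vacuum_lower_mul, vacuum_mid_mul, vacuum_mid_mul, e2,
      e3]
    simp

theorem mul_ι_mem_upperRadical (hδ : IsGrading δ)
    (f : Module.Dual k W) {b : TensorAlgebra k (Module.Dual k W)}
    (hb : b ∈ upperRadical hq) : b * TensorAlgebra.ι k f ∈ upperRadical hq := by
  intro a
  induction a using leftInduction_of_span hδ.span_vec generalizing b with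
  | hadd a a' ha ha' => rw [form_add_right, ha hb, ha' hb, add_zero]
  | hsmul r a ha => rw [form_smul_right, ha hb, mul_zero]
  | h1 =>
    rw [form, map_one, mul_one, vacuum_upper]; simp
  | h x hx a ih =>
    obtain ⟨g, hx⟩ := hx
    obtain ⟨b', h⟩ := hx.exists_commute (ρ := ρ) b
    have e : upper ρ δ (b * TensorAlgebra.ι k f) * lower ρ δ (TensorAlgebra.ι k x * a) =
        lower ρ δ (TensorAlgebra.ι k x) *
          (upper ρ δ b * upper ρ δ (TensorAlgebra.ι k f) * lower ρ δ a) +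
        mid ρ δ (MonoidAlgebra.of k G g) *
          (upper ρ δ (b' * TensorAlgebra.ι k f) * lower ρ δ a) +
        f x • (upper ρ δ b * lower ρ δ (tensorMap (ρ g) a) *
          mid ρ δ (MonoidAlgebra.of k G g)) := by
      rw [map_mul, map_mul, mul_assoc, ← mul_assoc (upper ρ δ (TensorAlgebra.ι k f)), ι_mul_ι,
        add_mul, mul_add, mul_assoc (lower ρ δ (TensorAlgebra.ι k x)), ← mul_assoc (upper ρ δ b), h,
        hx.pairing_eq, map_smul, smul_mul_assoc, mid_mul_lower, map_mul]
      simp only [add_mul, mul_smul_comm, mul_assoc]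
    have e2 := hb (tensorMap (ρ g) a)
    have e3 := ih (mem_upperRadical_of_commute h hb)
    rw [form] at e2 e3
    rw [form, e, map_add, map_add, map_smul, vacuum_lower_mul, vacuum_mid_mul, vacuum_mul_mid, e2,
      e3]
    simp

/-- Beyond the ideal properties, the point is that in f a = a f + a' g both a and a' lie in the
radical. -/
theorem isLowerIdeal_lowerRadical (hδ : IsGrading δ) : IsLowerIdeal ρ δ (lowerRadical hq) where
  ι_mul_mem v a ha := ι_mul_mem_lowerRadical hδ v ha
  mul_mem a ha x := by
    induction x using rightInduction with
    | hadd x y hx hy => rw [mul_add]; exact Submodule.add_mem _ hx hy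
    | hsmul r x hx => rw [mul_smul_comm]; exact Submodule.smul_mem _ _ hx
    | h1 => rwa [mul_one]
    | h v x hx => rw [← mul_assoc]; exact mul_ι_mem_lowerRadical hδ v hx
  act_mem g a ha := tensorMap_mem_lowerRadical ha g
  dual_mul_mem f a ha := by
    have hf : f ∈ Submodule.span k {f | ∃ g, IsHomogeneousDual δ g f} :=
      hδ.span_dual ▸ Submodule.mem_top
    induction hf using Submodule.span_induction with
    | mem f hf =>
      obtain ⟨g, hf⟩ := hf
      obtain ⟨a', h⟩ := hf.exists_commute (ρ := ρ) a
      rw [h]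
      refine Submodule.add_mem _ ?_ ?_
      · have : lower ρ δ a * upper ρ δ (TensorAlgebra.ι k f) =
          tri ρ δ a 1 (TensorAlgebra.ι k f) := by simp [tri]
        rw [this]; exact tri_mem_triSpan (Or.inl ha)
      · have : lower ρ δ a' * mid ρ δ (MonoidAlgebra.of k G g) =
          tri ρ δ a' (MonoidAlgebra.of k G g) 1 := by simp only [tri, map_one, mul_one]
        rw [this]; exact tri_mem_triSpan (Or.inl (mem_lowerRadical_of_commute h ha))
    | zero => simp
    | add f f' _ _ hf hf' => rw [map_add, map_add, add_mul]; exact Submodule.add_mem _ hf hf'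
    | smul r f _ hf => rw [map_smul, map_smul, smul_mul_assoc]; exact Submodule.smul_mem _ _ hf

theorem isUpperIdeal_upperRadical (hδ : IsGrading δ) : IsUpperIdeal ρ δ (upperRadical hq) where
  mul_ι_mem f b hb := mul_ι_mem_upperRadical hδ f hb
  mul_mem b hb x := by
    induction x using leftInduction with
    | hadd x y hx hy => rw [add_mul]; exact Submodule.add_mem _ hx hy
    | hsmul r x hx => rw [smul_mul_assoc]; exact Submodule.smul_mem _ _ hx
    | h1 => rwa [one_mul]
    | h f x hx => rw [mul_assoc]; exact ι_mul_mem_upperRadical hδ f hx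
  act_mem g b hb := dualAct_mem_upperRadical hb g
  mul_vec_mem v b hb := by
    have hv : v ∈ Submodule.span k {x | ∃ g, IsHomogeneousVec δ g x} :=
      hδ.span_vec ▸ Submodule.mem_top
    induction hv using Submodule.span_induction with
    | mem x hx =>
      obtain ⟨g, hx⟩ := hx
      obtain ⟨b', h⟩ := hx.exists_commute (ρ := ρ) b
      rw [h]
      refine Submodule.add_mem _ ?_ ?_
      · have : lower ρ δ (TensorAlgebra.ι k x) * upper ρ δ b =
          tri ρ δ (TensorAlgebra.ι k x) 1 b := by simp [tri]
        rw [this]; exact tri_mem_triSpan (Or.inr hb)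
      · have : mid ρ δ (MonoidAlgebra.of k G g) * upper ρ δ b' =
          tri ρ δ 1 (MonoidAlgebra.of k G g) b' := by simp only [tri, map_one, one_mul]
        rw [this]; exact tri_mem_triSpan (Or.inr (mem_upperRadical_of_commute h hb))
    | zero => simp
    | add f f' _ _ hf hf' => rw [map_add, map_add, mul_add]; exact Submodule.add_mem _ hf hf'
    | smul r f _ hf => rw [map_smul, map_smul, mul_smul_comm]; exact Submodule.smul_mem _ _ hf

/-- The maximal triangular ideal is given by the radicals of the form. -/
theorem isTriangularIdeal_maximal (hδ : IsGrading δ)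
    (hq : IsQuasiYetterDrinfeld ρ δ) :
    IsTriangularIdeal ρ δ (lowerRadical hq) (upperRadical hq) (maximalTriangularIdeal ρ δ) := by
  have h := isTriangularIdeal_triangularIdeal (isLowerIdeal_lowerRadical (hq := hq) hδ)
    (isUpperIdeal_upperRadical (hq := hq) hδ) (lowerRadical_le_positivePart hq)
    (upperRadical_le_positivePart hq)
  have he : maximalTriangularIdeal ρ δ = triangularIdeal (isLowerIdeal_lowerRadical (hq := hq) hδ)
      (isUpperIdeal_upperRadical (hq := hq) hδ) := by
    -- The ideal of the radicals is itself one of the summands and contains all the others.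
    refine le_antisymm (sSup_le ?_) (le_sSup ⟨_, _, h⟩)
    rintro J ⟨Im, Ip, hJ⟩
    rw [TwoSidedIdeal.le_iff, hJ.carrier_eq, h.carrier_eq]
    refine Submodule.span_mono ?_
    rintro _ ⟨a, y, b, hab, rfl⟩
    exact ⟨a, y, b, hab.imp (fun h => (hJ.le_radical hq).1 h) (fun h => (hJ.le_radical hq).2 h), rfl⟩
  rw [he]
  exact h

end Graded

/-! ### Braided integers, braided derivations and the kernel of the symmetriser -/

section BraidedInteger

variable {k : Type u} [Field k] {M : Type v} [AddCommGroup M] [Module k M]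

/-- `b ⊗ x ↦ ⟨f, x⟩ b`. -/
def contract {N : Type*} [AddCommGroup N] [Module k N] (f : Module.Dual k M) : N ⊗[k] M →ₗ[k] N :=
  (TensorProduct.rid k N).toLinearMap ∘ₗ f.lTensor N

@[simp]
theorem contract_tmul {N : Type*} [AddCommGroup N] [Module k N] (f : Module.Dual k M) (b : N)
    (x : M) : contract f (b ⊗ₜ[k] x) = f x • b := by
  simp [contract]

/-- The contractions with the coordinate functionals of a basis of M are the coordinates of z. -/
theorem eq_zero_of_contract_eq_zero {N : Type*} [AddCommGroup N] [Module k N] {z : N ⊗[k] M}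
    (h : ∀ f, contract f z = 0) : z = 0 := by
  classical
  let b := Module.Basis.ofVectorSpace k M
  let e := TensorProduct.equivFinsuppOfBasisRight (M := N) b
  have he : ∀ z i, e z i = contract (b.coord i) z := by
    intro z i
    induction z using TensorProduct.induction_on with
    | zero => simp
    | tmul x y => simp [e]
    | add x y hx hy => simp only [map_add, Finsupp.add_apply, hx, hy]
  apply e.injective
  ext i
  rw [he, h, map_zero, Finsupp.zero_apply]

/-- Multiplication of the first leg by `b` from the left. -/
def legMul (b : TensorAlgebra k M) : M ⊗[k] M →ₗ[k] TensorAlgebra k M ⊗[k] M :=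
  (LinearMap.mulLeft k b ∘ₗ TensorAlgebra.ι k).rTensor M

@[simp]
theorem legMul_tmul (b : TensorAlgebra k M) (x y : M) :
    legMul b (x ⊗ₜ[k] y) = (b * TensorAlgebra.ι k x) ⊗ₜ[k] y := by
  simp [legMul]

theorem lastLegs_tmul (Ψ : M ⊗[k] M →ₗ[k] M ⊗[k] M) (b : TensorAlgebra k M) (x y : M) :
    lastLegs Ψ (b ⊗ₜ[k] x ⊗ₜ[k] y) = legMul b (Ψ (x ⊗ₜ[k] y)) := by
  simp only [lastLegs, LinearMap.comp_apply, LinearEquiv.coe_coe, TensorProduct.assoc_tmul,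
    LinearMap.lTensor_tmul]
  generalize Ψ (x ⊗ₜ[k] y) = z
  induction z using TensorProduct.induction_on with
  | zero => simp
  | tmul x y => simp
  | add x y hx hy => simp only [TensorProduct.tmul_add, map_add, hx, hy]

variable (Ψ : M ⊗[k] M →ₗ[k] M ⊗[k] M)

@[simp]
theorem braidedInteger_one : braidedInteger Ψ 1 = 0 := by
  simp [braidedInteger]

theorem braidedInteger_mul_ι (a : TensorAlgebra k M) (y : M) :
    braidedInteger Ψ (a * TensorAlgebra.ι k y) =
      a ⊗ₜ[k] y + lastLegs Ψ (braidedInteger Ψ a ⊗ₜ[k] y) := by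
  -- The opposite algebra makes the rightmost letter act last, so appending y means applying
  -- `braidedStep Ψ y` to the state reached by a.
  let Λ := TensorAlgebra.lift k ((MulOpposite.opLinearEquiv k).toLinearMap ∘ₗ braidedStep Ψ)
  have hmul : ∀ (a : TensorAlgebra k M) (y : M), (Λ (a * TensorAlgebra.ι k y)).unop (1, 0) =
      braidedStep Ψ y ((Λ a).unop (1, 0)) := by
    intro a y
    simp [Λ]
  have hfst : ∀ a : TensorAlgebra k M, ((Λ a).unop (1, 0)).1 = a := by
    intro a
    induction a using rightInduction with
    | hadd a b ha hb => simp [ha, hb]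
    | hsmul r a ha => simp [ha]
    | h1 => simp
    | h m a ha => rw [hmul]; exact congrArg (· * TensorAlgebra.ι k m) ha
  change ((Λ (a * TensorAlgebra.ι k y)).unop (1, 0)).2 = _
  rw [hmul]
  change ((Λ a).unop (1, 0)).1 ⊗ₜ[k] y + lastLegs Ψ (((Λ a).unop (1, 0)).2 ⊗ₜ[k] y) = _
  rw [hfst]
  rfl

theorem lastLegs_zero : lastLegs (0 : M ⊗[k] M →ₗ[k] M ⊗[k] M) = 0 := by
  simp [lastLegs]

/-- For Ψ = 0 the braided integer only splits off the last letter, which is a left inverse of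
multiplication. -/
theorem mul_ι_injective : Function.Injective
    (LinearMap.mul' k (TensorAlgebra k M) ∘ₗ (TensorAlgebra.ι k).lTensor (TensorAlgebra k M)) := by
  have : braidedInteger 0 ∘ₗ (LinearMap.mul' k (TensorAlgebra k M) ∘ₗ
      (TensorAlgebra.ι k).lTensor (TensorAlgebra k M)) = LinearMap.id := by
    refine TensorProduct.ext' fun a y => ?_
    simp [braidedInteger_mul_ι, lastLegs_zero]
  exact Function.LeftInverse.injective (g := braidedInteger 0) (LinearMap.congr_fun this)

/-- The braided derivation `(id ⊗ f) ∘ [n]_Ψ`. -/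
def braidedDeriv (f : Module.Dual k M) : TensorAlgebra k M →ₗ[k] TensorAlgebra k M :=
  contract f ∘ₗ braidedInteger Ψ

/-- [n+1]! is ([n]! ⊗ id)[n+1] followed by the injective multiplication T(M) ⊗ M → T(M), and
vanishing in T(M) ⊗ M is detected by contracting the last leg. -/
theorem braidedFactorial_succ_eq_zero {n : ℕ} {a : TensorAlgebra k M} :
    braidedFactorial Ψ (n + 1) a = 0 ↔ ∀ f, braidedFactorial Ψ n (braidedDeriv Ψ f a) = 0 := by
  have h1 : braidedFactorial Ψ (n + 1) a = (LinearMap.mul' k (TensorAlgebra k M) ∘ₗ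
      (TensorAlgebra.ι k).lTensor (TensorAlgebra k M))
        ((braidedFactorial Ψ n).rTensor M (braidedInteger Ψ a)) := by
    rw [LinearMap.comp_apply, ← LinearMap.comp_apply (LinearMap.lTensor _ _),
      LinearMap.lTensor_comp_rTensor]
    rfl
  have h2 : ∀ f, braidedFactorial Ψ n (braidedDeriv Ψ f a) =
      contract f ((braidedFactorial Ψ n).rTensor M (braidedInteger Ψ a)) := by
    intro f
    rw [braidedDeriv, LinearMap.comp_apply]
    generalize braidedInteger Ψ a = z
    induction z using TensorProduct.induction_on with
    | zero => simp
    | tmul x y => simp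
    | add x y hx hy => simp only [map_add, hx, hy]
  rw [h1, LinearMap.map_eq_zero_iff _ mul_ι_injective]
  constructor
  · intro h f; rw [h2, h, map_zero]
  · intro h; exact eq_zero_of_contract_eq_zero fun f => by rw [← h2, h]

theorem braidedFactorial_zero_eq_zero {a : TensorAlgebra k M} :
    braidedFactorial Ψ 0 a = 0 ↔ TensorAlgebra.algebraMapInv (R := k) a = 0 := by
  change algebraMap k (TensorAlgebra k M) (TensorAlgebra.algebraMapInv a) = 0 ↔ _
  exact TensorAlgebra.algebraMap_eq_zero_iff M _

theorem algebraMapInv_of_mem_worKer {a : TensorAlgebra k M} (ha : a ∈ worKer Ψ) :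
    TensorAlgebra.algebraMapInv (R := k) a = 0 :=
  (braidedFactorial_zero_eq_zero Ψ).1 ((Submodule.mem_iInf _).1 ha 0)

theorem braidedDeriv_mem_worKer {a : TensorAlgebra k M} (ha : a ∈ worKer Ψ) (f : Module.Dual k M) :
    braidedDeriv Ψ f a ∈ worKer Ψ :=
  (Submodule.mem_iInf _).2 fun n =>
    (braidedFactorial_succ_eq_zero Ψ).1 ((Submodule.mem_iInf _).1 ha (n + 1)) f

/-- `worKer Ψ` is the largest subspace of `T^{>0}(M)` that is stable under braided derivations. -/
theorem le_worKer {S : Submodule k (TensorAlgebra k M)}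
    (h0 : ∀ a ∈ S, TensorAlgebra.algebraMapInv (R := k) a = 0)
    (h : ∀ a ∈ S, ∀ f, braidedDeriv Ψ f a ∈ S) : S ≤ worKer Ψ := by
  intro a ha
  refine (Submodule.mem_iInf _).2 fun n => ?_
  induction n generalizing a with
  | zero => exact (braidedFactorial_zero_eq_zero Ψ).2 (h0 a ha)
  | succ n ih => exact (braidedFactorial_succ_eq_zero Ψ).2 fun f => ih (h a ha f)

theorem mem_worKer_of_braidedInteger_eq_zero {a : TensorAlgebra k M}
    (h0 : TensorAlgebra.algebraMapInv (R := k) a = 0) (h : braidedInteger Ψ a = 0) :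
    a ∈ worKer Ψ := by
  refine (Submodule.mem_iInf _).2 fun n => ?_
  cases n with
  | zero => exact (braidedFactorial_zero_eq_zero Ψ).2 h0
  | succ n =>
    refine (braidedFactorial_succ_eq_zero Ψ).2 fun f => ?_
    rw [braidedDeriv, LinearMap.comp_apply, h, map_zero, map_zero]

end BraidedInteger

/-! ### The radicals are the kernels of the Woronowicz symmetrisers -/

section Radical

variable {k : Type u} [Field k] {G : Type v} [Group G] {W : Type w} [AddCommGroup W] [Module k W]
  {ρ : Representation k G W} {δ : Quasicoaction k G W}

theorem IsHomogeneousVec.braiding_tmul {g : G} {x : W} (hx : IsHomogeneousVec δ g x) (y : W) :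
    braiding ρ δ (x ⊗ₜ[k] y) = ρ g y ⊗ₜ[k] x := by
  have h : δ x = MonoidAlgebra.of k G g ⊗ₜ[k] x := hx
  simp only [braiding, LinearMap.comp_apply, LinearMap.rTensor_tmul, h, LinearEquiv.coe_coe,
    TensorProduct.assoc_tmul, LinearMap.lTensor_tmul, TensorProduct.comm_tmul,
    TensorProduct.assoc_symm_tmul, TensorProduct.lift.tmul, AlgHom.toLinearMap_apply,
    Representation.asAlgebraHom_of]

/-- Homogeneous elements of different degrees are orthogonal. -/
theorem IsHomogeneousDual.apply_eq_zero_or {g h : G} {f : Module.Dual k W} {x : W}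
    (hf : IsHomogeneousDual δ g f) (hx : IsHomogeneousVec δ h x) : f x = 0 ∨ g = h := by
  by_cases hfx : f x = 0
  · exact Or.inl hfx
  · right
    -- Two evaluations of β(f, x): f(x) g from the degree of f, and f(x) h from the degree of x.
    have := (hf x).symm.trans (hx.pairing_eq f)
    exact MonoidAlgebra.of_injective (smul_right_injective _ hfx this)

/-- Induction on `N ⊗ W` for linear predicates, along homogeneous elements of `W`. -/
theorem tensor_induction_of_span {N : Type*} [AddCommGroup N] [Module k N] {s : Set W}
    (hs : Submodule.span k s = ⊤) {P : N ⊗[k] W → Prop} (h0 : P 0)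
    (hadd : ∀ x y, P x → P y → P (x + y)) (h : ∀ a, ∀ x ∈ s, P (a ⊗ₜ[k] x)) (z : N ⊗[k] W) :
    P z := by
  induction z using TensorProduct.induction_on with
  | zero => exact h0
  | add x y hx hy => exact hadd _ _ hx hy
  | tmul a x =>
    have hx : x ∈ Submodule.span k s := hs ▸ Submodule.mem_top
    induction hx using Submodule.span_induction generalizing a with
    | mem x hx => exact h a x hx
    | zero => simpa using h0
    | add x y _ _ hx hy => rw [TensorProduct.tmul_add]; exact hadd _ _ (hx a) (hy a)
    | smul r x _ hx => rw [← TensorProduct.smul_tmul]; exact hx _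

/-- `a ⊗ x ↦ a · β(f, x)`. -/
def mulPairing (ρ : Representation k G W) (δ : Quasicoaction k G W) (f : Module.Dual k W) :
    TensorAlgebra k W ⊗[k] W →ₗ[k] FreeDouble ρ δ :=
  LinearMap.mul' k _ ∘ₗ TensorProduct.map (lower ρ δ).toLinearMap (mid ρ δ ∘ₗ pairingₗ δ f)

theorem mulPairing_tmul (f : Module.Dual k W) (a : TensorAlgebra k W) (x : W) :
    mulPairing ρ δ f (a ⊗ₜ[k] x) = lower ρ δ a * mid ρ δ (pairing δ f x) := rfl

/-- For x of degree g, moving g past y turns y into g(y), and this is what Ψ(x ⊗ y) = g(y) ⊗ x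
encodes. The braiding enters the commutation relations here. -/
theorem mulPairing_lastLegs (hδ : IsGrading δ)
    (f : Module.Dual k W) (z : TensorAlgebra k W ⊗[k] W) (y : W) :
    mulPairing ρ δ f (lastLegs (braiding ρ δ) (z ⊗ₜ[k] y)) =
      mulPairing ρ δ f z * lower ρ δ (TensorAlgebra.ι k y) := by
  induction z using tensor_induction_of_span (N := TensorAlgebra k W) hδ.span_vec with
  | h0 => simp
  | hadd z z' hz hz' => simp only [TensorProduct.add_tmul, map_add, hz, hz', add_mul]
  | h a x hx =>
    obtain ⟨g, hx⟩ := hx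
    rw [lastLegs_tmul, hx.braiding_tmul, legMul_tmul, mulPairing_tmul, mulPairing_tmul,
      hx.pairing_eq, map_smul, map_mul, mul_assoc, mul_smul_comm, ← mid_mul_ι, mul_assoc,
      smul_mul_assoc]

/-- The commutator of `f ∈ W*` with `T(W)` is given by the braided integers. -/
theorem upper_mul_lower (hδ : IsGrading δ)
    (f : Module.Dual k W) (a : TensorAlgebra k W) :
    upper ρ δ (TensorAlgebra.ι k f) * lower ρ δ a =
      lower ρ δ a * upper ρ δ (TensorAlgebra.ι k f) +
        mulPairing ρ δ f (braidedInteger (braiding ρ δ) a) := by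
  induction a using rightInduction with
  | hadd a b ha hb => simp only [map_add, mul_add, add_mul, ha, hb]; abel
  | hsmul r a ha => simp only [map_smul, mul_smul_comm, smul_mul_assoc, ha, smul_add]
  | h1 => simp
  | h y a ha =>
    rw [map_mul, ← mul_assoc, ha, add_mul, mul_assoc, ι_mul_ι, braidedInteger_mul_ι, map_add,
      mulPairing_lastLegs hδ, mulPairing_tmul, mul_add]
    simp only [mul_assoc, add_assoc]

/-- Right multiplication by f is adjoint to the braided derivation: in the commutator formula the
term ending in f vanishes, and dropping the group element turns β(f, x) into f(x). -/
theorem form_mul_ι (hδ : IsGrading δ) (hq : IsQuasiYetterDrinfeld ρ δ)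
    (b : TensorAlgebra k (Module.Dual k W)) (f : Module.Dual k W)
    (a : TensorAlgebra k W) : form hq (b * TensorAlgebra.ι k f) a =
      form hq b (braidedDeriv (braiding ρ δ) f a) := by
  have h : ∀ z, vacuum hq (upper ρ δ b * mulPairing ρ δ f z) = form hq b (contract f z) := by
    intro z
    induction z using tensor_induction_of_span (N := TensorAlgebra k W) hδ.span_vec with
    | h0 => simp [form]
    | hadd z z' hz hz' => simp only [map_add, mul_add, hz, hz', form_add_right]
    | h a x hx =>
      obtain ⟨g, hx⟩ := hx
      rw [mulPairing_tmul, hx.pairing_eq, map_smul, mul_smul_comm, mul_smul_comm, map_smul,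
        ← mul_assoc, vacuum_mul_mid, contract_tmul, form_smul_right, form, smul_eq_mul]
  rw [form, map_mul (upper ρ δ), mul_assoc, upper_mul_lower hδ, mul_add, map_add, ← mul_assoc,
    vacuum_mul_upper, zero_add, h]
  rfl

/-- By adjointness the radical is stable under braided derivations, so maximality of `worKer` gives
one inclusion. For the other, the letters of b are turned into derivations of a until only the
augmentation is left. -/
theorem lowerRadical_eq_worKer (hδ : IsGrading δ) (hq : IsQuasiYetterDrinfeld ρ δ) :
    lowerRadical hq = worKer (braiding ρ δ) := by
  apply le_antisymm
  · refine le_worKer _ (fun a ha => lowerRadical_le_positivePart hq ha) fun a ha f b => ?_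
    rw [← form_mul_ι hδ, ha]
  · intro a ha b
    induction b using rightInduction generalizing a with
    | hadd b b' hb hb' => rw [form_add_left, hb ha, hb' ha, add_zero]
    | hsmul r b hb => rw [form_smul_left, hb ha, mul_zero]
    | h1 => rw [form, map_one, one_mul, vacuum_lower, algebraMapInv_of_mem_worKer _ ha]
    | h f b hb => rw [form_mul_ι hδ]; exact hb (braidedDeriv_mem_worKer _ ha f)

theorem braidedDeriv_mul_ι (hδ : IsGrading δ)
    {g : G} {f : Module.Dual k W} (hf : IsHomogeneousDual δ g f)
    (a : TensorAlgebra k W) (y : W) : braidedDeriv (braiding ρ δ) f (a * TensorAlgebra.ι k y) =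
      f y • a + braidedDeriv (braiding ρ δ) f a * TensorAlgebra.ι k (ρ g y) := by
  rw [braidedDeriv, LinearMap.comp_apply, LinearMap.comp_apply, braidedInteger_mul_ι, map_add,
    contract_tmul]
  congr 1
  generalize braidedInteger (braiding ρ δ) a = z
  induction z using tensor_induction_of_span (N := TensorAlgebra k W) hδ.span_vec with
  | h0 => simp
  | hadd z z' hz hz' => simp only [TensorProduct.add_tmul, map_add, hz, hz', add_mul]
  | h a x hx =>
    obtain ⟨h, hx⟩ := hx
    rw [lastLegs_tmul, hx.braiding_tmul, legMul_tmul, contract_tmul, contract_tmul,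
      smul_mul_assoc]
    -- The braiding acts by the degree of x, but f only sees vectors of its own degree.
    rcases hf.apply_eq_zero_or hx with h0 | rfl
    · rw [h0, zero_smul, zero_smul]
    · rfl

variable [FiniteDimensional k W]

/-- On x ⊗ y with x of degree h, the functional φ ⊗ f composed with Ψ gives φ(h y) f(x), which
vanishes unless h = g. -/
theorem IsHomogeneousDual.dualBraiding_tmul (hδ : IsGrading δ)
    {g : G} {f : Module.Dual k W}
    (hf : IsHomogeneousDual δ g f) (φ : Module.Dual k W) :
    dualBraiding (braiding ρ δ) (φ ⊗ₜ[k] f) = f ⊗ₜ[k] (φ ∘ₗ ρ g) := by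
  rw [dualBraiding, LinearMap.comp_apply, LinearEquiv.coe_coe, LinearEquiv.symm_apply_eq]
  refine LinearMap.ext fun z => ?_
  change TensorProduct.dualDistrib k W W (φ ⊗ₜ[k] f) (braiding ρ δ z) =
    TensorProduct.dualDistrib k W W (f ⊗ₜ[k] (φ ∘ₗ ρ g)) z
  -- Exchange the legs, since the induction principle makes only the second leg homogeneous.
  rw [← (TensorProduct.comm k W W).symm_apply_apply z]
  generalize TensorProduct.comm k W W z = z
  induction z using tensor_induction_of_span (N := W) hδ.span_vec with
  | h0 => simp
  | hadd z z' hz hz' => simp only [map_add, hz, hz']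
  | h y x hx =>
    obtain ⟨h, hx⟩ := hx
    rw [TensorProduct.comm_symm_tmul, hx.braiding_tmul, TensorProduct.dualDistrib_apply,
      TensorProduct.dualDistrib_apply, LinearMap.comp_apply, mul_comm]
    rcases hf.apply_eq_zero_or hx with h0 | rfl
    · rw [h0, zero_mul, zero_mul]
    · rfl

theorem braidedDeriv_dual_mul_ι (hδ : IsGrading δ)
    {g : G} {f : Module.Dual k W} (hf : IsHomogeneousDual δ g f)
    (b : TensorAlgebra k (Module.Dual k W)) (y : W) :
    braidedDeriv (dualBraiding (braiding ρ δ)) (Module.Dual.eval k W y)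
        (b * TensorAlgebra.ι k f) =
      f y • b + braidedDeriv (dualBraiding (braiding ρ δ)) (Module.Dual.eval k W (ρ g y)) b *
        TensorAlgebra.ι k f := by
  rw [braidedDeriv, braidedDeriv, LinearMap.comp_apply, LinearMap.comp_apply, braidedInteger_mul_ι,
    map_add, contract_tmul, Module.Dual.eval_apply]
  congr 1
  generalize braidedInteger (dualBraiding (braiding ρ δ)) b = z
  induction z using TensorProduct.induction_on with
  | zero => simp
  | add z z' hz hz' => simp only [TensorProduct.add_tmul, map_add, hz, hz', add_mul]
  | tmul b φ =>
    rw [lastLegs_tmul, hf.dualBraiding_tmul hδ, legMul_tmul, contract_tmul, contract_tmul,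
      smul_mul_assoc]
    rfl

/-- The adjoint of right multiplication by y, by induction on b. The twisted Leibniz rules for Ψ and
Ψ* give the same recursion: ⟨b f, a y⟩ = f(y)⟨b, a⟩ + ⟨b, ∂_f(a) g(y)⟩, and by induction the last
term is ⟨∂_{g(y)}(b) f, a⟩. -/
theorem form_ι_mul (hδ : IsGrading δ) (hq : IsQuasiYetterDrinfeld ρ δ)
    (b : TensorAlgebra k (Module.Dual k W)) (a : TensorAlgebra k W) (y : W) :
    form hq b (a * TensorAlgebra.ι k y) =
      form hq (braidedDeriv (dualBraiding (braiding ρ δ)) (Module.Dual.eval k W y) b) a := by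
  induction b using rightInduction_of_span hδ.span_dual generalizing a y with
  | hadd b b' hb hb' => rw [form_add_left, hb, hb', map_add, form_add_left]
  | hsmul r b hb => rw [form_smul_left, hb, map_smul, form_smul_left]
  | h1 =>
    rw [form, map_one, one_mul, vacuum_lower, braidedDeriv, LinearMap.comp_apply,
      braidedInteger_one]
    simp [form]
  | h f hf b ih =>
    obtain ⟨g, hf⟩ := hf
    rw [form_mul_ι hδ, braidedDeriv_mul_ι hδ hf, form_add_right, form_smul_right, ih,
      braidedDeriv_dual_mul_ι hδ hf, form_add_left, form_smul_left, form_mul_ι hδ]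

theorem upperRadical_eq_worKer (hδ : IsGrading δ) (hq : IsQuasiYetterDrinfeld ρ δ) :
    upperRadical hq = worKer (dualBraiding (braiding ρ δ)) := by
  apply le_antisymm
  · refine le_worKer _ (fun b hb => upperRadical_le_positivePart hq hb) fun b hb F a => ?_
    -- In finite dimension every functional on W* is evaluation at a vector.
    obtain ⟨y, rfl⟩ := (Module.evalEquiv k W).surjective F
    change form hq (braidedDeriv _ (Module.Dual.eval k W y) b) a = 0
    rw [← form_ι_mul hδ, hb]
  · intro b hb a
    induction a using rightInduction generalizing b with
    | hadd a a' ha ha' => rw [form_add_right, ha hb, ha' hb, add_zero]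
    | hsmul r a ha => rw [form_smul_right, ha hb, mul_zero]
    | h1 => rw [form, map_one, mul_one, vacuum_upper, algebraMapInv_of_mem_worKer _ hb]
    | h y a ha => rw [form_ι_mul hδ]; exact ha (braidedDeriv_mem_worKer _ hb _)

end Radical

/-! ### The symmetric algebra as a quotient of the tensor algebra -/

section Sym

variable {k : Type u} [Field k] {M : Type v} [AddCommGroup M] [Module k M]

theorem commutator_mem_symKer (x y : M) : TensorAlgebra.ι k x * TensorAlgebra.ι k y -
    TensorAlgebra.ι k y * TensorAlgebra.ι k x ∈ symKer k M := by
  rw [symKer, LinearMap.mem_ker, AlgHom.toLinearMap_apply, map_sub, map_mul, map_mul, mul_comm,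
    sub_self]

theorem ι_mul_mem_symKer (x : M) {a : TensorAlgebra k M} (ha : a ∈ symKer k M) :
    TensorAlgebra.ι k x * a ∈ symKer k M := by
  rw [symKer, LinearMap.mem_ker, AlgHom.toLinearMap_apply] at ha ⊢
  rw [map_mul, ha, mul_zero]

theorem mul_mem_symKer {a : TensorAlgebra k M} (ha : a ∈ symKer k M) (x : TensorAlgebra k M) :
    a * x ∈ symKer k M := by
  rw [symKer, LinearMap.mem_ker, AlgHom.toLinearMap_apply] at ha ⊢
  rw [map_mul, ha, zero_mul]

theorem mul_mem_symKer' {a : TensorAlgebra k M} (ha : a ∈ symKer k M) (x : TensorAlgebra k M) :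
    x * a ∈ symKer k M := by
  rw [symKer, LinearMap.mem_ker, AlgHom.toLinearMap_apply] at ha ⊢
  rw [map_mul, ha, mul_zero]

/-- `symKer k M` is the smallest two-sided ideal of `T(M)` that contains all commutators of elements
of `M`. -/
theorem symKer_le {S : Submodule k (TensorAlgebra k M)}
    (hc : ∀ x y, TensorAlgebra.ι k x * TensorAlgebra.ι k y -
      TensorAlgebra.ι k y * TensorAlgebra.ι k x ∈ S)
    (hl : ∀ x, ∀ a ∈ S, TensorAlgebra.ι k x * a ∈ S)
    (hr : ∀ x, ∀ a ∈ S, a * TensorAlgebra.ι k x ∈ S) : symKer k M ≤ S := by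
  have hl' : ∀ y, ∀ a ∈ S, y * a ∈ S := by
    intro y
    induction y using TensorAlgebra.induction with
    | algebraMap r => intro a ha; rw [← Algebra.smul_def]; exact S.smul_mem _ ha
    | ι x => exact hl x
    | mul x y hx hy => intro a ha; rw [mul_assoc]; exact hx _ (hy _ ha)
    | add x y hx hy => intro a ha; rw [add_mul]; exact S.add_mem (hx _ ha) (hy _ ha)
  have hr' : ∀ y, ∀ a ∈ S, a * y ∈ S := by
    intro y
    induction y using TensorAlgebra.induction with
    | algebraMap r =>
      intro a ha; rw [← Algebra.commutes, ← Algebra.smul_def]; exact S.smul_mem _ ha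
    | ι x => exact hr x
    | mul x y hx hy => intro a ha; rw [← mul_assoc]; exact hy _ (hx _ ha)
    | add x y hx hy => intro a ha; rw [mul_add]; exact S.add_mem (hx _ ha) (hy _ ha)
  -- The quotient by `S` is commutative, since its generators commute; so T(M) → T(M)/S factors
  -- through the symmetric algebra by its universal property.
  let I : TwoSidedIdeal (TensorAlgebra k M) := TwoSidedIdeal.mk' (S : Set (TensorAlgebra k M))
    S.zero_mem S.add_mem S.neg_mem (fun {x y} hy => hl' x y hy) (fun {x y} hx => hr' y x hx)
  have hI : ∀ a, a ∈ I ↔ a ∈ S := fun a => TwoSidedIdeal.mem_mk' _ _ _ _ _ _ _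
  let π : TensorAlgebra k M →ₐ[k] I.ringCon.Quotient := I.ringCon.mkₐ k
  have hπ : ∀ a, π a = 0 ↔ a ∈ S := fun a => by
    rw [← hI, TwoSidedIdeal.mem_iff]; exact Quotient.eq
  have hcomm : ∀ x y : I.ringCon.Quotient, x * y = y * x := by
    intro x y
    obtain ⟨x, rfl⟩ : ∃ a, π a = x := Quotient.mk_surjective x
    obtain ⟨y, rfl⟩ : ∃ a, π a = y := Quotient.mk_surjective y
    change Commute (π x) (π y)
    induction x using TensorAlgebra.induction with
    | algebraMap r => rw [AlgHom.commutes]; exact Algebra.commute_algebraMap_left _ _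
    | ι x =>
      induction y using TensorAlgebra.induction with
      | algebraMap r => rw [AlgHom.commutes]; exact Algebra.commute_algebraMap_right _ _
      | ι y =>
        rw [commute_iff_eq, ← sub_eq_zero, ← map_mul π, ← map_mul π, ← map_sub π, hπ]
        exact hc x y
      | mul y y' hy hy' => rw [map_mul]; exact hy.mul_right hy'
      | add y y' hy hy' => rw [map_add]; exact hy.add_right hy'
    | mul y y' hy hy' => rw [map_mul]; exact hy.mul_left hy'
    | add y y' hy hy' => rw [map_add]; exact hy.add_left hy'
  let _ : CommSemiring I.ringCon.Quotient :=
    { (inferInstance : Semiring I.ringCon.Quotient) with mul_comm := hcomm }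
  let L : SymmetricAlgebra k M →ₐ[k] I.ringCon.Quotient :=
    SymmetricAlgebra.lift (π.toLinearMap ∘ₗ TensorAlgebra.ι k)
  have hL : ∀ a, L (SymmetricAlgebra.algHom k M a) = π a := by
    have : L.comp (SymmetricAlgebra.algHom k M) = π := by
      ext x
      exact SymmetricAlgebra.lift_ι_apply _ x
    exact fun a => DFunLike.congr_fun this a
  intro a ha
  rw [← hπ, ← hL]
  rw [symKer, LinearMap.mem_ker, AlgHom.toLinearMap_apply] at ha
  rw [ha, map_zero]

theorem symKer_le_positivePart : symKer k M ≤ positivePart k M := by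
  refine symKer_le ?_ ?_ ?_
  · intro x y; simp [positivePart]
  · intro x a ha; simp [positivePart]
  · intro x a ha; simp [positivePart]

theorem tensorMap_mem_symKer {N : Type*} [AddCommGroup N] [Module k N] (φ : M →ₗ[k] N)
    {a : TensorAlgebra k M} (ha : a ∈ symKer k M) : tensorMap φ a ∈ symKer k N := by
  have : symKer k M ≤ (symKer k N).comap (tensorMap φ).toLinearMap := by
    refine symKer_le ?_ ?_ ?_
    · intro x y; simpa using commutator_mem_symKer (φ x) (φ y)
    · intro x a ha; simpa using ι_mul_mem_symKer (φ x) ha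
    · intro x a ha
      simpa using mul_mem_symKer (Submodule.mem_comap.1 ha) (TensorAlgebra.ι k (φ x))
  exact this ha

variable {G : Type w} [Group G] {ρ : Representation k G M} {δ : Quasicoaction k G M}

theorem isLowerIdeal_symKer (h : ∀ f x y, Commute (upper ρ δ (TensorAlgebra.ι k f))
    (lower ρ δ (TensorAlgebra.ι k x * TensorAlgebra.ι k y -
      TensorAlgebra.ι k y * TensorAlgebra.ι k x))) : IsLowerIdeal ρ δ (symKer k M) where
  ι_mul_mem v a ha := ι_mul_mem_symKer v ha
  mul_mem a ha x := mul_mem_symKer ha x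
  act_mem g a ha := tensorMap_mem_symKer _ ha
  dual_mul_mem f a ha := by
    -- Membership in `symKer` is part of `S` because f x a also produces β(f, x) a, which is
    -- controlled only by the G-stability of `symKer`.
    let S : Submodule k (TensorAlgebra k M) := symKer k M ⊓
      ⨅ f, (triSpan ρ δ (symKer k M) ⊥).comap
        (LinearMap.mulLeft k (upper ρ δ (TensorAlgebra.ι k f)) ∘ₗ (lower ρ δ).toLinearMap)
    have hS : ∀ a, a ∈ S ↔ a ∈ symKer k M ∧ ∀ f, upper ρ δ (TensorAlgebra.ι k f) * lower ρ δ a ∈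
        triSpan ρ δ (symKer k M) ⊥ := by
      intro a; simp [S]
    suffices H : symKer k M ≤ S from ((hS a).1 (H ha)).2 f
    refine symKer_le ?_ ?_ ?_
    · intro x y
      refine (hS _).2 ⟨commutator_mem_symKer x y, fun f => ?_⟩
      rw [(h f x y).eq]
      exact IsLowerIdeal.lower_mul_mem (fun a ha x => mul_mem_symKer ha x)
        (commutator_mem_symKer x y) _
    · intro x a ha
      rw [hS] at ha ⊢
      refine ⟨ι_mul_mem_symKer x ha.1, fun f => ?_⟩
      rw [map_mul, ← mul_assoc, ι_mul_ι, add_mul, mul_assoc]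
      refine Submodule.add_mem _ ?_ (mid_mul_mem (fun g => ?_) _)
      · refine triSpan_lower_induction (p := LinearMap.mulLeft k _) (fun a ha z b => ?_) (ha.2 f)
        rw [LinearMap.mulLeft_apply, lower_mul_tri]
        exact tri_mem_triSpan (Or.inl (ι_mul_mem_symKer _ ha))
      · rw [mid_mul_lower]
        exact IsLowerIdeal.lower_mul_mem (fun a ha x => mul_mem_symKer ha x)
          (tensorMap_mem_symKer _ ha.1) _
    · intro x a ha
      rw [hS] at ha ⊢
      refine ⟨mul_mem_symKer ha.1 _, fun f => ?_⟩
      rw [map_mul, ← mul_assoc]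
      exact IsLowerIdeal.mul_mem_right (fun a ha x => mul_mem_symKer ha x) (ha.2 f) _

theorem isUpperIdeal_symKer (h : ∀ x f f', Commute
    (upper ρ δ (TensorAlgebra.ι k f * TensorAlgebra.ι k f' -
      TensorAlgebra.ι k f' * TensorAlgebra.ι k f)) (lower ρ δ (TensorAlgebra.ι k x))) :
    IsUpperIdeal ρ δ (symKer k (Module.Dual k M)) where
  mul_ι_mem f b hb := mul_mem_symKer hb _
  mul_mem b hb x := mul_mem_symKer' hb x
  act_mem g b hb := tensorMap_mem_symKer _ hb
  mul_vec_mem v b hb := by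
    have hI : ∀ b ∈ symKer k (Module.Dual k M), ∀ x, x * b ∈ symKer k (Module.Dual k M) :=
      fun b hb x => mul_mem_symKer' hb x
    let S : Submodule k (TensorAlgebra k (Module.Dual k M)) := symKer k (Module.Dual k M) ⊓
      ⨅ v, (triSpan ρ δ ⊥ (symKer k (Module.Dual k M))).comap
        (LinearMap.mulRight k (lower ρ δ (TensorAlgebra.ι k v)) ∘ₗ (upper ρ δ).toLinearMap)
    have hS : ∀ b, b ∈ S ↔ b ∈ symKer k (Module.Dual k M) ∧ ∀ v,
        upper ρ δ b * lower ρ δ (TensorAlgebra.ι k v) ∈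
          triSpan ρ δ ⊥ (symKer k (Module.Dual k M)) := by
      intro b; simp [S]
    suffices H : symKer k (Module.Dual k M) ≤ S from ((hS b).1 (H hb)).2 v
    refine symKer_le ?_ ?_ ?_
    · intro f f'
      refine (hS _).2 ⟨commutator_mem_symKer f f', fun v => ?_⟩
      rw [(h v f f').eq]
      exact IsUpperIdeal.mul_upper_mem hI
        (commutator_mem_symKer f f') _
    · intro f b hb
      rw [hS] at hb ⊢
      refine ⟨mul_mem_symKer' hb.1 _, fun v => ?_⟩
      rw [map_mul, mul_assoc]
      exact IsUpperIdeal.mul_mem_left hI (hb.2 v) _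
    · intro f b hb
      rw [hS] at hb ⊢
      refine ⟨mul_mem_symKer hb.1 _, fun v => ?_⟩
      rw [map_mul, mul_assoc, ι_mul_ι, mul_add, ← mul_assoc]
      refine Submodule.add_mem _ ?_ (mul_mid_mem (fun g => ?_) _)
      · refine triSpan_upper_induction (p := LinearMap.mulRight k _) (fun a z b hb => ?_) (hb.2 v)
        rw [LinearMap.mulRight_apply, tri_mul_upper]
        exact tri_mem_triSpan (Or.inr (mul_mem_symKer hb _))
      · rw [upper_mul_mid]
        exact IsUpperIdeal.mul_upper_mem hI
          (tensorMap_mem_symKer _ hb.1) _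

/-- If the commutators `[v, v']` commute with `W*` and the commutators `[f, f']` commute with `W`,
then they generate a triangular ideal. -/
theorem isTriangularIdeal_span_commutators
    (hm : ∀ f x y, Commute (upper ρ δ (TensorAlgebra.ι k f))
      (lower ρ δ (TensorAlgebra.ι k x * TensorAlgebra.ι k y -
        TensorAlgebra.ι k y * TensorAlgebra.ι k x)))
    (hp : ∀ x f f', Commute (upper ρ δ (TensorAlgebra.ι k f * TensorAlgebra.ι k f' -
      TensorAlgebra.ι k f' * TensorAlgebra.ι k f)) (lower ρ δ (TensorAlgebra.ι k x))) :
    IsTriangularIdeal ρ δ (symKer k M) (symKer k (Module.Dual k M)) (TwoSidedIdeal.span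
    ({x | ∃ v v' : M, x = lower ρ δ (TensorAlgebra.ι k v * TensorAlgebra.ι k v' -
        TensorAlgebra.ι k v' * TensorAlgebra.ι k v)} ∪
      {x | ∃ f f' : Module.Dual k M, x = upper ρ δ (TensorAlgebra.ι k f * TensorAlgebra.ι k f' -
        TensorAlgebra.ι k f' * TensorAlgebra.ι k f)})) := by
  have h := isTriangularIdeal_triangularIdeal (isLowerIdeal_symKer hm) (isUpperIdeal_symKer hp)
    symKer_le_positivePart symKer_le_positivePart
  set J : TwoSidedIdeal (FreeDouble ρ δ) := TwoSidedIdeal.span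
    ({x | ∃ v v' : M, x = lower ρ δ (TensorAlgebra.ι k v * TensorAlgebra.ι k v' -
        TensorAlgebra.ι k v' * TensorAlgebra.ι k v)} ∪
      {x | ∃ f f' : Module.Dual k M, x = upper ρ δ (TensorAlgebra.ι k f * TensorAlgebra.ι k f' -
        TensorAlgebra.ι k f' * TensorAlgebra.ι k f)}) with hJ
  suffices he : J = triangularIdeal (isLowerIdeal_symKer hm) (isUpperIdeal_symKer hp) by
    rw [he]; exact h
  have hmem : ∀ x, x ∈ triangularIdeal (isLowerIdeal_symKer hm) (isUpperIdeal_symKer hp) ↔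
      x ∈ triSpan ρ δ (symKer k M) (symKer k (Module.Dual k M)) := fun x => by
    rw [← SetLike.mem_coe, h.carrier_eq]; rfl
  let J' : Submodule k (FreeDouble ρ δ) :=
    { carrier := {x | x ∈ J}, add_mem' := fun hx hy => J.add_mem hx hy, zero_mem' := J.zero_mem
      smul_mem' := fun r x hx => by
        rw [Algebra.smul_def]; exact J.mul_mem_left _ _ hx }
  apply le_antisymm
  · rw [hJ, TwoSidedIdeal.span_le]
    rintro _ (⟨v, v', rfl⟩ | ⟨f, f', rfl⟩)
    · rw [SetLike.mem_coe, hmem, triSpan_eq_sup]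
      exact Submodule.mem_sup_left (lower_mem_triSpan (commutator_mem_symKer v v'))
    · rw [SetLike.mem_coe, hmem, triSpan_eq_sup]
      exact Submodule.mem_sup_right (upper_mem_triSpan (commutator_mem_symKer f f'))
  · have hlow : symKer k M ≤ J'.comap (lower ρ δ).toLinearMap := by
      refine symKer_le ?_ ?_ ?_
      · exact fun x y => TwoSidedIdeal.subset_span (Or.inl ⟨x, y, rfl⟩)
      · intro x a ha
        change lower ρ δ _ ∈ J
        rw [map_mul]; exact J.mul_mem_left _ _ ha
      · intro x a ha
        change lower ρ δ _ ∈ J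
        rw [map_mul]; exact J.mul_mem_right _ _ ha
    have hupp : symKer k (Module.Dual k M) ≤ J'.comap (upper ρ δ).toLinearMap := by
      refine symKer_le ?_ ?_ ?_
      · exact fun x y => TwoSidedIdeal.subset_span (Or.inr ⟨x, y, rfl⟩)
      · intro x a ha
        change upper ρ δ _ ∈ J
        rw [map_mul]; exact J.mul_mem_left _ _ ha
      · intro x a ha
        change upper ρ δ _ ∈ J
        rw [map_mul]; exact J.mul_mem_right _ _ ha
    intro x hx
    rw [hmem] at hx
    suffices H : triSpan ρ δ (symKer k M) (symKer k (Module.Dual k M)) ≤ J' from H hx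
    rw [triSpan, Submodule.span_le]
    rintro _ ⟨a, y, b, hab | hab, rfl⟩
    · exact J.mul_mem_right _ _ (J.mul_mem_right _ _ (hlow hab))
    · exact J.mul_mem_left _ _ (hupp hab)

end Sym

/-! ### The Yetter–Drinfeld module `Y_S(G)` and its grading -/

section Y

variable {k : Type u} [Field k] {V : Type v} [AddCommGroup V] [Module k V]
variable {G : Subgroup (LinearMap.GeneralLinearGroup k V)}

theorem YSpace.induction {P : YSpace G → Prop} (hadd : ∀ x y, P x → P y → P (x + y))
    (hV : ∀ v : V, P (v, 0)) (hs : ∀ s r, P (0, Finsupp.single s r)) (y : YSpace G) : P y := by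
  obtain ⟨v, φ⟩ := y
  have : ((v, φ) : YSpace G) = (v, 0) + (0, φ) := by simp
  rw [this]
  refine hadd _ _ (hV v) ?_
  induction φ using Finsupp.induction_linear with
  | zero => exact hV 0
  | add φ ψ hφ hψ =>
    have : ((0, φ + ψ) : YSpace G) = (0, φ) + (0, ψ) := by simp
    rw [this]
    exact hadd _ _ (hφ (by simp)) (hψ (by simp))
  | single s r => exact hs s r

variable (R : RootData G)

@[simp]
theorem RootData.yRep_vec (g : G) (v : V) : R.yRep g (v, 0) = (tautRep G g v, 0) := by
  change ((tautRep G g).prodMap _) (v, 0) = _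
  simp

@[simp]
theorem RootData.yRep_single (g : G) (s : Refl G) (r : k) :
    R.yRep g (0, Finsupp.single s r) = (0, Finsupp.single (s.conj g) (R.cocycle g s * r)) := by
  change ((tautRep G g).prodMap _) (0, Finsupp.single s r) = _
  simp

theorem isHomogeneousVec_vec (v : V) : IsHomogeneousVec (yCoaction G) 1 (v, 0) := by
  simp [IsHomogeneousVec, yCoaction, MonoidAlgebra.one_def]

theorem isHomogeneousVec_single (s : Refl G) (r : k) :
    IsHomogeneousVec (yCoaction G) s.1 (0, Finsupp.single s r) := by
  rw [IsHomogeneousVec, yCoaction, LinearMap.coprod_apply, map_zero, zero_add,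
    Finsupp.lsum_single]
  rfl

theorem IsHomogeneousVec.coaction_eq {W : Type*} [AddCommGroup W] [Module k W]
    {H : Type*} [Group H] {δ : Quasicoaction k H W}
    {g : H} {x : W} (h : IsHomogeneousVec δ g x) : δ x = MonoidAlgebra.of k H g ⊗ₜ[k] x := h

/-- All three axioms are linear, so homogeneous vectors suffice; on [s] compatibility is (g s g⁻¹) g
= g s. -/
theorem isYetterDrinfeld_y : IsYetterDrinfeld R.yRep (yCoaction G) where
  compat g y := by
    induction y using YSpace.induction with
    | hadd x y hx hy => simp only [map_add, hx, hy]
    | hV v =>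
      rw [R.yRep_vec, (isHomogeneousVec_vec _).coaction_eq, (isHomogeneousVec_vec _).coaction_eq]
      simp
    | hs s r =>
      rw [R.yRep_single, (isHomogeneousVec_single _ _).coaction_eq,
        (isHomogeneousVec_single _ _).coaction_eq]
      simp [Refl.conj]
  coassoc y := by
    induction y using YSpace.induction with
    | hadd x y hx hy => simp only [map_add, hx, hy]
    | hV v => rw [(isHomogeneousVec_vec _).coaction_eq]; simp [(isHomogeneousVec_vec v).coaction_eq]
    | hs s r =>
      rw [(isHomogeneousVec_single _ _).coaction_eq]
      simp [(isHomogeneousVec_single s r).coaction_eq]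
  counit y := by
    induction y using YSpace.induction with
    | hadd x y hx hy => simp only [map_add, hx, hy, TensorProduct.tmul_add]
    | hV v => rw [(isHomogeneousVec_vec _).coaction_eq]; simp
    | hs s r => rw [(isHomogeneousVec_single _ _).coaction_eq]; simp

theorem isHomogeneousDual_vec (f : Module.Dual k V) :
    IsHomogeneousDual (yCoaction G) 1 (f ∘ₗ LinearMap.fst k V (Refl G →₀ k)) := by
  intro y
  induction y using YSpace.induction with
  | hadd x y hx hy => rw [← pairingₗ_apply, map_add, map_add, add_smul, pairingₗ_apply,
      pairingₗ_apply, hx, hy]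
  | hV v => rw [(isHomogeneousVec_vec v).pairing_eq]
  | hs s r => rw [(isHomogeneousVec_single s r).pairing_eq]; simp

theorem isHomogeneousDual_single (s : Refl G) :
    IsHomogeneousDual (yCoaction G) s.1 (Finsupp.lapply s ∘ₗ LinearMap.snd k V (Refl G →₀ k)) := by
  intro y
  induction y using YSpace.induction with
  | hadd x y hx hy => rw [← pairingₗ_apply, map_add, map_add, add_smul, pairingₗ_apply,
      pairingₗ_apply, hx, hy]
  | hV v => rw [(isHomogeneousVec_vec v).pairing_eq]; simp
  | hs s' r =>
    rw [(isHomogeneousVec_single s' r).pairing_eq]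
    by_cases h : s' = s
    · rw [h]
    · simp [h]

theorem isGrading_y [Finite (Refl G)] : IsGrading (yCoaction G) where
  span_vec := by
    refine eq_top_iff.2 fun y _ => ?_
    induction y using YSpace.induction with
    | hadd x y hx hy => exact Submodule.add_mem _ (hx trivial) (hy trivial)
    | hV v => exact Submodule.subset_span ⟨1, isHomogeneousVec_vec v⟩
    | hs s r => exact Submodule.subset_span ⟨s.1, isHomogeneousVec_single s r⟩
  span_dual := by
    have := Fintype.ofFinite (Refl G)
    refine eq_top_iff.2 fun f _ => ?_
    -- Finiteness of the set of reflections makes every functional a finite combination of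
    -- coordinate functionals, apart from its part on V.
    have hf : f = (f ∘ₗ LinearMap.inl k V (Refl G →₀ k)) ∘ₗ LinearMap.fst k V (Refl G →₀ k) +
        ∑ s : Refl G, f (0, Finsupp.single s 1) •
          (Finsupp.lapply s ∘ₗ LinearMap.snd k V (Refl G →₀ k)) := by
      classical
      ext
      · simp
      · simp [LinearMap.sum_apply, Finsupp.single_apply, Prod.mk_zero_zero]
    rw [hf]
    refine Submodule.add_mem _ (Submodule.subset_span ⟨1, isHomogeneousDual_vec _⟩) ?_
    exact Submodule.sum_mem _ fun s _ => Submodule.smul_mem _ _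
      (Submodule.subset_span ⟨s.1, isHomogeneousDual_single s⟩)

end Y

/-! ### The Cherednik relations generate a triangular ideal -/

section Cherednik

variable {k : Type u} [Field k] {V : Type v} [AddCommGroup V] [Module k V]
variable {G : Subgroup (LinearMap.GeneralLinearGroup k V)} [Fintype (Refl G)] (R : RootData G)
  (t : k) (c : Refl G → k)

theorem cherednikCoaction_apply (v : V) : cherednikCoaction G t c v =
    t • (1 : MonoidAlgebra k G) ⊗ₜ[k] v +
      ∑ s : Refl G, c s • MonoidAlgebra.of k G s.1 ⊗ₜ[k] (v - tautRep G s.1 v) := by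
  rw [cherednikCoaction, finsum_eq_sum_of_fintype]
  simp only [LinearMap.add_apply, LinearMap.sum_apply]
  rfl

theorem isQuasiYetterDrinfeld_cherednik (hc : ∀ (g : G) (s : Refl G), c (s.conj g) = c s) :
    IsQuasiYetterDrinfeld (tautRep G) (cherednikCoaction G t c) := by
  intro g v
  rw [cherednikCoaction_apply, cherednikCoaction_apply]
  simp only [map_add, map_sum, map_smul, TensorProduct.map_tmul, LinearMap.mulRight_apply,
    LinearMap.mulLeft_apply, one_mul, mul_one, LinearMap.id_apply]
  congr 1
  symm
  -- Reindex by s ↦ g s g⁻¹; the invariance of c matches the coefficients.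
  refine Fintype.sum_equiv
    ⟨Refl.conj g, Refl.conj g⁻¹, fun s => by rw [← Refl.conj_mul, inv_mul_cancel, Refl.conj_one],
      fun s => by rw [← Refl.conj_mul, mul_inv_cancel, Refl.conj_one]⟩ _ _ fun s => ?_
  change c s • _ = c (s.conj g) • (MonoidAlgebra.of k G (g * s.1 * g⁻¹) * MonoidAlgebra.of k G g)
    ⊗ₜ[k] (tautRep G g v - tautRep G (g * s.1 * g⁻¹) (tautRep G g v))
  rw [hc, ← map_mul, ← map_mul, inv_mul_cancel_right, tautRep_mul_apply, tautRep_inv_apply,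
    tautRep_mul_apply, map_sub]

theorem pairing_cherednik (f : Module.Dual k V) (v : V) : pairing (cherednikCoaction G t c) f v =
    (t * f v) • (1 : MonoidAlgebra k G) +
      ∑ s : Refl G, (c s * (R.root s v * f (R.coroot s))) • MonoidAlgebra.of k G s.1 := by
  rw [pairing, cherednikCoaction_apply]
  simp only [map_add, map_sum, map_smul, LinearMap.lTensor_tmul, TensorProduct.rid_tmul,
    R.refl_apply, sub_sub_cancel, smul_eq_mul, smul_smul]

local notation "δ" => cherednikCoaction G t c

/-- Each s in β(f, v) replaces v' by v' - ⟨α_s, v'⟩ α̌_s when it passes. Since its coefficient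
already contains ⟨α_s, v⟩, the defect is symmetric in v and v'. -/
theorem mid_pairing_mul (f : Module.Dual k V) (v v' : V) :
    mid (tautRep G) δ (pairing δ f v) * lower (tautRep G) δ (TensorAlgebra.ι k v') =
      lower (tautRep G) δ (TensorAlgebra.ι k v') * mid (tautRep G) δ (pairing δ f v) -
        ∑ s : Refl G, (c s * f (R.coroot s) * (R.root s v * R.root s v')) •
          (lower (tautRep G) δ (TensorAlgebra.ι k (R.coroot s)) *
            mid (tautRep G) δ (MonoidAlgebra.of k G s.1)) := by
  rw [pairing_cherednik R]
  simp only [map_add, map_sum, map_smul, add_mul, mul_add, Finset.sum_mul, Finset.mul_sum,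
    smul_mul_assoc, mul_smul_comm, mid_one, one_mul, mul_one, mid_mul_ι, R.refl_apply, map_sub,
    sub_mul, smul_sub, Finset.sum_sub_distrib, smul_smul, add_sub_assoc]
  refine congrArg₂ _ rfl (congrArg₂ _ rfl (Finset.sum_congr rfl fun s _ => congrArg₂ _ ?_ rfl))
  ring

/-- Expanding f v v' - v v' f leaves v β(f, v') + v' β(f, v) and the symmetric defect, so exchanging
v and v' changes nothing. -/
theorem commute_upper_commutator (f : Module.Dual k V) (v v' : V) :
    Commute (upper (tautRep G) δ (TensorAlgebra.ι k f))
      (lower (tautRep G) δ (TensorAlgebra.ι k v * TensorAlgebra.ι k v' -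
        TensorAlgebra.ι k v' * TensorAlgebra.ι k v)) := by
  obtain ⟨R⟩ := RootData.nonempty (G := G)
  have h : ∀ v v' : V, upper (tautRep G) δ (TensorAlgebra.ι k f) *
      (lower (tautRep G) δ (TensorAlgebra.ι k v) * lower (tautRep G) δ (TensorAlgebra.ι k v')) =
      lower (tautRep G) δ (TensorAlgebra.ι k v) * lower (tautRep G) δ (TensorAlgebra.ι k v') *
        upper (tautRep G) δ (TensorAlgebra.ι k f) +
      (lower (tautRep G) δ (TensorAlgebra.ι k v) * mid (tautRep G) δ (pairing δ f v') +
      lower (tautRep G) δ (TensorAlgebra.ι k v') * mid (tautRep G) δ (pairing δ f v)) -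
        ∑ s : Refl G, (c s * f (R.coroot s) * (R.root s v * R.root s v')) •
          (lower (tautRep G) δ (TensorAlgebra.ι k (R.coroot s)) *
            mid (tautRep G) δ (MonoidAlgebra.of k G s.1)) := by
    intro v v'
    rw [← mul_assoc, ι_mul_ι, add_mul, mul_assoc, ι_mul_ι, mid_pairing_mul R, mul_add]
    simp only [mul_assoc]
    abel
  rw [commute_iff_eq, map_sub, map_mul, map_mul, mul_sub, sub_mul, h v v', h v' v]
  simp only [mul_comm (R.root _ v)]
  abel

/-- Dual computation: f ∘ s = f - ⟨f, α̌_s⟩ α_s, and the defect is symmetric in f and f'. -/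
theorem upper_mul_mid_pairing (f f' : Module.Dual k V) (v : V) :
    upper (tautRep G) δ (TensorAlgebra.ι k f) * mid (tautRep G) δ (pairing δ f' v) =
      mid (tautRep G) δ (pairing δ f' v) * upper (tautRep G) δ (TensorAlgebra.ι k f) -
        ∑ s : Refl G, (c s * R.root s v * (f (R.coroot s) * f' (R.coroot s))) •
          (mid (tautRep G) δ (MonoidAlgebra.of k G s.1) *
            upper (tautRep G) δ (TensorAlgebra.ι k (R.root s))) := by
  have hf : ∀ s : Refl G, f ∘ₗ tautRep G s.1 = f - f (R.coroot s) • R.root s := by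
    intro s; ext x; simp [R.refl_apply, mul_comm]
  rw [pairing_cherednik R]
  simp only [map_add, map_sum, map_smul, add_mul, mul_add, Finset.sum_mul, Finset.mul_sum,
    smul_mul_assoc, mul_smul_comm, mid_one, one_mul, mul_one, ι_mul_mid, hf, map_sub,
    mul_sub, smul_sub, Finset.sum_sub_distrib, smul_smul, add_sub_assoc]
  refine congrArg₂ _ rfl (congrArg₂ _ rfl (Finset.sum_congr rfl fun s _ => congrArg₂ _ ?_ rfl))
  ring

theorem commute_commutator_lower (v : V) (f f' : Module.Dual k V) :
    Commute (upper (tautRep G) δ (TensorAlgebra.ι k f * TensorAlgebra.ι k f' -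
      TensorAlgebra.ι k f' * TensorAlgebra.ι k f))
      (lower (tautRep G) δ (TensorAlgebra.ι k v)) := by
  obtain ⟨R⟩ := RootData.nonempty (G := G)
  have h : ∀ f f' : Module.Dual k V, upper (tautRep G) δ (TensorAlgebra.ι k f) *
      upper (tautRep G) δ (TensorAlgebra.ι k f') * lower (tautRep G) δ (TensorAlgebra.ι k v) =
      lower (tautRep G) δ (TensorAlgebra.ι k v) * (upper (tautRep G) δ (TensorAlgebra.ι k f) *
        upper (tautRep G) δ (TensorAlgebra.ι k f')) +
      (mid (tautRep G) δ (pairing δ f v) * upper (tautRep G) δ (TensorAlgebra.ι k f') +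
      mid (tautRep G) δ (pairing δ f' v) * upper (tautRep G) δ (TensorAlgebra.ι k f)) -
        ∑ s : Refl G, (c s * R.root s v * (f (R.coroot s) * f' (R.coroot s))) •
          (mid (tautRep G) δ (MonoidAlgebra.of k G s.1) *
            upper (tautRep G) δ (TensorAlgebra.ι k (R.root s))) := by
    intro f f'
    rw [mul_assoc, ι_mul_ι, mul_add, ← mul_assoc, ι_mul_ι, upper_mul_mid_pairing R, add_mul]
    simp only [mul_assoc]
    abel
  rw [commute_iff_eq, map_sub, map_mul, map_mul, mul_sub, sub_mul, h f f', h f' f]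
  simp only [mul_comm (f (R.coroot _))]
  abel

theorem isTriangularIdeal_cherednik : IsTriangularIdeal (tautRep G) (cherednikCoaction G t c)
    (symKer k V) (symKer k (Module.Dual k V)) (cherednikIdeal G t c) := by
  exact isTriangularIdeal_span_commutators (commute_upper_commutator t c)
    (commute_commutator_lower t c)

end Cherednik

/-! ### Homomorphisms between free doubles and between braided doubles -/

section Morphism

variable {k G V W : Type*} [Field k] [Group G] [AddCommGroup V] [Module k V] [AddCommGroup W]
  [Module k W] {ρV : Representation k G V} {δV : Quasicoaction k G V}
  {ρW : Representation k G W} {δW : Quasicoaction k G W}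
  {μ : V →ₗ[k] W} {η : Module.Dual k V →ₗ[k] Module.Dual k W}

/-- `μ : V → W` and `η : V* → W*` are equivariant and preserve the `kG`-valued pairings. -/
structure IsCompatible (ρV : Representation k G V) (δV : Quasicoaction k G V)
    (ρW : Representation k G W) (δW : Quasicoaction k G W) (μ : V →ₗ[k] W)
    (η : Module.Dual k V →ₗ[k] Module.Dual k W) : Prop where
  map_act : ∀ g v, μ (ρV g v) = ρW g (μ v)
  map_dual : ∀ f g, η (f ∘ₗ ρV g) = η f ∘ₗ ρW g
  pairing_eq : ∀ f v, pairing δW (η f) (μ v) = pairing δV f v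

/-- The inclusion `kG → Ã(W, δ)` as an algebra homomorphism. -/
def midHom (ρ : Representation k G W) (δ : Quasicoaction k G W) :
    MonoidAlgebra k G →ₐ[k] FreeDouble ρ δ :=
  AlgHom.ofLinearMap (mid ρ δ) (mid_one ρ δ) (mid_mul ρ δ)

/-- The homomorphism `T(μ) ⊗ id ⊗ T(η)` of free doubles. -/
def FreeDouble.map (h : IsCompatible ρV δV ρW δW μ η) : FreeDouble ρV δV →ₐ[k] FreeDouble ρW δW :=
  FreeDouble.lift ρV δV ((lower ρW δW).toLinearMap ∘ₗ TensorAlgebra.ι k ∘ₗ μ) (midHom ρW δW)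
    ((upper ρW δW).toLinearMap ∘ₗ TensorAlgebra.ι k ∘ₗ η)
    (fun g v => by
      change mid ρW δW _ * lower ρW δW (TensorAlgebra.ι k (μ v)) =
        lower ρW δW (TensorAlgebra.ι k (μ (ρV g v))) * mid ρW δW _
      rw [mid_mul_ι, h.map_act])
    (fun f g => by
      change upper ρW δW (TensorAlgebra.ι k (η f)) * mid ρW δW _ =
        mid ρW δW _ * upper ρW δW (TensorAlgebra.ι k (η (f ∘ₗ ρV g)))
      rw [ι_mul_mid, h.map_dual])
    (fun f v => by
      change upper ρW δW (TensorAlgebra.ι k (η f)) * lower ρW δW (TensorAlgebra.ι k (μ v)) =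
        lower ρW δW (TensorAlgebra.ι k (μ v)) * upper ρW δW (TensorAlgebra.ι k (η f)) +
          mid ρW δW (pairing δV f v)
      rw [ι_mul_ι, h.pairing_eq])

theorem FreeDouble.map_lower (h : IsCompatible ρV δV ρW δW μ η)
    (a : TensorAlgebra k V) :
    FreeDouble.map h (lower ρV δV a) = lower ρW δW (tensorMap μ a) := by
  have : (FreeDouble.map h).comp (lower ρV δV) = (lower ρW δW).comp (tensorMap μ) := by
    ext v
    simp [FreeDouble.map]
  exact DFunLike.congr_fun this a

theorem FreeDouble.map_upper (h : IsCompatible ρV δV ρW δW μ η)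
    (b : TensorAlgebra k (Module.Dual k V)) :
    FreeDouble.map h (upper ρV δV b) = upper ρW δW (tensorMap η b) := by
  have : (FreeDouble.map h).comp (upper ρV δV) = (upper ρW δW).comp (tensorMap η) := by
    ext v
    simp [FreeDouble.map]
  exact DFunLike.congr_fun this b

theorem FreeDouble.map_tri (h : IsCompatible ρV δV ρW δW μ η)
    (a : TensorAlgebra k V) (y : MonoidAlgebra k G)
    (b : TensorAlgebra k (Module.Dual k V)) :
    FreeDouble.map h (tri ρV δV a y b) = tri ρW δW (tensorMap μ a) y (tensorMap η b) := by
  have hm : FreeDouble.map h (mid ρV δV y) = mid ρW δW y := FreeDouble.lift_mid ..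
  rw [tri, map_mul, map_mul, FreeDouble.map_lower, FreeDouble.map_upper, hm]
  rfl

theorem vacuum_map (h : IsCompatible ρV δV ρW δW μ η)
    (hV : IsQuasiYetterDrinfeld ρV δV) (hW : IsQuasiYetterDrinfeld ρW δW)
    (x : FreeDouble ρV δV) : vacuum hW (FreeDouble.map h x) = vacuum hV x := by
  induction x using FreeDouble.tri_induction with
  | h0 => simp
  | hadd x y hx hy => rw [map_add, map_add, map_add, hx, hy]
  | htri a y b =>
    rw [FreeDouble.map_tri, vacuum_tri, vacuum_tri, algebraMapInv_tensorMap,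
      algebraMapInv_tensorMap]

/-- T(μ) ⊗ id ⊗ T(η) respects ε ⊗ ε ⊗ ε, so compatible maps are isometric for the scalar pairings.
Consequently T(μ) and T(η) reflect radicals. -/
theorem form_tensorMap (h : IsCompatible ρV δV ρW δW μ η)
    (hV : IsQuasiYetterDrinfeld ρV δV) (hW : IsQuasiYetterDrinfeld ρW δW)
    (b : TensorAlgebra k (Module.Dual k V)) (a : TensorAlgebra k V) :
    form hW (tensorMap η b) (tensorMap μ a) = form hV b a := by
  rw [form, form, ← vacuum_map h hV hW, map_mul (FreeDouble.map h), FreeDouble.map_upper, FreeDouble.map_lower]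

theorem mem_lowerRadical_of_tensorMap (h : IsCompatible ρV δV ρW δW μ η)
    (hV : IsQuasiYetterDrinfeld ρV δV)
    (hW : IsQuasiYetterDrinfeld ρW δW) {a : TensorAlgebra k V}
    (ha : tensorMap μ a ∈ lowerRadical hW) : a ∈ lowerRadical hV := by
  rw [mem_lowerRadical] at ha ⊢
  intro b
  rw [← form_tensorMap h hV hW, ha]

theorem mem_upperRadical_of_tensorMap (h : IsCompatible ρV δV ρW δW μ η)
    (hV : IsQuasiYetterDrinfeld ρV δV)
    (hW : IsQuasiYetterDrinfeld ρW δW) {b : TensorAlgebra k (Module.Dual k V)}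
    (hb : tensorMap η b ∈ upperRadical hW) : b ∈ upperRadical hV := by
  rw [mem_upperRadical] at hb ⊢
  intro a
  rw [← form_tensorMap h hV hW, hb]

variable {Im : Submodule k (TensorAlgebra k V)} {Ip : Submodule k (TensorAlgebra k (Module.Dual k V))}
  {J : TwoSidedIdeal (FreeDouble ρV δV)} {Km : Submodule k (TensorAlgebra k W)}
  {Kp : Submodule k (TensorAlgebra k (Module.Dual k W))} {L : TwoSidedIdeal (FreeDouble ρW δW)}

theorem FreeDouble.map_mem (h : IsCompatible ρV δV ρW δW μ η)
    (hJ : IsTriangularIdeal ρV δV Im Ip J)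
    (hL : IsTriangularIdeal ρW δW Km Kp L) (hm : ∀ a ∈ Im, tensorMap μ a ∈ Km)
    (hp : ∀ b ∈ Ip, tensorMap η b ∈ Kp) {x : FreeDouble ρV δV} (hx : x ∈ J) :
    FreeDouble.map h x ∈ L := by
  rw [← SetLike.mem_coe, hJ.carrier_eq] at hx
  rw [← SetLike.mem_coe, hL.carrier_eq]
  induction hx using Submodule.span_induction with
  | mem x hx =>
    obtain ⟨a, y, b, hab, rfl⟩ := hx
    exact Submodule.subset_span ⟨_, y, _, hab.imp (hm a) (hp b), FreeDouble.map_tri h a y b⟩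
  | zero => rw [map_zero]; exact Submodule.zero_mem _
  | add x y _ _ hx hy => rw [map_add]; exact Submodule.add_mem _ hx hy
  | smul r x _ hx => rw [map_smul]; exact Submodule.smul_mem _ r hx

/-- Compatible maps induce a morphism of braided doubles. -/
theorem exists_isMorphism (h : IsCompatible ρV δV ρW δW μ η)
    (hJ : IsBraidedDouble ρV δV Im Ip J) (hL : IsBraidedDouble ρW δW Km Kp L)
    (hν : ∃ ν : W →ₗ[k] V, (∀ g, ν ∘ₗ ρW g = ρV g ∘ₗ ν) ∧ ν.dualMap = η)
    (hm : ∀ a ∈ Im, tensorMap μ a ∈ Km) (hp : ∀ b ∈ Ip, tensorMap η b ∈ Kp) :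
    ∃ Φ, IsMorphism ρV δV Im Ip J ρW δW Km Kp L μ η Φ := by
  let F := (toQuot ρW δW L).comp (FreeDouble.map h)
  have hF : ∀ x ∈ J, F x = 0 := fun x hx =>
    toQuot_eq_zero.2 (FreeDouble.map_mem h hJ.triangular hL.triangular hm hp hx)
  refine ⟨J.ringCon.liftₐ F fun x y hxy => ?_, hJ, hL, fun g => LinearMap.ext (h.map_act g), hν, hm,
    hp, fun a y b => ?_⟩
  · have := hF _ ((TwoSidedIdeal.rel_iff J x y).1 hxy)
    rw [map_sub, sub_eq_zero] at this
    exact this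
  · exact congrArg (toQuot ρW δW L) (FreeDouble.map_tri h a y b)

/-- A morphism of braided doubles is injective if it is so on the lower and the upper parts. -/
theorem IsMorphism.injective {Φ : QuotAlg ρV δV J →ₐ[k] QuotAlg ρW δW L}
    (hΦ : IsMorphism ρV δV Im Ip J ρW δW Km Kp L μ η Φ)
    (hm : ∀ a, tensorMap μ a ∈ Km → a ∈ Im) (hp : ∀ b, tensorMap η b ∈ Kp → b ∈ Ip) :
    Function.Injective Φ := by
  obtain ⟨e, he⟩ := hΦ.source.decomposition
  obtain ⟨e', he'⟩ := hΦ.target.decomposition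
  let qm : (TensorAlgebra k V ⧸ Im) →ₗ[k] (TensorAlgebra k W ⧸ Km) :=
    Im.mapQ Km (tensorMap μ).toLinearMap hΦ.map_lower
  let qp : (TensorAlgebra k (Module.Dual k V) ⧸ Ip) →ₗ[k] (TensorAlgebra k (Module.Dual k W) ⧸ Kp) :=
    Ip.mapQ Kp (tensorMap η).toLinearMap hΦ.map_upper
  have hqm : Function.Injective qm := by
    refine (injective_iff_map_eq_zero qm).2 fun x hx => ?_
    obtain ⟨a, rfl⟩ := Submodule.mkQ_surjective _ x
    exact (Submodule.Quotient.mk_eq_zero _).2 (hm a ((Submodule.Quotient.mk_eq_zero _).1 hx))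
  have hqp : Function.Injective qp := by
    refine (injective_iff_map_eq_zero qp).2 fun x hx => ?_
    obtain ⟨a, rfl⟩ := Submodule.mkQ_surjective _ x
    exact (Submodule.Quotient.mk_eq_zero _).2 (hp a ((Submodule.Quotient.mk_eq_zero _).1 hx))
  -- Over a field, tensor products of injective maps are injective; in the triangular decompositions
  -- Φ is this tensor product.
  have hq : Function.Injective
      (TensorProduct.map (TensorProduct.map qm (LinearMap.id (R := k) (M := MonoidAlgebra k G))) qp) :=
    TensorProduct.map_injective_of_flat_flat _ _
      (TensorProduct.map_injective_of_flat_flat _ _ hqm Function.injective_id) hqp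
  have hcomp : Φ.toLinearMap ∘ₗ e.toLinearMap = e'.toLinearMap ∘ₗ
      TensorProduct.map (TensorProduct.map qm (LinearMap.id (R := k) (M := MonoidAlgebra k G))) qp := by
    refine TensorProduct.ext_threefold fun x y z => ?_
    obtain ⟨a, rfl⟩ := Im.mkQ_surjective x
    obtain ⟨b, rfl⟩ := Ip.mkQ_surjective z
    change Φ (e _) = e' (Km.mkQ (tensorMap μ a) ⊗ₜ y ⊗ₜ Kp.mkQ (tensorMap η b))
    rw [he, he', hΦ.map_tri]
  intro x y hxy
  obtain ⟨x, rfl⟩ := e.surjective x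
  obtain ⟨y, rfl⟩ := e.surjective y
  have hx := LinearMap.congr_fun hcomp x
  have hy := LinearMap.congr_fun hcomp y
  have : e' (TensorProduct.map (TensorProduct.map qm LinearMap.id) qp x) =
      e' (TensorProduct.map (TensorProduct.map qm LinearMap.id) qp y) :=
    hx.symm.trans (hxy.trans hy)
  exact congrArg e (hq (e'.injective this))

end Morphism

/-! ### Commutators in Nichols–Woronowicz algebras -/

section Quadratic

variable {k : Type u} [Field k] {M : Type v} [AddCommGroup M] [Module k M]

/-- In degree two the braided integer is id + Ψ, so the hypothesis says that it kills the
commutator. -/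
theorem commutator_mem_worKer {Ψ : M ⊗[k] M →ₗ[k] M ⊗[k] M} {x y : M}
    (h : x ⊗ₜ[k] y + Ψ (x ⊗ₜ[k] y) = y ⊗ₜ[k] x + Ψ (y ⊗ₜ[k] x)) :
    TensorAlgebra.ι k x * TensorAlgebra.ι k y - TensorAlgebra.ι k y * TensorAlgebra.ι k x ∈
      worKer Ψ := by
  have hι : ∀ x y : M, braidedInteger Ψ (TensorAlgebra.ι k x * TensorAlgebra.ι k y) =
      legMul 1 (x ⊗ₜ[k] y + Ψ (x ⊗ₜ[k] y)) := by
    intro x y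
    have h1 : braidedInteger Ψ (TensorAlgebra.ι k x) = 1 ⊗ₜ[k] x := by
      have := braidedInteger_mul_ι Ψ 1 x
      rwa [one_mul, braidedInteger_one, TensorProduct.zero_tmul, map_zero, add_zero] at this
    rw [braidedInteger_mul_ι, h1, lastLegs_tmul, map_add, legMul_tmul, one_mul]
  refine mem_worKer_of_braidedInteger_eq_zero Ψ (by simp) ?_
  rw [map_sub, hι, hι, h, sub_self]

theorem tensorMap_mem_of_mem_symKer {N : Type*} [AddCommGroup N] [Module k N] (φ : M →ₗ[k] N)
    {S : Submodule k (TensorAlgebra k N)}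
    (hc : ∀ x y, TensorAlgebra.ι k (φ x) * TensorAlgebra.ι k (φ y) -
      TensorAlgebra.ι k (φ y) * TensorAlgebra.ι k (φ x) ∈ S)
    (hl : ∀ x, ∀ a ∈ S, TensorAlgebra.ι k x * a ∈ S)
    (hr : ∀ x, ∀ a ∈ S, a * TensorAlgebra.ι k x ∈ S) {a : TensorAlgebra k M}
    (ha : a ∈ symKer k M) : tensorMap φ a ∈ S := by
  have : symKer k M ≤ S.comap (tensorMap φ).toLinearMap := by
    refine symKer_le ?_ ?_ ?_
    · intro x y; simpa using hc x y
    · intro x a ha; simpa using hl (φ x) _ ha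
    · intro x a ha; simpa using hr (φ x) _ ha
  exact this ha

end Quadratic

/-! ### Compatibility and commutation for μ and ν* -/

section CherednikMorphism

variable {k : Type u} [Field k] {V : Type v} [AddCommGroup V] [Module k V]
variable {G : Subgroup (LinearMap.GeneralLinearGroup k V)} (R : RootData G)

/-- Compute g s v also as (g s g⁻¹) g v and compare the coefficients of the nonzero vector
α̌_{gsg⁻¹}. This gives the equivariance of μ. -/
theorem RootData.root_conj (g : G) (s : Refl G) (v : V) :
    R.root (s.conj g) (tautRep G g v) = R.cocycle g s * R.root s v := by
  have h := R.refl_apply (s.conj g) (tautRep G g v)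
  change tautRep G (g * s.1 * g⁻¹) (tautRep G g v) = _ at h
  rw [tautRep_mul_apply, tautRep_inv_apply, tautRep_mul_apply, R.refl_apply s v, map_sub, map_smul,
    sub_right_inj, R.cocycle_spec, smul_smul, mul_comm] at h
  exact (smul_left_injective k (R.coroot_ne _) h).symm

theorem RootData.nuStar_vec (f : Module.Dual k V) (v : V) : R.nuStar f (v, 0) = f v := by
  simp [RootData.nuStar]

theorem RootData.nuStar_single (f : Module.Dual k V) (s : Refl G) (r : k) :
    R.nuStar f (0, Finsupp.single s r) = r * f (R.coroot s) := by
  simp [RootData.nuStar]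

theorem RootData.nuStar_comp (f : Module.Dual k V) (g : G) :
    R.nuStar (f ∘ₗ tautRep G g) = R.nuStar f ∘ₗ R.yRep g := by
  refine LinearMap.ext fun y => ?_
  induction y using YSpace.induction with
  | hadd x y hx hy => rw [map_add, map_add, hx, hy]
  | hV v =>
    change _ = R.nuStar f (R.yRep g _)
    rw [R.nuStar_vec, R.yRep_vec, R.nuStar_vec]; rfl
  | hs s r =>
    change _ = R.nuStar f (R.yRep g _)
    rw [R.nuStar_single, R.yRep_single, R.nuStar_single, LinearMap.comp_apply, R.cocycle_spec,
      map_smul, smul_eq_mul]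
    ring

theorem RootData.exists_nu : ∃ ν : YSpace G →ₗ[k] V, (∀ g, ν ∘ₗ R.yRep g = tautRep G g ∘ₗ ν) ∧
    ν.dualMap = R.nuStar := by
  -- ν is the identity on V and sends [s] to α̌_s.
  refine ⟨LinearMap.coprod LinearMap.id (Finsupp.linearCombination k R.coroot), fun g => ?_, ?_⟩
  · refine LinearMap.ext fun y => ?_
    induction y using YSpace.induction with
    | hadd x y hx hy => rw [map_add, map_add, hx, hy]
    | hV v => rw [LinearMap.comp_apply, R.yRep_vec]; simp
    | hs s r =>
      rw [LinearMap.comp_apply, R.yRep_single]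
      simp only [LinearMap.coprod_apply, LinearMap.comp_apply, map_zero, zero_add, map_smul,
        Finsupp.linearCombination_single, R.cocycle_spec, smul_smul, mul_comm]
  · refine LinearMap.ext fun f => LinearMap.ext fun y => ?_
    induction y using YSpace.induction with
    | hadd x y hx hy => rw [map_add, map_add, hx, hy]
    | hV v => simp [R.nuStar_vec]
    | hs s r => simp [R.nuStar_single]

variable (G) in
/-- The projection `Y_S(G) → V`, as a map `V* → Y_S(G)*`. -/
def fstStar : Module.Dual k V →ₗ[k] Module.Dual k (YSpace G) :=
  (LinearMap.fst k V (Refl G →₀ k)).dualMap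

theorem fstStar_apply (f : Module.Dual k V) (y : YSpace G) : fstStar G f y = f y.1 := rfl

theorem isHomogeneousDual_fstStar (f : Module.Dual k V) :
    IsHomogeneousDual (yCoaction G) 1 (fstStar G f) := isHomogeneousDual_vec f

variable [Fintype (Refl G)]

theorem RootData.nuStar_eq (f : Module.Dual k V) : R.nuStar f = fstStar G f +
    ∑ s : Refl G, f (R.coroot s) • (Finsupp.lapply s ∘ₗ LinearMap.snd k V (Refl G →₀ k)) := by
  classical
  refine LinearMap.ext fun y => ?_
  induction y using YSpace.induction with
  | hadd x y hx hy => rw [map_add, map_add, hx, hy]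
  | hV v => simp [R.nuStar_vec, fstStar_apply, LinearMap.sum_apply]
  | hs s r =>
    simp [R.nuStar_single, fstStar_apply, LinearMap.sum_apply, Finsupp.single_apply, mul_comm]

/-- Splitting ν*(f') into homogeneous parts, Ψ* exchanges ν*(f) and ν*(f') up to the term Σ ⟨f,
α̌_s⟩⟨f', α̌_s⟩ [s]* ⊗ ν*(α_s), which is symmetric in f and f'. -/
theorem RootData.nuStar_commutator_mem_worKer [FiniteDimensional k V] (f f' : Module.Dual k V) :
    TensorAlgebra.ι k (R.nuStar f) * TensorAlgebra.ι k (R.nuStar f') -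
      TensorAlgebra.ι k (R.nuStar f') * TensorAlgebra.ι k (R.nuStar f) ∈
        worKer (dualBraiding R.yBraiding) := by
  let q : Refl G → Module.Dual k (YSpace G) :=
    fun s => Finsupp.lapply s ∘ₗ LinearMap.snd k V (Refl G →₀ k)
  have h : ∀ f f' : Module.Dual k V, dualBraiding R.yBraiding (R.nuStar f ⊗ₜ[k] R.nuStar f') =
      R.nuStar f' ⊗ₜ[k] R.nuStar f - ∑ s : Refl G, (f (R.coroot s) * f' (R.coroot s)) •
        q s ⊗ₜ[k] R.nuStar (R.root s) := by
    intro f f'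
    have hs : ∀ s : Refl G, dualBraiding R.yBraiding (R.nuStar f ⊗ₜ[k] (f' (R.coroot s) • q s)) =
        (f' (R.coroot s) • q s) ⊗ₜ[k] R.nuStar f - (f (R.coroot s) * f' (R.coroot s)) •
          q s ⊗ₜ[k] R.nuStar (R.root s) := by
      intro s
      have hf : f ∘ₗ tautRep G s.1 = f - f (R.coroot s) • R.root s := by
        ext x; simp [R.refl_apply, mul_comm]
      rw [TensorProduct.tmul_smul, map_smul, RootData.yBraiding,
        (isHomogeneousDual_single s).dualBraiding_tmul (isGrading_y (G := G)), ← R.nuStar_comp, hf, map_sub,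
        map_smul, TensorProduct.tmul_sub, TensorProduct.tmul_smul, smul_sub, smul_smul,
        ← TensorProduct.smul_tmul', mul_comm]
    have h1 : dualBraiding R.yBraiding (R.nuStar f ⊗ₜ[k] fstStar G f') =
        fstStar G f' ⊗ₜ[k] R.nuStar f := by
      rw [RootData.yBraiding, (isHomogeneousDual_fstStar f').dualBraiding_tmul (isGrading_y (G := G)), map_one]
      rfl
    have hsum : ∑ s : Refl G, dualBraiding R.yBraiding (R.nuStar f ⊗ₜ[k] (f' (R.coroot s) • q s)) =
        (∑ s : Refl G, (f' (R.coroot s) • q s) ⊗ₜ[k] R.nuStar f) -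
          ∑ s : Refl G, (f (R.coroot s) * f' (R.coroot s)) • q s ⊗ₜ[k] R.nuStar (R.root s) := by
      rw [Finset.sum_congr rfl fun s _ => hs s]
      exact Finset.sum_sub_distrib (G := Module.Dual k (YSpace G) ⊗[k] Module.Dual k (YSpace G)) _ _
    conv_lhs => rw [R.nuStar_eq f']
    rw [TensorProduct.tmul_add, TensorProduct.tmul_sum, map_add, map_sum, h1, hsum,
      ← TensorProduct.sum_tmul,
      ← add_sub_assoc, ← TensorProduct.add_tmul, ← R.nuStar_eq]
  refine commutator_mem_worKer ?_
  rw [h f f', h f' f]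
  simp only [mul_comm (f (R.coroot _))]
  abel

/-- A second partner for ν*: vectors of V have degree 1, so only ⟨f, v⟩ · 1 survives. It serves the
injectivity of the upper half. -/
theorem RootData.isCompatible_inl :
    IsCompatible (tautRep G) (cherednikCoaction G (1 : k) 0) R.yRep (yCoaction G)
      (LinearMap.inl k V (Refl G →₀ k)) R.nuStar where
  map_act g v := (R.yRep_vec g v).symm
  map_dual := R.nuStar_comp
  pairing_eq f v := by
    rw [LinearMap.inl_apply, (isHomogeneousVec_vec _).pairing_eq, pairing_cherednik R, R.nuStar_vec]
    simp [MonoidAlgebra.one_def]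

variable [Finite G] (t : k) (c : Refl G → k)

theorem RootData.mu_eq (v : V) : R.mu t c v = (t • v, 0) +
    ∑ s : Refl G, (0, Finsupp.single s (c s * R.root s v)) := by
  classical
  have h : ∀ φ : Refl G →₀ k, ((0, φ) : YSpace G) = LinearMap.inr k V (Refl G →₀ k) φ :=
    fun _ => rfl
  simp only [h, ← map_sum]
  rw [LinearMap.inr_apply, Prod.mk_add_mk, add_zero, zero_add]
  refine Prod.ext rfl (Finsupp.ext fun r => ?_)
  rw [Finsupp.finsetSum_apply]
  simp [RootData.mu, Finsupp.single_apply]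

variable {c}

theorem RootData.mu_act (hc : ∀ (g : G) (s : Refl G), c (s.conj g) = c s) (g : G) (v : V) :
    R.mu t c (tautRep G g v) = R.yRep g (R.mu t c v) := by
  rw [R.mu_eq, R.mu_eq, map_add, map_sum, R.yRep_vec, map_smul]
  refine congrArg₂ _ rfl (Fintype.sum_equiv
    ⟨Refl.conj g, Refl.conj g⁻¹, fun s => by rw [← Refl.conj_mul, inv_mul_cancel, Refl.conj_one],
      fun s => by rw [← Refl.conj_mul, mul_inv_cancel, Refl.conj_one]⟩ _ _ fun s => ?_).symm
  change R.yRep g _ =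
    (0, Finsupp.single (s.conj g) (c (s.conj g) * R.root (s.conj g) (tautRep G g v)))
  rw [R.yRep_single, hc, R.root_conj, mul_left_comm]

theorem RootData.pairing_mu (f : Module.Dual k (YSpace G)) (v : V) :
    pairing (yCoaction G) f (R.mu t c v) = (t * f (v, 0)) • (1 : MonoidAlgebra k G) +
      ∑ s : Refl G, (c s * R.root s v * f (0, Finsupp.single s 1)) • MonoidAlgebra.of k G s.1 := by
  rw [R.mu_eq, ← pairingₗ_apply, map_add, map_sum, pairingₗ_apply,
    (isHomogeneousVec_vec _).pairing_eq, map_one]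
  simp only [pairingₗ_apply, (isHomogeneousVec_single _ _).pairing_eq]
  have h1 : ((t • v, 0) : YSpace G) = t • (v, 0) := by simp
  have h2 : ∀ (s : Refl G) (r : k), ((0, Finsupp.single s r) : YSpace G) =
      r • (0, Finsupp.single s 1) := fun s r => by simp
  rw [h1, map_smul, smul_eq_mul]
  refine congrArg₂ _ rfl (Finset.sum_congr rfl fun s _ => ?_)
  rw [h2, map_smul, smul_eq_mul]

theorem RootData.isCompatible (hc : ∀ (g : G) (s : Refl G), c (s.conj g) = c s) :
    IsCompatible (tautRep G) (cherednikCoaction G t c) R.yRep (yCoaction G) (R.mu t c) R.nuStar where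
  map_act := R.mu_act t hc
  map_dual := R.nuStar_comp
  pairing_eq f v := by
    rw [R.pairing_mu, pairing_cherednik R, R.nuStar_vec]
    simp only [R.nuStar_single, one_mul, mul_assoc]

/-- A second partner for μ: f ∘ pr_V ignores all [s], which leaves t⟨f, v⟩ · 1. It serves the
injectivity of the lower half. -/
theorem RootData.isCompatible_fstStar (hc : ∀ (g : G) (s : Refl G), c (s.conj g) = c s) :
    IsCompatible (tautRep G) (cherednikCoaction G t 0) R.yRep (yCoaction G) (R.mu t c)
      (fstStar G) where
  map_act := R.mu_act t hc
  map_dual f g := rfl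
  pairing_eq f v := by
    rw [R.pairing_mu, pairing_cherednik R]
    simp [fstStar_apply]

/-- The component of μ(v) at [s] acts on μ(v') by s, and by equivariance this subtracts ⟨α_s, v'⟩
μ(α̌_s). The total correction to the flip is symmetric in v and v'. -/
theorem RootData.mu_commutator_mem_worKer (hc : ∀ (g : G) (s : Refl G), c (s.conj g) = c s)
    (v v' : V) : TensorAlgebra.ι k (R.mu t c v) * TensorAlgebra.ι k (R.mu t c v') -
      TensorAlgebra.ι k (R.mu t c v') * TensorAlgebra.ι k (R.mu t c v) ∈ worKer R.yBraiding := by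
  have h : ∀ v v' : V, R.yBraiding (R.mu t c v ⊗ₜ[k] R.mu t c v') =
      R.mu t c v' ⊗ₜ[k] R.mu t c v - ∑ s : Refl G, (c s * (R.root s v * R.root s v')) •
        R.mu t c (R.coroot s) ⊗ₜ[k] ((0, Finsupp.single s 1) : YSpace G) := by
    intro v v'
    have hs : ∀ s : Refl G, R.yBraiding
        (((0, Finsupp.single s (c s * R.root s v)) : YSpace G) ⊗ₜ[k] R.mu t c v') =
        R.mu t c v' ⊗ₜ[k] ((0, Finsupp.single s (c s * R.root s v)) : YSpace G) -
        (c s * (R.root s v * R.root s v')) •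
        R.mu t c (R.coroot s) ⊗ₜ[k] ((0, Finsupp.single s 1) : YSpace G) := by
      intro s
      have h2 : ((0, Finsupp.single s (c s * R.root s v)) : YSpace G) =
        (c s * R.root s v) • (0, Finsupp.single s 1) := by simp
      rw [RootData.yBraiding, (isHomogeneousVec_single s _).braiding_tmul, ← R.mu_act t hc,
        R.refl_apply, map_sub, TensorProduct.sub_tmul, map_smul, h2, TensorProduct.tmul_smul,
        ← TensorProduct.smul_tmul', TensorProduct.tmul_smul, smul_smul]
      congr 2
      ring
    have h1 : R.yBraiding (((t • v, 0) : YSpace G) ⊗ₜ[k] R.mu t c v') =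
        R.mu t c v' ⊗ₜ[k] ((t • v, 0) : YSpace G) := by
      rw [RootData.yBraiding, (isHomogeneousVec_vec _).braiding_tmul, map_one]; rfl
    have hsum : ∑ s : Refl G, R.yBraiding
        (((0, Finsupp.single s (c s * R.root s v)) : YSpace G) ⊗ₜ[k] R.mu t c v') =
        (∑ s : Refl G, R.mu t c v' ⊗ₜ[k]
          ((0, Finsupp.single s (c s * R.root s v)) : YSpace G)) -
        ∑ s : Refl G, (c s * (R.root s v * R.root s v')) •
          R.mu t c (R.coroot s) ⊗ₜ[k] ((0, Finsupp.single s 1) : YSpace G) := by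
      rw [Finset.sum_congr rfl fun s _ => hs s]
      exact Finset.sum_sub_distrib (G := YSpace G ⊗[k] YSpace G) _ _
    conv_lhs => rw [R.mu_eq t c v]
    rw [TensorProduct.add_tmul, TensorProduct.sum_tmul, map_add, map_sum, h1, hsum,
      ← TensorProduct.tmul_sum,
      ← add_sub_assoc, ← TensorProduct.tmul_add, ← R.mu_eq]
  refine commutator_mem_worKer ?_
  rw [h v v', h v' v]
  simp only [mul_comm (R.root _ v)]
  abel

end CherednikMorphism

/-! ### Nondegeneracy of the polynomial pairing in characteristic zero -/

section Polynomial

variable {k : Type u} [Field k] {M : Type v} [AddCommGroup M] [Module k M] {I : Type*}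
  (B : Module.Basis I k M)

/-- The homomorphism `T(M) → k[x_i]` attached to a basis of `M`. -/
def toMvPolynomial : TensorAlgebra k M →ₐ[k] MvPolynomial I k :=
  (SymmetricAlgebra.equivMvPolynomial B).toAlgHom.comp (SymmetricAlgebra.algHom k M)

theorem toMvPolynomial_eq_zero {a : TensorAlgebra k M} :
    toMvPolynomial B a = 0 ↔ a ∈ symKer k M := by
  rw [symKer, LinearMap.mem_ker, AlgHom.toLinearMap_apply]
  exact map_eq_zero_iff _ (SymmetricAlgebra.equivMvPolynomial B).injective

theorem toMvPolynomial_basis (i : I) :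
    toMvPolynomial B (TensorAlgebra.ι k (B i)) = MvPolynomial.X i :=
  SymmetricAlgebra.equivMvPolynomial_ι_apply B i

theorem coeff_zero_toMvPolynomial (a : TensorAlgebra k M) :
    MvPolynomial.coeff 0 (toMvPolynomial B a) = TensorAlgebra.algebraMapInv (R := k) a := by
  have : (MvPolynomial.aeval (0 : I → k)).comp (toMvPolynomial B) =
      TensorAlgebra.algebraMapInv (R := k) := by
    apply TensorAlgebra.hom_ext
    refine B.ext fun i => ?_
    simp [toMvPolynomial_basis]
  rw [← this]
  simp [MvPolynomial.constantCoeff_eq]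

theorem pderiv_toMvPolynomial_ι (i : I) (x : M) :
    MvPolynomial.pderiv i (toMvPolynomial B (TensorAlgebra.ι k x)) =
      MvPolynomial.C (B.coord i x) := by
  classical
  have : (MvPolynomial.pderiv (R := k) i).toLinearMap ∘ₗ (toMvPolynomial B).toLinearMap ∘ₗ
      TensorAlgebra.ι k = (Algebra.linearMap k (MvPolynomial I k)) ∘ₗ B.coord i := by
    refine B.ext fun j => ?_
    simp [toMvPolynomial_basis, Pi.single_apply, Finsupp.single_apply, MvPolynomial.pderiv_X, eq_comm]
  exact LinearMap.congr_fun this x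

/-- A set of tensors of augmentation zero that is stable under partial derivatives, up to nonzero
scalars and commutators, lies in the ideal generated by commutators. -/
theorem mem_symKer_of_pderiv [CharZero k] {t : k} (ht : t ≠ 0) {S : Set (TensorAlgebra k M)}
    (h0 : ∀ a ∈ S, TensorAlgebra.algebraMapInv (R := k) a = 0)
    (h : ∀ a ∈ S, ∀ i, ∃ a' ∈ S, toMvPolynomial B a' =
      t • MvPolynomial.pderiv i (toMvPolynomial B a)) {a : TensorAlgebra k M} (ha : a ∈ S) :
    a ∈ symKer k M := by
  -- The coefficient of t ∂_i p at m is t (m_i + 1) times that of p at m + e_i, and this factor is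
  -- invertible in characteristic zero. Starting from the constant terms, all coefficients vanish.
  have hstep : ∀ (i : I) (m : I →₀ ℕ),
      (∀ a ∈ S, MvPolynomial.coeff m (toMvPolynomial B a) = 0) →
      ∀ a ∈ S, MvPolynomial.coeff (m + Finsupp.single i 1) (toMvPolynomial B a) = 0 := by
    intro i m hm a ha
    obtain ⟨a', ha', he⟩ := h a ha i
    have := hm a' ha'
    rw [he, MvPolynomial.coeff_smul, MvPolynomial.coeff_pderiv, smul_eq_mul] at this
    have hne : ((m i : k) + 1) ≠ 0 := by exact_mod_cast Nat.succ_ne_zero (m i)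
    simpa [ht, hne] using this
  have hall : ∀ (m m' : I →₀ ℕ),
      (∀ a ∈ S, MvPolynomial.coeff m' (toMvPolynomial B a) = 0) →
      ∀ a ∈ S, MvPolynomial.coeff (m' + m) (toMvPolynomial B a) = 0 := by
    intro m
    induction m using Finsupp.induction_linear with
    | zero => intro m' h; simpa using h
    | add f g hf hg => intro m' h; rw [← add_assoc]; exact hg _ (hf _ h)
    | single i n =>
      induction n with
      | zero => intro m' h; simpa using h
      | succ n ih =>
        intro m' h
        rw [Finsupp.single_add, ← add_assoc]
        exact hstep i _ (ih m' h)
  rw [← toMvPolynomial_eq_zero B]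
  ext m
  have := hall m 0 (fun a ha => by rw [coeff_zero_toMvPolynomial, h0 a ha]) a ha
  rwa [zero_add] at this

end Polynomial

/-! ### Radicals of Weyl algebra pairings -/

section Weyl

variable {k : Type u} [Field k] {G : Type v} [Group G] {W : Type w} [AddCommGroup W] [Module k W]
  {ρ : Representation k G W} {δ : Quasicoaction k G W} {t : k} {I : Type*}

/-- With scalar β the commutator with the i-th coordinate functional obeys the ordinary Leibniz
rule, so its image in the polynomial ring is t ∂_i. -/
theorem exists_lower_deriv (hδ : ∀ f v, pairing δ f v = (t * f v) • (1 : MonoidAlgebra k G))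
    (B : Module.Basis I k W) (i : I) (a : TensorAlgebra k W) :
    ∃ a', upper ρ δ (TensorAlgebra.ι k (B.coord i)) * lower ρ δ a =
      lower ρ δ a * upper ρ δ (TensorAlgebra.ι k (B.coord i)) + lower ρ δ a' ∧
      toMvPolynomial B a' = t • MvPolynomial.pderiv i (toMvPolynomial B a) := by
  induction a using leftInduction with
  | hadd x y hx hy =>
    obtain ⟨x', hx, hx'⟩ := hx
    obtain ⟨y', hy, hy'⟩ := hy
    refine ⟨x' + y', ?_, ?_⟩
    · rw [map_add, map_add, mul_add, add_mul, hx, hy]; abel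
    · rw [map_add, map_add, map_add, smul_add, hx', hy']
  | hsmul r x hx =>
    obtain ⟨x', hx, hx'⟩ := hx
    refine ⟨r • x', ?_, ?_⟩
    · rw [map_smul, map_smul, mul_smul_comm, smul_mul_assoc, hx, smul_add]
    · rw [map_smul, map_smul, Derivation.map_smul, hx', smul_comm]
  | h1 => exact ⟨0, by simp, by simp⟩
  | h v a ha =>
    obtain ⟨a', ha, ha'⟩ := ha
    refine ⟨TensorAlgebra.ι k v * a' + (t * B.coord i v) • a, ?_, ?_⟩
    · rw [map_mul, ← mul_assoc, ι_mul_ι, hδ, map_smul, mid_one, add_mul, mul_assoc, ha, map_add,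
        map_mul, map_smul, smul_mul_assoc, one_mul, mul_add]
      simp only [mul_assoc, add_assoc]
    · rw [map_add, map_mul, map_smul, ha', map_mul, Derivation.leibniz, pderiv_toMvPolynomial_ι,
        smul_add, smul_eq_mul, smul_eq_mul, mul_smul_comm, mul_comm (toMvPolynomial B a),
        ← MvPolynomial.smul_eq_C_mul, smul_smul]

theorem exists_upper_deriv (hδ : ∀ f v, pairing δ f v = (t * f v) • (1 : MonoidAlgebra k G))
    (B : Module.Basis I k (Module.Dual k W)) (i : I) (v : W) (hv : ∀ f, B.coord i f = f v)
    (b : TensorAlgebra k (Module.Dual k W)) :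
    ∃ b', upper ρ δ b * lower ρ δ (TensorAlgebra.ι k v) =
      lower ρ δ (TensorAlgebra.ι k v) * upper ρ δ b + upper ρ δ b' ∧
      toMvPolynomial B b' = t • MvPolynomial.pderiv i (toMvPolynomial B b) := by
  induction b using rightInduction with
  | hadd x y hx hy =>
    obtain ⟨x', hx, hx'⟩ := hx
    obtain ⟨y', hy, hy'⟩ := hy
    refine ⟨x' + y', ?_, ?_⟩
    · rw [map_add, map_add, mul_add, add_mul, hx, hy]; abel
    · rw [map_add, map_add, map_add, smul_add, hx', hy']
  | hsmul r x hx =>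
    obtain ⟨x', hx, hx'⟩ := hx
    refine ⟨r • x', ?_, ?_⟩
    · rw [map_smul, map_smul, mul_smul_comm, smul_mul_assoc, hx, smul_add]
    · rw [map_smul, map_smul, Derivation.map_smul, hx', smul_comm]
  | h1 => exact ⟨0, by simp, by simp⟩
  | h f b hb =>
    obtain ⟨b', hb, hb'⟩ := hb
    refine ⟨b' * TensorAlgebra.ι k f + (t * f v) • b, ?_, ?_⟩
    · rw [map_mul, mul_assoc, ι_mul_ι, hδ, map_smul, mid_one, mul_add, ← mul_assoc, hb, map_add,
        map_mul, map_smul, mul_smul_comm, mul_one, add_mul]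
      simp only [mul_assoc, add_assoc]
    · rw [map_add, map_mul, map_smul, hb', map_mul, Derivation.leibniz, pderiv_toMvPolynomial_ι, hv,
        smul_add, smul_eq_mul, smul_eq_mul, smul_mul_assoc, mul_comm _ (MvPolynomial.C _),
        ← MvPolynomial.smul_eq_C_mul, smul_smul, add_comm, mul_comm (toMvPolynomial B _)]

variable [CharZero k] [FiniteDimensional k W] (hq : IsQuasiYetterDrinfeld ρ δ)

/-- Testing a against b f shows that the radical is stable under the lifts of t ∂_i, and its
elements have augmentation zero. -/
theorem lowerRadical_le_symKer (ht : t ≠ 0)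
    (hδ : ∀ f v, pairing δ f v = (t * f v) • (1 : MonoidAlgebra k G)) :
    lowerRadical hq ≤ symKer k W := by
  intro a ha
  refine mem_symKer_of_pderiv (Module.finBasis k W) ht (S := {a | a ∈ lowerRadical hq})
    (fun a ha => lowerRadical_le_positivePart hq ha) (fun a ha i => ?_) ha
  obtain ⟨a', h, h'⟩ := exists_lower_deriv (ρ := ρ) hδ (Module.finBasis k W) i a
  refine ⟨a', (mem_lowerRadical hq).2 fun b => ?_, h'⟩
  have := (mem_lowerRadical hq).1 ha (b * TensorAlgebra.ι k ((Module.finBasis k W).coord i))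
  rwa [form, map_mul (upper ρ δ), mul_assoc, h, mul_add, map_add, ← mul_assoc, vacuum_mul_upper,
    zero_add] at this

theorem upperRadical_le_symKer (ht : t ≠ 0)
    (hδ : ∀ f v, pairing δ f v = (t * f v) • (1 : MonoidAlgebra k G)) :
    upperRadical hq ≤ symKer k (Module.Dual k W) := by
  intro b hb
  have hB : ∀ i f, (Module.finBasis k W).dualBasis.coord i f = f (Module.finBasis k W i) := by
    intro i f
    simp [Module.Basis.coord_apply]
  refine mem_symKer_of_pderiv (Module.finBasis k W).dualBasis ht (S := {b | b ∈ upperRadical hq})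
    (fun b hb => upperRadical_le_positivePart hq hb) (fun b hb i => ?_) hb
  obtain ⟨b', h, h'⟩ := exists_upper_deriv (ρ := ρ) hδ _ i _ (hB i) b
  refine ⟨b', (mem_upperRadical hq).2 fun a => ?_, h'⟩
  have := (mem_upperRadical hq).1 hb (TensorAlgebra.ι k (Module.finBasis k W i) * a)
  rwa [form, map_mul (lower ρ δ), ← mul_assoc, h, add_mul, map_add, mul_assoc, vacuum_lower_mul,
    zero_add] at this

end Weyl

end BraidedDouble

end

/-! ### The morphism of braided doubles and its injectivity -/

open BraidedDouble in
theorem theoremG {k : Type*} [Field k] {V : Type*} [AddCommGroup V] [Module k V]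
    [FiniteDimensional k V] (G : Subgroup (LinearMap.GeneralLinearGroup k V)) [Finite G]
    (R : RootData G) (t : k) (c : Refl G → k) (hc : ∀ (g : G) (s : Refl G), c (s.conj g) = c s) :
    IsYetterDrinfeld R.yRep (yCoaction G) ∧
    ∃ Φ : CherednikAlgebra G t c →ₐ[k] R.HeisenbergDouble,
      IsMorphism
        (tautRep G) (cherednikCoaction G t c)
        (symKer k V) (symKer k (Module.Dual k V)) (cherednikIdeal G t c)
        R.yRep (yCoaction G)
        (worKer R.yBraiding) (worKer (dualBraiding R.yBraiding))
        (maximalTriangularIdeal R.yRep (yCoaction G))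
        (R.mu t c) R.nuStar Φ ∧
      (t ≠ 0 → CharZero k → Function.Injective Φ) := by
  have : Fintype (Refl G) := Fintype.ofFinite _
  have hY : IsYetterDrinfeld R.yRep (yCoaction G) := isYetterDrinfeld_y R
  have hδ : IsGrading (yCoaction G) := isGrading_y
  have hlow : lowerRadical hY.compat = worKer R.yBraiding := lowerRadical_eq_worKer hδ hY.compat
  have hupp : upperRadical hY.compat = worKer (dualBraiding R.yBraiding) :=
    upperRadical_eq_worKer hδ hY.compat
  have hsource := (isTriangularIdeal_cherednik t c).isBraidedDouble
    (isQuasiYetterDrinfeld_cherednik t c hc)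
  have htarget := (isTriangularIdeal_maximal hδ hY.compat).isBraidedDouble hY.compat
  have hIm := isLowerIdeal_lowerRadical (hq := hY.compat) hδ
  have hIp := isUpperIdeal_upperRadical (hq := hY.compat) hδ
  rw [hlow] at hIm htarget
  rw [hupp] at hIp htarget
  obtain ⟨Φ, hΦ⟩ := exists_isMorphism (R.isCompatible t hc) hsource htarget R.exists_nu
    (fun a ha => tensorMap_mem_of_mem_symKer _ (R.mu_commutator_mem_worKer t hc) hIm.ι_mul_mem
      (fun x a ha => hIm.mul_mem a ha _) ha)
    (fun b hb => tensorMap_mem_of_mem_symKer _ R.nuStar_commutator_mem_worKer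
      (fun x b hb => hIp.mul_mem b hb _) hIp.mul_ι_mem hb)
  refine ⟨hY, Φ, hΦ, fun ht hk => hΦ.injective (fun a ha => ?_) (fun b hb => ?_)⟩
  · rw [← hlow] at ha
    -- `fstStar` pairs with μ as in the double with parameters (t, 0), so the lower radical there
    -- controls the kernel of T(μ).
    have hq := isQuasiYetterDrinfeld_cherednik t (0 : Refl G → k) fun _ _ => rfl
    refine lowerRadical_le_symKer hq ht (fun f v => ?_)
      (mem_lowerRadical_of_tensorMap (R.isCompatible_fstStar t hc) hq hY.compat ha)
    simp [pairing_cherednik R]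
  · rw [← hupp] at hb
    -- The inclusion of V pairs with ν* as in the double with parameters (1, 0), so the nonzero
    -- scalar here is 1.
    have hq := isQuasiYetterDrinfeld_cherednik (1 : k) (0 : Refl G → k) fun _ _ => rfl
    refine upperRadical_le_symKer hq one_ne_zero (fun f v => ?_)
      (mem_upperRadical_of_tensorMap R.isCompatible_inl hq hY.compat hb)
    simp [pairing_cherednik R]
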